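/- **Setting.** A vector-valued MDP (VMDP) $\mathcal M=(\mathcal S,\mathcal A,H,\Pr,\mathbf r)$ has measurable state and action spaces (possibly infinite), horizon $H\ge 1$, transition kernels $\Pr_h(\cdot\mid s,a)$ and measurable mean returns $\mathbf r_h:\mathcal S\times\mathcal A\to\mathcal B(1)\subset\mathbb R^d$, $d\ge 1$, where $\mathcal B(1)$ is the closed Euclidean unit ball. Episodes start in a fixed state $s_1$; return samples lie in $\mathcal B(1)$ almost surely and have conditional mean $\mathbf r_h(s_h,a_h)$ given the past. For $\theta\in\mathcal B(1)$ and a Markov policy $\pi$, $V_1^\pi(s_1;\theta)=\mathbb E_\pi[\sum_{h=1}^H\langle\theta,\mathbf r_h(s_h,a_h)\rangle]$ and $V_1^\star(s_1;\theta)=\sup_\pi V_1^\pi(s_1;\theta)$. The VMDP is *linear* with (known, measurable) feature map $\phi:\mathcal S\times\mathcal A\to\mathbb R^{d_{\rm lin}}$, $d_{\rm lin}\ge1$, $\|\phi\|\le 1$, if for every $h\in[H]$ there are signed measures $\mu_h=(\mu_h^{(1)},\dots,\mu_h^{(d_{\rm lin})})$ on $\mathcal S$ with $\Pr_h(\cdot\mid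 s,a)=\langle\mu_h(\cdot),\phi(s,a)\rangle$ and $\|(|\mu_h^{(i)}|(\mathcal S))_i\|_2\le\sqrt{d_{\rm lin}}$, and a matrix $W_h\in\mathbb R^{d\times d_{\rm lin}}$ with $\mathbf r_h(s,a)=W_h\phi(s,a)$ and operator norm $\|W_h\|\le\sqrt{d_{\rm lin}}$. **Algorithm** (bonus coefficient $\beta$, $K$ episodes). Write $\phi_h^i=\phi(s_h^i,a_h^i)$ and $\|x\|_{M}=\sqrt{x^\top M x}$. *Exploration.* In episode $k=1,\dots,K$, set $\widetilde V_{H+1}^k=0$ and for $h=H,\dots,1$ let $\widetilde\Lambda_h^k=I+\sum_{i<k}\phi_h^i(\phi_h^i)^\top$, $\;\widetilde b_h^k=\beta\|\phi(\cdot,\cdot)\|_{(\widetilde\Lambda_h^k)^{-1}}$, $\;\widetilde r_h^k=\min\{\widetilde b_h^k,H\}/H$, $\;\widetilde w_h^k=(\widetilde\Lambda_h^k)^{-1}\sum_{i<k}\phi_h^i\widetilde V_{h+1}^k(s_{h+1}^i)$, $\;\widetilde Q_h^k=\min\{(\widetilde w_h^k)^\top\phi+\widetilde r_h^k+\widetilde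 b_h^k,\,H\}$, $\;\widetilde V_h^k=\max_a\widetilde Q_h^k(\cdot,a)$; then play $a_h^k\in\arg\max_a\widetilde Q_h^k(s_h^k,a)$, without using any return. *Planning.* Given $\theta\in\mathcal B(1)$ and the revealed return samples $\mathbf r_h^i$, set $\widehat V_{H+1}=0$ and for $h=H,\dots,1$ let $\widehat\Lambda_h=I+\sum_{i\le K}\phi_h^i(\phi_h^i)^\top$, $\;\widehat w_h=\widehat\Lambda_h^{-1}\sum_{i\le K}\phi_h^i[\widehat V_{h+1}(s_{h+1}^i)+\theta^\top\mathbf r_h^i]$, $\;\widehat Q_h=\min\{\widehat w_h^\top\phi+\beta\|\phi\|_{\widehat\Lambda_h^{-1}},\,H\}$, $\;\widehat V_h=\max_a\widehat Q_h(\cdot,a)$; output $\pi_\theta$ with $\pi_{\theta,h}(s)\in\arg\max_a\widehat Q_h(s,a)$. Ties in the argmax are broken by an arbitrary measurable rule (assumed to exist, as it does for finite $\mathcal A$). **Theorem.** There are absolute constants $c_\beta,c_K>0$ such that for all $d_{\rm lin},d,H\ge1$, $\epsilon\in(0,H]$, $\delta\in(0,1]$, with $\iota'=\log\frac{d_{\rm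 lin}dH}{\epsilon\delta}$, and for every $K\ge c_K\, d_{\rm lin}^3H^6(\iota')^2/\epsilon^2$: if $\beta=c_\beta\, d_{\rm lin}H\sqrt{\iota}$ with $\iota=\log\frac{d_{\rm lin}dKH}{\delta}$, then on every linear VMDP, after $K$ episodes of exploration, with probability at least $1-\delta$, $$\forall\,\theta\in\mathcal B(1):\qquad V_1^\star(s_1;\theta)-V_1^{\pi_\theta}(s_1;\theta)\le\epsilon .$$ Consequently, with the same $c_\beta$, the algorithm is a reward-free algorithm with sample complexity $m_{\rm RFE}(\epsilon,\delta)\le C\,d_{\rm lin}^3H^6(\iota')^2/\epsilon^2$ for an absolute constant $C$: for some number of episodes $K$ not exceeding this bound, the above guarantee holds on every linear VMDP. -/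

import Mathlib

open MeasureTheory ProbabilityTheory

universe u v w

noncomputable section

namespace RewardFree

/-- An episodic vector-valued Markov decision process with `d`-dimensional returns. Steps are
numbered from `0`; in an episode of length `H` only the steps `h < H` play a role. -/
structure VMDP (S A : Type*) [MeasurableSpace S] [MeasurableSpace A] (d : ℕ) where
  /-- transition probabilities of step `h` -/
  P : ℕ → Kernel (S × A) S
  markov : ∀ h, IsMarkovKernel (P h)
  /-- expected return vector of step `h`, with values in the unit ball -/
  r : ℕ → S × A → EuclideanSpace ℝ (Fin d)
  measurable_r : ∀ h, Measurable (r h)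
  norm_r_le : ∀ h z, ‖r h z‖ ≤ 1

/-- A (randomized) policy: at every step a Markov kernel from states to actions. -/
structure Policy (S A : Type*) [MeasurableSpace S] [MeasurableSpace A] where
  act : ℕ → Kernel S A
  markov : ∀ h, IsMarkovKernel (act h)

section Basic

variable {S A : Type*} [MeasurableSpace S] [MeasurableSpace A] {d : ℕ}

/-- The deterministic policy that plays `f h s` in state `s` at step `h`. -/
def Policy.ofFun (f : ℕ → S → A) (hf : ∀ h, Measurable (f h)) : Policy S A where
  act h := Kernel.deterministic (f h) (hf h)
  markov h := Kernel.isMarkovKernel_deterministic (hf h)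

/-- The law of the next `n` state-action pairs `(s_h, a_h), …, (s_{h+n-1}, a_{h+n-1})` when the
state at step `h` is given and the policy `π` is followed. -/
def VMDP.traj (M : VMDP S A d) (π : Policy S A) : (n : ℕ) → (h : ℕ) → Kernel S (Fin n → S × A)
  | 0, _ => Kernel.const S (Measure.dirac Fin.elim0)
  | n + 1, h =>
      ((Kernel.id ×ₖ (M.traj π n (h + 1) ∘ₖ M.P h)) ∘ₖ (Kernel.id ×ₖ π.act h)).map
        (fun q : (S × A) × (Fin n → S × A) => (Fin.cons q.1 q.2 : Fin (n + 1) → S × A))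

/-- The scalarized value `V^π_h(s; θ)` in episodes of length `H`: the expectation, under `π` and
given `s_h = s`, of the sum of `⟨θ, r_{h'}(s_{h'}, a_{h'})⟩` over `h ≤ h' < H`. -/
def VMDP.value (M : VMDP S A d) (H : ℕ) (θ : EuclideanSpace ℝ (Fin d)) (π : Policy S A)
    (h : ℕ) (s : S) : ℝ :=
  ∫ τ, ∑ i : Fin (H - h), inner ℝ θ (M.r (h + i) (τ i)) ∂(M.traj π (H - h) h s)

/-- The optimal scalarized value `V^⋆_h(s; θ)`, the supremum over all policies. -/
def VMDP.optValue (M : VMDP S A d) (H : ℕ) (θ : EuclideanSpace ℝ (Fin d)) (h : ℕ) (s : S) : ℝ :=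
  ⨆ π : Policy S A, M.value H θ π h s

/-- Linear VMDP with feature map `φ`. The bound on `‖μ_h(S)‖` for signed measures is read as the
bound on the vector of total variation masses, and `‖W_h‖` is the operator norm. -/
structure VMDP.IsLinear (M : VMDP S A d) (H : ℕ) {m : ℕ} (φ : S × A → EuclideanSpace ℝ (Fin m)) :
    Prop where
  measurable_feature : Measurable φ
  norm_feature_le : ∀ z, ‖φ z‖ ≤ 1
  transition : ∀ h < H, ∃ μ : Fin m → SignedMeasure S,
    ‖WithLp.toLp 2 (fun i => (μ i).totalVariation.real Set.univ)‖ ≤ Real.sqrt m ∧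
    ∀ z B, MeasurableSet B → (M.P h z).real B = ∑ i, μ i B * φ z i
  returns : ∀ h < H, ∃ W : Matrix (Fin d) (Fin m) ℝ,
    ‖(Matrix.toEuclideanLin W).toContinuousLinearMap‖ ≤ Real.sqrt m ∧
    ∀ z, M.r h z = Matrix.toEuclideanLin W (φ z)

end Basic

section Algorithm

/-- Regression parameters: a weight vector `w` and an inverse Gram matrix `Λ⁻¹`. -/
abbrev Param (m : ℕ) : Type := EuclideanSpace ℝ (Fin m) × (Fin m → Fin m → ℝ)

variable {S A : Type*} {m : ℕ}

/-- The regularized Gram matrix `∑_{i < n} x_i x_iᵀ + I`. -/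
def gram (x : ℕ → EuclideanSpace ℝ (Fin m)) (n : ℕ) : Matrix (Fin m) (Fin m) ℝ :=
  ∑ i ∈ Finset.range n, Matrix.vecMulVec (x i).ofLp (x i).ofLp + 1

/-- The ridge regression estimate `Λ⁻¹ ∑_{i < n} y_i x_i`. -/
def ridge (x : ℕ → EuclideanSpace ℝ (Fin m)) (y : ℕ → ℝ) (n : ℕ) : EuclideanSpace ℝ (Fin m) :=
  WithLp.toLp 2 ((gram x n)⁻¹.mulVec (∑ i ∈ Finset.range n, y i • (x i).ofLp))

/-- The elliptical bonus `β √(vᵀ G v)`. -/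
def bonus (β : ℝ) (G : Fin m → Fin m → ℝ) (v : EuclideanSpace ℝ (Fin m)) : ℝ :=
  β * Real.sqrt (v.ofLp ⬝ᵥ (Matrix.of G).mulVec v.ofLp)

/-- The truncated bonus `u = min {β √(φᵀ G φ), H}`, which drives the exploration through the
intrinsic reward `u / H`. -/
def truncBonus (β : ℝ) (H : ℕ) (φ : S × A → EuclideanSpace ℝ (Fin m)) (p : Param m)
    (s : S) (a : A) : ℝ :=
  min (bonus β p.2 (φ (s, a))) H

/-- Exploration phase: `Q̃ = min {wᵀφ + u/H + β √(φᵀ Λ⁻¹ φ), H}`. -/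
def exploreQ (β : ℝ) (H : ℕ) (φ : S × A → EuclideanSpace ℝ (Fin m)) (p : Param m)
    (s : S) (a : A) : ℝ :=
  min (inner ℝ p.1 (φ (s, a)) + truncBonus β H φ p s a / H + bonus β p.2 (φ (s, a))) H

/-- Planning phase: `Q̂ = min {wᵀφ + β √(φᵀ Λ⁻¹ φ), H}`. -/
def planQ (β : ℝ) (H : ℕ) (φ : S × A → EuclideanSpace ℝ (Fin m)) (p : Param m)
    (s : S) (a : A) : ℝ :=
  min (inner ℝ p.1 (φ (s, a)) + bonus β p.2 (φ (s, a))) H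

/-- The regression of step `h` on the first `n` episodes of the data `(s, a)`, with targets
`V (s^i_{h+1}) + g^i_h`. -/
def fit (φ : S × A → EuclideanSpace ℝ (Fin m)) (s : ℕ → ℕ → S) (a : ℕ → ℕ → A)
    (g : ℕ → ℕ → ℝ) (n h : ℕ) (V : S → ℝ) : Param m :=
  (ridge (fun i => φ (s i h, a i h)) (fun i => V (s i (h + 1)) + g i h) n,
    fun i j => (gram (fun i => φ (s i h, a i h)) n)⁻¹ i j)

/-- Least-squares value iteration: `lsviValue … j` is the function `V_h` at step `h = H - j`,
that is, with `j` steps to go; it is `0` after the last step, and `V_h(s) = max_a Q_h(s, a)`. -/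
def lsviValue (Q : Param m → S → A → ℝ) (H : ℕ) (φ : S × A → EuclideanSpace ℝ (Fin m))
    (s : ℕ → ℕ → S) (a : ℕ → ℕ → A) (g : ℕ → ℕ → ℝ) (n : ℕ) : ℕ → S → ℝ
  | 0 => fun _ => 0
  | j + 1 => fun x =>
      ⨆ b : A, Q (fit φ s a g n (H - (j + 1)) (lsviValue Q H φ s a g n j)) x b

/-- The regression parameters of least-squares value iteration at step `h < H`. -/
def lsviParam (Q : Param m → S → A → ℝ) (H : ℕ) (φ : S × A → EuclideanSpace ℝ (Fin m))
    (s : ℕ → ℕ → S) (a : ℕ → ℕ → A) (g : ℕ → ℕ → ℝ) (n h : ℕ) : Param m :=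
  fit φ s a g n h (lsviValue Q H φ s a g n (H - (h + 1)))

/-- A measurable choice of `argmax_a Q_p(s, a)`, with an arbitrary tie-breaking rule, for the
functions `Q_p` that the algorithm can produce. -/
structure Greedy [MeasurableSpace S] [MeasurableSpace A] (Q : Param m → S → A → ℝ) where
  act : Param m → S → A
  measurable_act : Measurable (fun q : Param m × S => act q.1 q.2)
  isMax : ∀ p : Param m, (Matrix.of p.2).PosDef → ∀ s a, Q p s a ≤ Q p s (act p s)

variable [MeasurableSpace S] [MeasurableSpace A]

/-- The exploration rule: the action taken in episode `k` at step `h` in state `x`, computed from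
the states and actions of the episodes `i < k` only. -/
def exploreAct (β : ℝ) (H : ℕ) (φ : S × A → EuclideanSpace ℝ (Fin m))
    (G : Greedy (exploreQ β H φ)) (s : ℕ → ℕ → S) (a : ℕ → ℕ → A) (k h : ℕ) (x : S) : A :=
  G.act (lsviParam (exploreQ β H φ) H φ s a (fun _ _ => 0) k h) x

/-- The output of the planning phase for the vector `θ`, computed from the `K` explored episodes
`(s, a)` and the revealed return samples `r`. -/
def planPolicy {d : ℕ} (β : ℝ) (H : ℕ) (φ : S × A → EuclideanSpace ℝ (Fin m))
    (G : Greedy (planQ β H φ)) (K : ℕ) (s : ℕ → ℕ → S) (a : ℕ → ℕ → A)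
    (r : ℕ → ℕ → EuclideanSpace ℝ (Fin d)) (θ : EuclideanSpace ℝ (Fin d)) : Policy S A :=
  Policy.ofFun
    (fun h => G.act (lsviParam (planQ β H φ) H φ s a (fun i j => inner ℝ θ (r i j)) K h))
    (fun _ => G.measurable_act.comp (measurable_const.prodMk measurable_id))

end Algorithm

section Interaction

variable {S A Ω : Type*} [MeasurableSpace S] [MeasurableSpace A] [MeasurableSpace Ω] {d : ℕ}

/-- The information available after the action of step `h` of episode `k`: the states, actions
and returns of the earlier episodes, the states and actions of episode `k` up to step `h`, and
its returns before step `h`. -/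
@[reducible]
def history (H : ℕ) (s : ℕ → ℕ → Ω → S) (a : ℕ → ℕ → Ω → A)
    (r : ℕ → ℕ → Ω → EuclideanSpace ℝ (Fin d)) (k h : ℕ) : MeasurableSpace Ω :=
  (⨆ (i : ℕ) (j : ℕ) (_ : (i < k ∧ j ≤ H) ∨ (i = k ∧ j ≤ h)),
      MeasurableSpace.comap (s i j) inferInstance) ⊔
  (⨆ (i : ℕ) (j : ℕ) (_ : (i < k ∧ j < H) ∨ (i = k ∧ j ≤ h)),
      MeasurableSpace.comap (a i j) inferInstance) ⊔
  (⨆ (i : ℕ) (j : ℕ) (_ : (i < k ∧ j < H) ∨ (i = k ∧ j < h)),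
      MeasurableSpace.comap (r i j) inferInstance)

/-- The random variables `s k h`, `a k h`, `r k h` record `K` episodes of interaction with `M`
from the initial state `s₁`, the actions being chosen by the exploration rule `rule`. Return
samples lie in the unit ball and have the right conditional mean. -/
structure IsRun (M : VMDP S A d) (s₁ : S) (H K : ℕ)
    (rule : (ℕ → ℕ → S) → (ℕ → ℕ → A) → ℕ → ℕ → S → A) (Pr : Measure Ω)
    (s : ℕ → ℕ → Ω → S) (a : ℕ → ℕ → Ω → A) (r : ℕ → ℕ → Ω → EuclideanSpace ℝ (Fin d)) :
    Prop where
  measurable_s : ∀ k h, Measurable (s k h)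
  measurable_a : ∀ k h, Measurable (a k h)
  measurable_r : ∀ k h, Measurable (r k h)
  start : ∀ k < K, ∀ᵐ ω ∂Pr, s k 0 ω = s₁
  action : ∀ k < K, ∀ h < H, ∀ᵐ ω ∂Pr,
    a k h ω = rule (fun i j => s i j ω) (fun i j => a i j ω) k h (s k h ω)
  transition : ∀ k < K, ∀ h < H, ∀ B : Set S, MeasurableSet B →
    Pr[((s k (h + 1)) ⁻¹' B).indicator (fun _ => (1 : ℝ)) | history H s a r k h]
      =ᵐ[Pr] fun ω => (M.P h (s k h ω, a k h ω)).real B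
  return_ball : ∀ k < K, ∀ h < H, ∀ᵐ ω ∂Pr, ‖r k h ω‖ ≤ 1
  return_mean : ∀ k < K, ∀ h < H,
    Pr[r k h | history H s a r k h] =ᵐ[Pr] fun ω => M.r h (s k h ω, a k h ω)

end Interaction

/-- The bonus coefficient `β = c_β · d_lin · H · √ι` with `ι = log (d_lin d K H / δ)`. -/
def bonusCoeff (cβ : ℝ) (m d H K : ℕ) (δ : ℝ) : ℝ :=
  cβ * m * H * Real.sqrt (Real.log (m * d * K * H / δ))

/-- The rate `d_lin³ H⁶ ι'² / ε²` with `ι' = log (d_lin d H / (ε δ))`. -/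
def rate (m d H : ℕ) (ε δ : ℝ) : ℝ :=
  (m : ℝ) ^ 3 * (H : ℝ) ^ 6 * Real.log (m * d * H / (ε * δ)) ^ 2 / ε ^ 2

/-- The reward-free guarantee of the algorithm with bonus constant `cβ` run for `K` episodes, on
all linear VMDPs with `m`-dimensional features, `d`-dimensional returns and horizon `H`: with
probability at least `1 - δ`, simultaneously for all `θ` in the unit ball, the planning phase
returns a policy that is `ε`-optimal for `θ` from the initial state. -/
def Guarantee (cβ : ℝ) (m d H K : ℕ) (ε δ : ℝ) : Prop :=
  ∀ (S : Type u) (A : Type v) (Ω : Type w) [MeasurableSpace S] [MeasurableSpace A]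
    [MeasurableSpace Ω] (φ : S × A → EuclideanSpace ℝ (Fin m)) (M : VMDP S A d) (s₁ : S)
    (Ge : Greedy (exploreQ (bonusCoeff cβ m d H K δ) H φ))
    (Gp : Greedy (planQ (bonusCoeff cβ m d H K δ) H φ))
    (Pr : Measure Ω) [IsProbabilityMeasure Pr]
    (s : ℕ → ℕ → Ω → S) (a : ℕ → ℕ → Ω → A) (r : ℕ → ℕ → Ω → EuclideanSpace ℝ (Fin d)),
    M.IsLinear H φ →
    IsRun M s₁ H K (exploreAct (bonusCoeff cβ m d H K δ) H φ Ge) Pr s a r →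
    ∃ E : Set Ω, MeasurableSet E ∧ 1 - δ ≤ Pr.real E ∧
      ∀ ω ∈ E, ∀ θ : EuclideanSpace ℝ (Fin d), ‖θ‖ ≤ 1 →
        M.optValue H θ 0 s₁ -
          M.value H θ (planPolicy (bonusCoeff cβ m d H K δ) H φ Gp K (fun i j => s i j ω)
            (fun i j => a i j ω) (fun i j => r i j ω) θ) 0 s₁ ≤ ε

end RewardFree

end

/-
Both phases run optimistic least-squares value iteration. Regression noise is controlled by
self-normalized concentration, made uniform over the value functions the algorithm may produce by
a union bound over a grid of regression parameters; hence on an event of probability `1 - δ` every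
regression error is at most half of its bonus.

On this event the planned values dominate the optimal ones, so the suboptimality of `π_θ` is at most
the difference between the planned value and the value of `π_θ`. By the Bellman recursion this
difference accumulates bonuses along `π_θ`. The exploration values of each episode are optimistic
for exactly such an accumulation, with bonuses that are larger because Gram matrices only grow; so
the suboptimality is at most four times the exploration value at `s₁` of every episode. Unrolling
the latter along the explored trajectories, their sum over the `K` episodes is a martingale plus the
bonuses met by the exploration, which the elliptical potential bounds by `O(√K)` up to logarithms.
-/

noncomputable section

namespace RewardFree

open Matrix

section QuadraticForm

variable {n : Type*} [Fintype n]

/-- The quadratic form `vᵀ G v`. -/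
def quad (G : Matrix n n ℝ) (v : n → ℝ) : ℝ := v ⬝ᵥ G *ᵥ v

/-- The seminorm `‖v‖_G = √(vᵀ G v)` of a positive semidefinite matrix `G`. -/
def matNorm (G : Matrix n n ℝ) (v : n → ℝ) : ℝ := √(quad G v)

variable {G : Matrix n n ℝ}

lemma matNorm_nonneg (G : Matrix n n ℝ) (v : n → ℝ) : 0 ≤ matNorm G v := Real.sqrt_nonneg _

@[simp] lemma quad_zero (G : Matrix n n ℝ) : quad G 0 = 0 := by simp [quad]

@[simp] lemma matNorm_zero (G : Matrix n n ℝ) : matNorm G 0 = 0 := by simp [matNorm]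

lemma quad_nonneg (hG : G.PosSemidef) (v : n → ℝ) : 0 ≤ quad G v := by
  simpa [quad] using hG.dotProduct_mulVec_nonneg v

lemma quad_add_smul (hG : G.IsSymm) (v w : n → ℝ) (t : ℝ) :
    quad G (v + t • w) = quad G v + 2 * t * (v ⬝ᵥ G *ᵥ w) + t ^ 2 * quad G w := by
  have hcomm : w ⬝ᵥ G *ᵥ v = v ⬝ᵥ G *ᵥ w := by
    rw [dotProduct_mulVec, ← mulVec_transpose, hG.eq, dotProduct_comm]
  simp only [quad, mulVec_add, mulVec_smul, add_dotProduct, dotProduct_add, smul_dotProduct,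
    dotProduct_smul, smul_eq_mul, hcomm]
  ring

lemma matNorm_sq (hG : G.PosSemidef) (v : n → ℝ) : matNorm G v ^ 2 = quad G v :=
  Real.sq_sqrt (quad_nonneg hG v)

lemma matNorm_smul (G : Matrix n n ℝ) (t : ℝ) (v : n → ℝ) :
    matNorm G (t • v) = |t| * matNorm G v := by
  rw [matNorm, matNorm, ← Real.sqrt_sq_eq_abs, ← Real.sqrt_mul (sq_nonneg t)]
  congr 1
  simp only [quad, mulVec_smul, smul_dotProduct, dotProduct_smul, smul_eq_mul]
  ring

lemma matNorm_eq_norm (hG : G.PosSemidef) (v : n → ℝ) :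
    matNorm G v = (G.toSeminormedAddCommGroup hG).toNorm.norm v :=
  congrArg Real.sqrt (dotProduct_comm v (G *ᵥ v))

lemma abs_dotProduct_mulVec_le (hG : G.PosSemidef) (v w : n → ℝ) :
    |v ⬝ᵥ G *ᵥ w| ≤ matNorm G v * matNorm G w := by
  rw [matNorm_eq_norm hG, matNorm_eq_norm hG, dotProduct_comm]
  let := G.toSeminormedAddCommGroup hG
  let := G.toInnerProductSpace hG
  exact abs_real_inner_le_norm v w

lemma matNorm_add_le (hG : G.PosSemidef) (v w : n → ℝ) :
    matNorm G (v + w) ≤ matNorm G v + matNorm G w := by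
  simp only [matNorm_eq_norm hG]
  exact @norm_add_le _ (G.toSeminormedAddCommGroup hG).toSeminormedAddGroup v w

lemma matNorm_sub_le (hG : G.PosSemidef) (v w : n → ℝ) :
    matNorm G (v - w) ≤ matNorm G v + matNorm G w := by
  simp only [matNorm_eq_norm hG]
  exact @norm_sub_le _ (G.toSeminormedAddCommGroup hG).toSeminormedAddGroup v w

lemma matNorm_sum_le (hG : G.PosSemidef) {ι : Type*} (t : Finset ι) (v : ι → n → ℝ) :
    matNorm G (∑ i ∈ t, v i) ≤ ∑ i ∈ t, matNorm G (v i) := by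
  simp only [matNorm_eq_norm hG]
  exact @norm_sum_le _ _ (G.toSeminormedAddCommGroup hG) t v

lemma matNorm_sum_smul_le (hG : G.PosSemidef) {ι : Type*} (t : Finset ι) (c : ι → ℝ)
    (v : ι → n → ℝ) :
    matNorm G (∑ i ∈ t, c i • v i) ≤ √(∑ i ∈ t, c i ^ 2) * √(∑ i ∈ t, quad G (v i)) :=
  calc matNorm G (∑ i ∈ t, c i • v i)
      ≤ ∑ i ∈ t, matNorm G (c i • v i) := matNorm_sum_le hG t _
    _ = ∑ i ∈ t, |c i| * matNorm G (v i) := by simp only [matNorm_smul]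
    _ ≤ √(∑ i ∈ t, |c i| ^ 2) * √(∑ i ∈ t, matNorm G (v i) ^ 2) := Real.sum_mul_le_sqrt_mul_sqrt ..
    _ = _ := by simp only [sq_abs, matNorm_sq hG]

end QuadraticForm

section RankOneUpdate

variable {n : Type*} [Fintype n] [DecidableEq n] {Λ : Matrix n n ℝ}

lemma inv_add_vecMulVec (hΛ : Λ.PosDef) (x : n → ℝ) :
    (Λ + vecMulVec x x)⁻¹ =
      Λ⁻¹ - (1 + quad Λ⁻¹ x)⁻¹ • vecMulVec (Λ⁻¹ *ᵥ x) (Λ⁻¹ *ᵥ x) := by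
  have hquad : 0 ≤ quad Λ⁻¹ x := quad_nonneg hΛ.inv.posSemidef x
  have hsymm : Λ⁻¹ᵀ = Λ⁻¹ := (isHermitian_iff_isSymm.mp hΛ.inv.isHermitian).eq
  have hunit : IsUnit Λ.det := hΛ.det_pos.ne'.isUnit
  have hΛmul : Λ * vecMulVec (Λ⁻¹ *ᵥ x) (Λ⁻¹ *ᵥ x) = vecMulVec x (Λ⁻¹ *ᵥ x) := by
    rw [mul_vecMulVec, mulVec_mulVec, mul_nonsing_inv _ hunit, one_mulVec]
  have hmulInv : vecMulVec x x * Λ⁻¹ = vecMulVec x (Λ⁻¹ *ᵥ x) := by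
    rw [vecMulVec_mul, ← mulVec_transpose, hsymm]
  have hmul : vecMulVec x x * vecMulVec (Λ⁻¹ *ᵥ x) (Λ⁻¹ *ᵥ x)
      = quad Λ⁻¹ x • vecMulVec x (Λ⁻¹ *ᵥ x) := by
    rw [vecMulVec_mul_vecMulVec, vecMulVec_smul, quad]
  refine inv_eq_right_inv ?_
  rw [Matrix.mul_sub, Matrix.add_mul, Matrix.mul_smul, Matrix.add_mul, hΛmul, hmulInv, hmul,
    mul_nonsing_inv _ hunit]
  match_scalars <;> field_simp
  ring

lemma quad_inv_add_vecMulVec (hΛ : Λ.PosDef) (x v : n → ℝ) :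
    quad (Λ + vecMulVec x x)⁻¹ v =
      quad Λ⁻¹ v - (v ⬝ᵥ Λ⁻¹ *ᵥ x) ^ 2 / (1 + quad Λ⁻¹ x) := by
  rw [inv_add_vecMulVec hΛ]
  simp only [quad, sub_mulVec, smul_mulVec, vecMulVec_mulVec, dotProduct_sub, dotProduct_smul,
    smul_eq_mul, op_smul_eq_smul]
  rw [dotProduct_comm (Λ⁻¹ *ᵥ x) v]
  ring

lemma det_add_vecMulVec (hΛ : Λ.PosDef) (x : n → ℝ) :
    (Λ + vecMulVec x x).det = Λ.det * (1 + quad Λ⁻¹ x) := by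
  rw [vecMulVec_eq Unit, det_add_replicateCol_mul_replicateRow hΛ.det_pos.ne'.isUnit,
    Matrix.mul_assoc, ← replicateCol_mulVec, det_unique (n := Unit)]
  simp [quad]

end RankOneUpdate

section Gram

variable {m : ℕ} (x : ℕ → EuclideanSpace ℝ (Fin m))

lemma ofLp_dotProduct_self (v : EuclideanSpace ℝ (Fin m)) : v.ofLp ⬝ᵥ v.ofLp = ‖v‖ ^ 2 := by
  simp [EuclideanSpace.real_norm_sq_eq, dotProduct, ← sq]

lemma gram_zero : gram x 0 = 1 := by simp [gram]

lemma gram_succ (n : ℕ) : gram x (n + 1) = gram x n + vecMulVec (x n).ofLp (x n).ofLp := by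
  rw [gram, gram, Finset.sum_range_succ]
  abel

lemma gram_posDef (n : ℕ) : (gram x n).PosDef := by
  induction n with
  | zero => simpa only [gram_zero] using PosDef.one
  | succ n ih =>
    rw [gram_succ]
    exact ih.add_posSemidef (posSemidef_vecMulVec_self_star (x n).ofLp)

lemma gram_inv_posSemidef (n : ℕ) : (gram x n)⁻¹.PosSemidef := (gram_posDef x n).inv.posSemidef

lemma isUnit_det_gram (n : ℕ) : IsUnit (gram x n).det := (gram_posDef x n).det_pos.ne'.isUnit

/-- The leverage `x_nᵀ Λ_n⁻¹ x_n` of the next regressor. -/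
def lever (n : ℕ) : ℝ := quad (gram x n)⁻¹ (x n).ofLp

lemma lever_nonneg (n : ℕ) : 0 ≤ lever x n := quad_nonneg (gram_inv_posSemidef x n) _

lemma quad_gram_inv_succ (n : ℕ) (v : Fin m → ℝ) :
    quad (gram x (n + 1))⁻¹ v =
      quad (gram x n)⁻¹ v - (v ⬝ᵥ (gram x n)⁻¹ *ᵥ (x n).ofLp) ^ 2 / (1 + lever x n) := by
  rw [gram_succ, quad_inv_add_vecMulVec (gram_posDef x n), lever]

lemma antitone_quad_gram_inv (v : Fin m → ℝ) : Antitone fun n => quad (gram x n)⁻¹ v := by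
  refine antitone_nat_of_succ_le fun n => ?_
  have := lever_nonneg x n
  rw [quad_gram_inv_succ]
  exact sub_le_self _ (by positivity)

lemma antitone_matNorm_gram_inv (v : Fin m → ℝ) : Antitone fun n => matNorm (gram x n)⁻¹ v :=
  fun _ _ hle => Real.sqrt_le_sqrt (antitone_quad_gram_inv x v hle)

lemma quad_gram_inv_le (n : ℕ) (v : EuclideanSpace ℝ (Fin m)) :
    quad (gram x n)⁻¹ v.ofLp ≤ ‖v‖ ^ 2 :=
  calc quad (gram x n)⁻¹ v.ofLp ≤ quad (gram x 0)⁻¹ v.ofLp :=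
        antitone_quad_gram_inv x v.ofLp n.zero_le
    _ = ‖v‖ ^ 2 := by simp [gram_zero, quad, ofLp_dotProduct_self]

lemma matNorm_gram_inv_le (n : ℕ) (v : EuclideanSpace ℝ (Fin m)) :
    matNorm (gram x n)⁻¹ v.ofLp ≤ ‖v‖ :=
  Real.sqrt_le_left (norm_nonneg v) |>.mpr (quad_gram_inv_le x n v)

lemma matNorm_gram_inv_single_le (n : ℕ) (j : Fin m) :
    matNorm (gram x n)⁻¹ (Pi.single j 1) ≤ 1 := by
  simpa using matNorm_gram_inv_le x n (EuclideanSpace.single j 1)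

lemma abs_gram_inv_apply_le (n : ℕ) (i j : Fin m) : |(gram x n)⁻¹ i j| ≤ 1 :=
  calc |(gram x n)⁻¹ i j|
      = |Pi.single i 1 ⬝ᵥ (gram x n)⁻¹ *ᵥ Pi.single j 1| := by simp
    _ ≤ matNorm (gram x n)⁻¹ (Pi.single i 1) * matNorm (gram x n)⁻¹ (Pi.single j 1) :=
        abs_dotProduct_mulVec_le (gram_inv_posSemidef x n) _ _
    _ ≤ 1 := mul_le_one₀ (matNorm_gram_inv_single_le x n i) (matNorm_nonneg _ _)
        (matNorm_gram_inv_single_le x n j)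

end Gram

section EllipticalPotential

variable {m : ℕ} (x : ℕ → EuclideanSpace ℝ (Fin m))

lemma sum_lever_div_le_log_det (n : ℕ) :
    ∑ i ∈ Finset.range n, lever x i / (1 + lever x i) ≤ Real.log (gram x n).det := by
  induction n with
  | zero => simp [gram_zero]
  | succ n ih =>
    have hpos : 0 < 1 + lever x n := by linarith [lever_nonneg x n]
    have hlog : lever x n / (1 + lever x n) ≤ Real.log (1 + lever x n) :=
      calc lever x n / (1 + lever x n) = 1 - (1 + lever x n)⁻¹ := by field_simp; ring
        _ ≤ Real.log (1 + lever x n) := Real.one_sub_inv_le_log_of_pos hpos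
    have hdet : (gram x (n + 1)).det = (gram x n).det * (1 + lever x n) := by
      rw [gram_succ, det_add_vecMulVec (gram_posDef x n), lever]
    rw [Finset.sum_range_succ, hdet, Real.log_mul (gram_posDef x n).det_pos.ne' hpos.ne']
    exact add_le_add ih hlog

variable {x} (hx : ∀ i, ‖x i‖ ≤ 1) (n : ℕ)
include hx

lemma lever_le_one : lever x n ≤ 1 :=
  (quad_gram_inv_le x n (x n)).trans (pow_le_one₀ (norm_nonneg _) (hx n))

lemma trace_gram_le : (gram x n).trace ≤ m + n := by
  induction n with
  | zero => simp [gram_zero]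
  | succ n ih =>
    have : ‖x n‖ ^ 2 ≤ 1 := pow_le_one₀ (norm_nonneg _) (hx n)
    rw [gram_succ, trace_add, trace_vecMulVec, ofLp_dotProduct_self]
    push_cast
    linarith

lemma log_det_gram_le : Real.log (gram x n).det ≤ m * Real.log (m + n) := by
  have hpd := gram_posDef x n
  set ev := hpd.isHermitian.eigenvalues
  have hev : ∀ i, 0 < ev i := hpd.eigenvalues_pos
  have hev_le : ∀ i, ev i ≤ m + n := fun i =>
    calc ev i ≤ ∑ j, ev j :=
          Finset.single_le_sum (fun j _ => (hev j).le) (Finset.mem_univ i)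
      _ = (gram x n).trace := hpd.isHermitian.trace_eq_sum_eigenvalues.symm
      _ ≤ m + n := trace_gram_le hx n
  calc Real.log (gram x n).det = Real.log (∏ i, ev i) :=
        congrArg Real.log hpd.isHermitian.det_eq_prod_eigenvalues
    _ = ∑ i, Real.log (ev i) := Real.log_prod fun i _ => (hev i).ne'
    _ ≤ ∑ _i : Fin m, Real.log (m + n) :=
        Finset.sum_le_sum fun i _ => Real.log_le_log (hev i) (hev_le i)
    _ = m * Real.log (m + n) := by simp

lemma sum_lever_le : ∑ i ∈ Finset.range n, lever x i ≤ 2 * (m * Real.log (m + n)) := by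
  have hlever : ∀ i, lever x i ≤ 2 * (lever x i / (1 + lever x i)) := fun i => by
    have := lever_nonneg x i
    rw [mul_div_assoc', le_div_iff₀ (by positivity)]
    nlinarith [lever_le_one hx i]
  calc ∑ i ∈ Finset.range n, lever x i
      ≤ 2 * ∑ i ∈ Finset.range n, lever x i / (1 + lever x i) := by
        rw [Finset.mul_sum]
        exact Finset.sum_le_sum fun i _ => hlever i
    _ ≤ 2 * (m * Real.log (m + n)) := by
        gcongr
        exact (sum_lever_div_le_log_det x n).trans (log_det_gram_le hx n)

end EllipticalPotential

section Ridge

variable {m : ℕ} (x : ℕ → EuclideanSpace ℝ (Fin m)) (y : ℕ → ℝ) (n : ℕ)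

lemma gram_mulVec (w : EuclideanSpace ℝ (Fin m)) :
    gram x n *ᵥ w.ofLp = ∑ i ∈ Finset.range n, inner ℝ w (x i) • (x i).ofLp + w.ofLp := by
  simp only [gram, add_mulVec, one_mulVec, sum_mulVec, vecMulVec_mulVec, op_smul_eq_smul,
    EuclideanSpace.inner_eq_star_dotProduct, star_trivial]

lemma ridge_sub_eq (w : EuclideanSpace ℝ (Fin m)) :
    (ridge x y n - w).ofLp = (gram x n)⁻¹ *ᵥ
      (∑ i ∈ Finset.range n, (y i - inner ℝ w (x i)) • (x i).ofLp - w.ofLp) := by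
  have hw : w.ofLp = (gram x n)⁻¹ *ᵥ gram x n *ᵥ w.ofLp := by
    rw [mulVec_mulVec, nonsing_inv_mul _ (isUnit_det_gram x n), one_mulVec]
  rw [WithLp.ofLp_sub, hw, ridge, ← mulVec_sub, ← hw, gram_mulVec]
  simp only [sub_smul, Finset.sum_sub_distrib, sub_add_eq_sub_sub]

lemma abs_inner_ridge_sub_le (w v : EuclideanSpace ℝ (Fin m)) :
    |inner ℝ (ridge x y n) v - inner ℝ w v| ≤ matNorm (gram x n)⁻¹ v.ofLp *
      (matNorm (gram x n)⁻¹ (∑ i ∈ Finset.range n, (y i - inner ℝ w (x i)) • (x i).ofLp)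
        + ‖w‖) := by
  have hG := gram_inv_posSemidef x n
  rw [← inner_sub_left, EuclideanSpace.inner_eq_star_dotProduct, star_trivial, ridge_sub_eq]
  refine (abs_dotProduct_mulVec_le hG _ _).trans ?_
  have := matNorm_nonneg (gram x n)⁻¹ v.ofLp
  gcongr
  exact (matNorm_sub_le hG _ _).trans (add_le_add_right (matNorm_gram_inv_le x n w) _)

variable {x y n} in
lemma abs_ridge_apply_le (hx : ∀ i, ‖x i‖ ≤ 1) {C : ℝ} (hy : ∀ i < n, |y i| ≤ C) (j : Fin m) :
    |ridge x y n j| ≤ n * C := by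
  have hG := gram_inv_posSemidef x n
  have hterm : ∀ i ∈ Finset.range n, matNorm (gram x n)⁻¹ (y i • (x i).ofLp) ≤ C := fun i hi =>
    calc matNorm (gram x n)⁻¹ (y i • (x i).ofLp)
        = |y i| * matNorm (gram x n)⁻¹ (x i).ofLp := matNorm_smul _ _ _
      _ ≤ |y i| := mul_le_of_le_one_right (abs_nonneg _)
          ((matNorm_gram_inv_le x n (x i)).trans (hx i))
      _ ≤ C := hy i (Finset.mem_range.mp hi)
  calc |ridge x y n j|
      = |Pi.single j 1 ⬝ᵥ (gram x n)⁻¹ *ᵥ ∑ i ∈ Finset.range n, y i • (x i).ofLp| := by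
        simp [ridge]
    _ ≤ matNorm (gram x n)⁻¹ (Pi.single j 1) *
          matNorm (gram x n)⁻¹ (∑ i ∈ Finset.range n, y i • (x i).ofLp) :=
        abs_dotProduct_mulVec_le hG _ _
    _ ≤ matNorm (gram x n)⁻¹ (∑ i ∈ Finset.range n, y i • (x i).ofLp) :=
        mul_le_of_le_one_left (matNorm_nonneg _ _) (matNorm_gram_inv_single_le x n j)
    _ ≤ ∑ i ∈ Finset.range n, matNorm (gram x n)⁻¹ (y i • (x i).ofLp) := matNorm_sum_le hG _ _
    _ ≤ n * C := by simpa using Finset.sum_le_sum hterm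

end Ridge

lemma exp_le_add_exp_sq (y : ℝ) : Real.exp y ≤ y + Real.exp (y ^ 2) := by
  have hsq := Real.add_one_le_exp (y ^ 2)
  rcases le_or_gt |y| 1 with hy | hy
  · linarith [(abs_le.mp (Real.abs_exp_sub_one_sub_id_le hy)).2]
  · rcases lt_abs.mp hy with hy | hy
    · have : Real.exp y ≤ Real.exp (y ^ 2) := Real.exp_le_exp.mpr (by nlinarith)
      linarith
    · have : Real.exp y ≤ 1 := Real.exp_le_one_iff.mpr (by linarith)
      nlinarith

section SelfNormalized

variable {m : ℕ} {ι : Type*} (x : ℕ → EuclideanSpace ℝ (Fin m)) (η : ℕ → ι → ℝ)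

/-- The sum `S_j = ∑_{i < n} η_{i,j} x_i` of the regressors weighted by the `j`-th coordinate of
the noise. -/
def noiseSum (n : ℕ) (j : ι) : Fin m → ℝ := ∑ i ∈ Finset.range n, η i j • (x i).ofLp

/-- The correlation `S_jᵀ Λ_n⁻¹ x_n` of the noise sum with the next regressor. -/
def noiseCorr (n : ℕ) (j : ι) : ℝ := noiseSum x η n j ⬝ᵥ (gram x n)⁻¹ *ᵥ (x n).ofLp

lemma noiseSum_succ (n : ℕ) (j : ι) :
    noiseSum x η (n + 1) j = noiseSum x η n j + η n j • (x n).ofLp :=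
  Finset.sum_range_succ ..

lemma quad_gram_inv_succ_noiseSum (n : ℕ) (j : ι) :
    quad (gram x (n + 1))⁻¹ (noiseSum x η (n + 1) j) = quad (gram x n)⁻¹ (noiseSum x η n j) +
      (2 * (noiseCorr x η n j * η n j) - noiseCorr x η n j ^ 2
        + lever x n * η n j ^ 2) / (1 + lever x n) := by
  have hpos : 0 < 1 + lever x n := by linarith [lever_nonneg x n]
  have hcorr : (noiseSum x η n j + η n j • (x n).ofLp) ⬝ᵥ (gram x n)⁻¹ *ᵥ (x n).ofLp
      = noiseCorr x η n j + η n j * lever x n := by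
    simp [add_dotProduct, noiseCorr, lever, quad]
  have hquad : quad (gram x n)⁻¹ (noiseSum x η n j + η n j • (x n).ofLp)
      = quad (gram x n)⁻¹ (noiseSum x η n j) + 2 * η n j * noiseCorr x η n j
        + η n j ^ 2 * lever x n :=
    quad_add_smul (isHermitian_iff_isSymm.mp (gram_inv_posSemidef x n).isHermitian) _ _ _
  rw [quad_gram_inv_succ, noiseSum_succ, hcorr, hquad]
  field_simp
  ring

variable [Fintype ι]

/-- The self-normalized squared norm `∑_j ‖S_j‖²_{Λ_n⁻¹}` of the noise sums. -/
def selfNorm (n : ℕ) : ℝ := ∑ j, quad (gram x n)⁻¹ (noiseSum x η n j)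

lemma selfNorm_zero : selfNorm x η 0 = 0 := by simp [selfNorm, noiseSum]

lemma selfNorm_succ (n : ℕ) :
    selfNorm x η (n + 1) = selfNorm x η n +
      (2 * ∑ j, noiseCorr x η n j * η n j - ∑ j, noiseCorr x η n j ^ 2
        + lever x n * ∑ j, η n j ^ 2) / (1 + lever x n) := by
  simp only [selfNorm, quad_gram_inv_succ_noiseSum, Finset.mul_sum, ← Finset.sum_sub_distrib,
    ← Finset.sum_add_distrib, Finset.sum_div]

/-- The exponential `exp (l (‖S‖² - B² ∑ u_i / (1 + u_i)))` of the compensated self-normalized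
norm, where `u_i` is the leverage: a supermartingale for centered noise bounded by `B`. -/
def expSelfNorm (l B : ℝ) (n : ℕ) : ℝ :=
  Real.exp (l * (selfNorm x η n - B ^ 2 * ∑ i ∈ Finset.range n, lever x i / (1 + lever x i)))

/-- The predictable weight of the noise coordinate `η_{n,j}` in the upper bound for the increment of
`expSelfNorm`. -/
def expWeight (l B : ℝ) (n : ℕ) (j : ι) : ℝ :=
  expSelfNorm x η l B n * Real.exp (-(l * (∑ j, noiseCorr x η n j ^ 2) / (1 + lever x n)))
    * (2 * l / (1 + lever x n)) * noiseCorr x η n j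

lemma expSelfNorm_pos (l B : ℝ) (n : ℕ) : 0 < expSelfNorm x η l B n := Real.exp_pos _

variable {x η} {B : ℝ} (hη : ∀ i, ∑ j, η i j ^ 2 ≤ B ^ 2) (n : ℕ)
include hη

lemma selfNorm_le : selfNorm x η n ≤ n * B ^ 2 := by
  induction n with
  | zero => simp [selfNorm_zero]
  | succ n ih =>
    have hlever := lever_nonneg x n
    have hcross : 2 * ∑ j, noiseCorr x η n j * η n j
        ≤ ∑ j, noiseCorr x η n j ^ 2 + ∑ j, η n j ^ 2 := by
      rw [Finset.mul_sum, ← Finset.sum_add_distrib]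
      gcongr with j
      linarith [two_mul_le_add_sq (noiseCorr x η n j) (η n j)]
    have hincr : (2 * ∑ j, noiseCorr x η n j * η n j - ∑ j, noiseCorr x η n j ^ 2
        + lever x n * ∑ j, η n j ^ 2) / (1 + lever x n) ≤ B ^ 2 := by
      rw [div_le_iff₀ (by positivity)]
      nlinarith [hη n]
    rw [selfNorm_succ]
    push_cast
    linarith

lemma sq_noiseCorr_le (hx : ∀ i, ‖x i‖ ≤ 1) (j : ι) : noiseCorr x η n j ^ 2 ≤ n * B ^ 2 := by
  have hG := gram_inv_posSemidef x n
  calc noiseCorr x η n j ^ 2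
      ≤ (matNorm (gram x n)⁻¹ (noiseSum x η n j) * matNorm (gram x n)⁻¹ (x n).ofLp) ^ 2 :=
        sq_le_sq' (neg_le_of_abs_le (abs_dotProduct_mulVec_le hG _ _))
          (le_of_abs_le (abs_dotProduct_mulVec_le hG _ _))
    _ = quad (gram x n)⁻¹ (noiseSum x η n j) * lever x n := by
        rw [mul_pow, matNorm_sq hG, matNorm_sq hG, lever]
    _ ≤ quad (gram x n)⁻¹ (noiseSum x η n j) :=
        mul_le_of_le_one_right (quad_nonneg hG _) (lever_le_one hx n)
    _ ≤ selfNorm x η n :=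
        Finset.single_le_sum (f := fun j => quad (gram x n)⁻¹ (noiseSum x η n j))
          (fun _ _ => quad_nonneg hG _) (Finset.mem_univ j)
    _ ≤ n * B ^ 2 := selfNorm_le hη n

lemma selfNorm_succ_sub_le :
    selfNorm x η (n + 1) - B ^ 2 * (lever x n / (1 + lever x n)) ≤ selfNorm x η n +
      (2 * ∑ j, noiseCorr x η n j * η n j - ∑ j, noiseCorr x η n j ^ 2) / (1 + lever x n) := by
  have hlever := lever_nonneg x n
  have hnoise : lever x n / (1 + lever x n) * ∑ j, η n j ^ 2
      ≤ lever x n / (1 + lever x n) * B ^ 2 :=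
    mul_le_mul_of_nonneg_left (hη n) (by positivity)
  rw [selfNorm_succ, add_div, mul_div_right_comm]
  linarith

section ExpBounds

variable {l : ℝ} (hl : 0 ≤ l)
include hl

lemma expSelfNorm_succ_le_mul :
    expSelfNorm x η l B (n + 1) ≤ expSelfNorm x η l B n *
      (Real.exp (-(l * (∑ j, noiseCorr x η n j ^ 2) / (1 + lever x n)))
        * Real.exp (2 * l / (1 + lever x n) * ∑ j, noiseCorr x η n j * η n j)) := by
  have hincr := mul_le_mul_of_nonneg_left (selfNorm_succ_sub_le (x := x) hη n) hl
  rw [expSelfNorm, expSelfNorm, ← Real.exp_add, ← Real.exp_add, Real.exp_le_exp,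
    Finset.sum_range_succ]
  linear_combination hincr

lemma exp_two_mul_sum_noiseCorr_le (hlB : 4 * l * B ^ 2 ≤ 1) :
    Real.exp (2 * l / (1 + lever x n) * ∑ j, noiseCorr x η n j * η n j) ≤
      2 * l / (1 + lever x n) * ∑ j, noiseCorr x η n j * η n j
        + Real.exp (l * (∑ j, noiseCorr x η n j ^ 2) / (1 + lever x n)) := by
  have hlever := lever_nonneg x n
  set D := 1 + lever x n
  set cη := ∑ j, noiseCorr x η n j * η n j
  set c2 := ∑ j, noiseCorr x η n j ^ 2
  have hc2 : 0 ≤ c2 := Finset.sum_nonneg fun _ _ => sq_nonneg _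
  have hcη : cη ^ 2 ≤ c2 * B ^ 2 :=
    (Finset.sum_mul_sq_le_sq_mul_sq _ _ _).trans (mul_le_mul_of_nonneg_left (hη n) hc2)
  refine (exp_le_add_exp_sq _).trans (add_le_add_right (Real.exp_le_exp.mpr ?_) _)
  calc (2 * l / D * cη) ^ 2 = l / D * (4 * l / D * cη ^ 2) := by ring
    _ ≤ l / D * (4 * l * (c2 * B ^ 2)) := by
        gcongr
        exact div_le_self (by positivity) (by linarith)
    _ = l / D * (c2 * (4 * l * B ^ 2)) := by ring
    _ ≤ l / D * c2 := by
        gcongr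
        exact mul_le_of_le_one_right hc2 hlB
    _ = l * c2 / D := by ring

lemma expSelfNorm_succ_le (hlB : 4 * l * B ^ 2 ≤ 1) :
    expSelfNorm x η l B (n + 1) ≤
      expSelfNorm x η l B n + ∑ j, expWeight x η l B n j * η n j := by
  have hpos := (expSelfNorm_pos x η l B n).le
  have hbound := exp_two_mul_sum_noiseCorr_le (x := x) hη n hl hlB
  have hweight : ∑ j, expWeight x η l B n j * η n j = expSelfNorm x η l B n *
      Real.exp (-(l * (∑ j, noiseCorr x η n j ^ 2) / (1 + lever x n))) * (2 * l / (1 + lever x n)) *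
        ∑ j, noiseCorr x η n j * η n j := by
    simp only [expWeight, Finset.mul_sum, mul_assoc]
  rw [hweight]
  set E := l * (∑ j, noiseCorr x η n j ^ 2) / (1 + lever x n)
  set cη := ∑ j, noiseCorr x η n j * η n j
  calc expSelfNorm x η l B (n + 1)
      ≤ expSelfNorm x η l B n * (Real.exp (-E) * Real.exp (2 * l / (1 + lever x n) * cη)) :=
        expSelfNorm_succ_le_mul hη n hl
    _ ≤ expSelfNorm x η l B n * (Real.exp (-E) * (2 * l / (1 + lever x n) * cη + Real.exp E)) := by
        gcongr
    _ = expSelfNorm x η l B n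
          + expSelfNorm x η l B n * Real.exp (-E) * (2 * l / (1 + lever x n)) * cη := by
        rw [mul_add, ← Real.exp_add, neg_add_cancel, Real.exp_zero]
        ring

lemma expSelfNorm_le : expSelfNorm x η l B n ≤ Real.exp (l * (n * B ^ 2)) := by
  refine Real.exp_le_exp.mpr (mul_le_mul_of_nonneg_left ?_ hl)
  have hcomp : 0 ≤ ∑ i ∈ Finset.range n, lever x i / (1 + lever x i) :=
    Finset.sum_nonneg fun i _ => div_nonneg (lever_nonneg x i) (by linarith [lever_nonneg x i])
  nlinarith [selfNorm_le (x := x) hη n, sq_nonneg B]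

lemma abs_expWeight_le (hx : ∀ i, ‖x i‖ ≤ 1) (j : ι) :
    |expWeight x η l B n j| ≤ Real.exp (l * (n * B ^ 2)) * 1 * (2 * l) * √(n * B ^ 2) := by
  have hlever := lever_nonneg x n
  rw [expWeight, abs_mul, abs_mul, abs_mul, abs_of_pos (expSelfNorm_pos ..), Real.abs_exp,
    abs_of_nonneg (by positivity : 0 ≤ 2 * l / (1 + lever x n))]
  gcongr
  · exact expSelfNorm_le hη n hl
  · rw [Real.exp_le_one_iff, Left.neg_nonpos_iff]
    exact div_nonneg (mul_nonneg hl (Finset.sum_nonneg fun _ _ => sq_nonneg _)) (by linarith)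
  · exact div_le_self (by positivity) (by linarith)
  · exact Real.abs_le_sqrt (sq_noiseCorr_le hη n hx j)

end ExpBounds

end SelfNormalized

section Measurability

variable {Ω : Type*} {mΩ : MeasurableSpace Ω}

lemma measurable_matrix_inv_apply {n : Type*} [Fintype n] [DecidableEq n] {M : Ω → Matrix n n ℝ}
    (hM : ∀ i j, Measurable fun ω => M ω i j) (i j : n) : Measurable fun ω => (M ω)⁻¹ i j := by
  have hM' : Measurable fun ω i j => M ω i j :=
    measurable_pi_lambda _ fun i => measurable_pi_lambda _ (hM i)
  have hof : Continuous fun G : n → n → ℝ => Matrix.of G := continuous_id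
  have hdet := hof.matrix_det.measurable.comp hM'
  have hadj := (hof.matrix_adjugate.matrix_elem i j).measurable.comp hM'
  simp only [inv_def, Matrix.smul_apply, Ring.inverse_eq_inv', smul_eq_mul]
  exact hdet.inv.mul hadj

variable {m : ℕ} {ι : Type*} {x : ℕ → Ω → EuclideanSpace ℝ (Fin m)} {η : ℕ → Ω → ι → ℝ} {n : ℕ}

lemma measurable_gram_inv_apply (hx : ∀ i < n, Measurable (x i)) (i j : Fin m) :
    Measurable fun ω => (gram (x · ω) n)⁻¹ i j := by
  refine measurable_matrix_inv_apply (fun i j => ?_) i j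
  simp only [gram, Matrix.add_apply, Matrix.sum_apply, vecMulVec_apply]
  refine (Finset.measurable_sum _ fun k hk => ?_).add_const _
  have := hx k (Finset.mem_range.mp hk)
  fun_prop

lemma measurable_dotProduct_gram_inv (hx : ∀ i < n, Measurable (x i)) {v w : Ω → Fin m → ℝ}
    (hv : Measurable v) (hw : Measurable w) :
    Measurable fun ω => v ω ⬝ᵥ (gram (x · ω) n)⁻¹ *ᵥ w ω := by
  simp only [dotProduct, mulVec]
  exact Finset.measurable_sum _ fun i _ => ((measurable_pi_apply i).comp hv).mul
    (Finset.measurable_sum _ fun j _ =>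
      (measurable_gram_inv_apply hx i j).mul ((measurable_pi_apply j).comp hw))

lemma measurable_noiseSum (hx : ∀ i < n, Measurable (x i))
    (hη : ∀ i < n, ∀ j, Measurable fun ω => η i ω j) (j : ι) :
    Measurable fun ω => noiseSum (x · ω) (η · ω) n j := by
  simp only [noiseSum]
  refine Finset.measurable_sum _ fun k hk => ?_
  have := hx k (Finset.mem_range.mp hk)
  have := hη k (Finset.mem_range.mp hk) j
  fun_prop

lemma measurable_lever (hx : ∀ i ≤ n, Measurable (x i)) :
    Measurable fun ω => lever (x · ω) n := by
  have hofLp : Measurable fun ω => (x n ω).ofLp := by have := hx n le_rfl; fun_prop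
  exact measurable_dotProduct_gram_inv (fun i hi => hx i hi.le) hofLp hofLp

lemma measurable_noiseCorr (hx : ∀ i ≤ n, Measurable (x i))
    (hη : ∀ i < n, ∀ j, Measurable fun ω => η i ω j) (j : ι) :
    Measurable fun ω => noiseCorr (x · ω) (η · ω) n j := by
  have hofLp : Measurable fun ω => (x n ω).ofLp := by have := hx n le_rfl; fun_prop
  exact measurable_dotProduct_gram_inv (fun i hi => hx i hi.le)
    (measurable_noiseSum (fun i hi => hx i hi.le) hη j) hofLp

variable [Fintype ι]

lemma measurable_selfNorm (hx : ∀ i < n, Measurable (x i))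
    (hη : ∀ i < n, ∀ j, Measurable fun ω => η i ω j) :
    Measurable fun ω => selfNorm (x · ω) (η · ω) n :=
  Finset.measurable_sum _ fun j _ => measurable_dotProduct_gram_inv hx
    (measurable_noiseSum hx hη j) (measurable_noiseSum hx hη j)

lemma measurable_expSelfNorm (hx : ∀ i < n, Measurable (x i))
    (hη : ∀ i < n, ∀ j, Measurable fun ω => η i ω j) (l B : ℝ) :
    Measurable fun ω => expSelfNorm (x · ω) (η · ω) l B n := by
  have hlever : ∀ k < n, Measurable fun ω => lever (x · ω) k := fun k hk =>
    measurable_lever fun i hi => hx i (hi.trans_lt hk)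
  have hcomp : Measurable fun ω =>
      ∑ i ∈ Finset.range n, lever (x · ω) i / (1 + lever (x · ω) i) :=
    Finset.measurable_sum _ fun k hk =>
      (hlever k (Finset.mem_range.mp hk)).div ((hlever k (Finset.mem_range.mp hk)).const_add 1)
  exact Real.measurable_exp.comp (((measurable_selfNorm hx hη).sub (hcomp.const_mul _)).const_mul l)

lemma measurable_expWeight (hx : ∀ i ≤ n, Measurable (x i))
    (hη : ∀ i < n, ∀ j, Measurable fun ω => η i ω j) (l B : ℝ) (j : ι) :
    Measurable fun ω => expWeight (x · ω) (η · ω) l B n j := by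
  have hlever := measurable_lever hx
  have hcorr := measurable_noiseCorr hx hη
  have hexp := measurable_expSelfNorm (fun i hi => hx i hi.le) hη l B
  unfold expWeight
  fun_prop

end Measurability

section Concentration

variable {Ω ι : Type*} {mΩ : MeasurableSpace Ω} {Pr : Measure Ω} {ℱ : Filtration ℕ mΩ}
  {η : ℕ → Ω → ι → ℝ} {B : ℝ} {K : ℕ} [Fintype ι]

/-- A vector-valued noise sequence: adapted, bounded by `B` in the Euclidean norm, and, in the
first `K` rounds, centered given the past. -/
structure IsNoise (Pr : Measure Ω) (ℱ : Filtration ℕ mΩ) (η : ℕ → Ω → ι → ℝ) (B : ℝ) (K : ℕ) :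
    Prop where
  measurable : ∀ n j, Measurable[ℱ (n + 1)] fun ω => η n ω j
  sum_sq_le : ∀ n ω, ∑ j, η n ω j ^ 2 ≤ B ^ 2
  condExp_eq_zero : ∀ n < K, ∀ j, Pr[fun ω => η n ω j | ℱ n] =ᵐ[Pr] 0

namespace IsNoise

lemma abs_le (hη : IsNoise Pr ℱ η B K) (n : ℕ) (ω : Ω) (j : ι) : |η n ω j| ≤ |B| :=
  sq_le_sq.mp <| (Finset.single_le_sum (f := fun j => η n ω j ^ 2) (fun _ _ => sq_nonneg _)
    (Finset.mem_univ j)).trans (hη.sum_sq_le n ω)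

lemma measurable_of_lt (hη : IsNoise Pr ℱ η B K) (n : ℕ) :
    ∀ i < n, ∀ j, Measurable[ℱ n] fun ω => η i ω j :=
  fun i hi j => (hη.measurable i j).mono (ℱ.mono hi) le_rfl

variable [IsProbabilityMeasure Pr]

lemma integrable (hη : IsNoise Pr ℱ η B K) (n : ℕ) (j : ι) :
    Integrable (fun ω => η n ω j) Pr :=
  .of_bound ((hη.measurable n j).mono (ℱ.le _) le_rfl).aestronglyMeasurable |B|
    (.of_forall fun ω => hη.abs_le n ω j)

variable {g : Ω → ℝ} {C : ℝ} {n : ℕ}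

lemma integrable_mul (hη : IsNoise Pr ℱ η B K) (hg : Measurable[ℱ n] g) (hC : ∀ ω, |g ω| ≤ C)
    (j : ι) : Integrable (fun ω => g ω * η n ω j) Pr :=
  (hη.integrable n j).bdd_mul (hg.mono (ℱ.le n) le_rfl).aestronglyMeasurable (.of_forall hC)

lemma integral_mul_eq_zero (hη : IsNoise Pr ℱ η B K) (hn : n < K) (hg : Measurable[ℱ n] g)
    (hC : ∀ ω, |g ω| ≤ C) (j : ι) : ∫ ω, g ω * η n ω j ∂Pr = 0 := by
  have hpull : Pr[fun ω => g ω * η n ω j | ℱ n] =ᵐ[Pr] g * Pr[fun ω => η n ω j | ℱ n] :=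
    condExp_mul_of_stronglyMeasurable_left hg.stronglyMeasurable (hη.integrable_mul hg hC j)
      (hη.integrable n j)
  have hzero : Pr[fun ω => g ω * η n ω j | ℱ n] =ᵐ[Pr] 0 := by
    filter_upwards [hpull, hη.condExp_eq_zero n hn j] with ω hω hcond
    simp [hω, hcond]
  rw [← integral_condExp (ℱ.le n), integral_congr_ae hzero]
  simp

variable {m : ℕ} {x : ℕ → Ω → EuclideanSpace ℝ (Fin m)}

lemma integrable_expSelfNorm (hη : IsNoise Pr ℱ η B K) (hxm : ∀ n, Measurable[ℱ n] (x n))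
    {l : ℝ} (hl : 0 ≤ l) (n : ℕ) :
    Integrable (fun ω => expSelfNorm (x · ω) (η · ω) l B n) Pr :=
  .of_bound ((measurable_expSelfNorm (fun i hi => (hxm i).mono (ℱ.mono hi.le) le_rfl)
      (hη.measurable_of_lt n) l B).mono (ℱ.le n) le_rfl).aestronglyMeasurable
    (Real.exp (l * (n * B ^ 2))) (.of_forall fun ω => by
      rw [Real.norm_eq_abs, abs_of_pos (expSelfNorm_pos ..)]
      exact expSelfNorm_le (fun i => hη.sum_sq_le i ω) n hl)

variable (hη : IsNoise Pr ℱ η B K) (hxm : ∀ n, Measurable[ℱ n] (x n)) (hx : ∀ n ω, ‖x n ω‖ ≤ 1)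
include hη hxm hx

lemma integral_expSelfNorm_le_one {l : ℝ} (hl : 0 ≤ l) (hlB : 4 * l * B ^ 2 ≤ 1) {n : ℕ}
    (hn : n ≤ K) : ∫ ω, expSelfNorm (x · ω) (η · ω) l B n ∂Pr ≤ 1 := by
  have hint := hη.integrable_expSelfNorm hxm hl
  induction n with
  | zero => simp [expSelfNorm, selfNorm_zero]
  | succ n ih =>
    have hweight : ∀ j, Measurable[ℱ n] fun ω => expWeight (x · ω) (η · ω) l B n j :=
      measurable_expWeight (fun i hi => (hxm i).mono (ℱ.mono hi) le_rfl)
        (hη.measurable_of_lt n) l B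
    have hweight_le := fun j ω =>
      abs_expWeight_le (fun i => hη.sum_sq_le i ω) n hl (fun i => hx i ω) j
    have hincr : Integrable (fun ω =>
        ∑ j, expWeight (x · ω) (η · ω) l B n j * η n ω j) Pr :=
      integrable_finsetSum _ fun j _ => hη.integrable_mul (hweight j) (hweight_le j) j
    have hincr_zero : ∫ ω, ∑ j, expWeight (x · ω) (η · ω) l B n j * η n ω j ∂Pr = 0 := by
      rw [integral_finsetSum _ fun j _ => hη.integrable_mul (hweight j) (hweight_le j) j]
      exact Finset.sum_eq_zero fun j _ =>
        hη.integral_mul_eq_zero hn (hweight j) (hweight_le j) j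
    calc ∫ ω, expSelfNorm (x · ω) (η · ω) l B (n + 1) ∂Pr
        ≤ ∫ ω, (expSelfNorm (x · ω) (η · ω) l B n
            + ∑ j, expWeight (x · ω) (η · ω) l B n j * η n ω j) ∂Pr :=
          integral_mono (hint _) ((hint n).add hincr)
            fun ω => expSelfNorm_succ_le (fun i => hη.sum_sq_le i ω) n hl hlB
      _ = ∫ ω, expSelfNorm (x · ω) (η · ω) l B n ∂Pr := by
          rw [integral_add (hint n) hincr, hincr_zero, add_zero]
      _ ≤ 1 := ih (Nat.le_of_succ_le hn)

lemma measureReal_le_expSelfNorm_le {l : ℝ} (hl : 0 ≤ l) (hlB : 4 * l * B ^ 2 ≤ 1) {n : ℕ}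
    (hn : n ≤ K) {δ : ℝ} (hδ : 0 < δ) :
    Pr.real {ω | 1 / δ ≤ expSelfNorm (x · ω) (η · ω) l B n} ≤ δ := by
  have hmarkov := (mul_meas_ge_le_integral_of_nonneg (.of_forall fun ω =>
    (expSelfNorm_pos (x · ω) (η · ω) l B n).le) (hη.integrable_expSelfNorm hxm hl n)
    (1 / δ)).trans (hη.integral_expSelfNorm_le_one hxm hx hl hlB hn)
  rwa [div_mul_eq_mul_div, one_mul, div_le_one hδ] at hmarkov

theorem measure_lt_selfNorm_le (hB : 0 < B) {δ : ℝ} (hδ : 0 < δ) {n : ℕ} (hn : n ≤ K) :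
    Pr {ω | B ^ 2 * (m * Real.log (m + n)) + 4 * B ^ 2 * Real.log (1 / δ)
        < selfNorm (x · ω) (η · ω) n} ≤ ENNReal.ofReal δ := by
  set l : ℝ := 1 / (4 * B ^ 2) with hl
  have hlB : 4 * l * B ^ 2 = 1 := by rw [hl]; field_simp
  have hmarkov := hη.measureReal_le_expSelfNorm_le hxm hx (by positivity) hlB.le hn hδ
  refine (measure_mono fun ω hω => ?_).trans
    ((ENNReal.le_ofReal_iff_toReal_le (measure_ne_top _ _) hδ.le).mpr hmarkov)
  have hcomp : ∑ i ∈ Finset.range n, lever (x · ω) i / (1 + lever (x · ω) i)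
      ≤ m * Real.log (m + n) :=
    (sum_lever_div_le_log_det _ n).trans (log_det_gram_le (fun i => hx i ω) n)
  rw [Set.mem_ofPred_eq] at hω
  rw [Set.mem_ofPred_eq, expSelfNorm, ← Real.exp_log (by positivity : 0 < 1 / δ), Real.exp_le_exp,
    hl, div_mul_eq_mul_div, one_mul, le_div_iff₀ (by positivity)]
  linarith [mul_le_mul_of_nonneg_left hcomp (sq_nonneg B)]

end IsNoise

end Concentration

section Freezing

variable {Ω S T : Type*} {mΩ : MeasurableSpace Ω} [MeasurableSpace S] [MeasurableSpace T]
  {μ : Measure Ω} [IsFiniteMeasure μ]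

lemma map_prodMk_eq_compProd {X : Ω → T} {Y : Ω → S} (hX : Measurable X) (hY : Measurable Y)
    (κ : Kernel T S) [IsFiniteKernel κ]
    (hrect : ∀ A B, MeasurableSet A → MeasurableSet B →
      μ (X ⁻¹' A ∩ Y ⁻¹' B) = ∫⁻ ω in X ⁻¹' A, κ (X ω) B ∂μ) :
    μ.map (fun ω => (X ω, Y ω)) = (μ.map X).compProd κ := by
  refine Measure.ext_prod fun {A B} hA hB => ?_
  rw [Measure.map_apply (hX.prodMk hY) (hA.prod hB), Measure.compProd_apply_prod hA hB,
    setLIntegral_map hA (κ.measurable_coe hB) hX, ← hrect A B hA hB]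
  rfl

lemma setIntegral_prodMk_eq_of_rect {X : Ω → T} {Y : Ω → S} (hX : Measurable X)
    (hY : Measurable Y) (κ : Kernel T S) [IsFiniteKernel κ]
    (hrect : ∀ A B, MeasurableSet A → MeasurableSet B →
      μ (X ⁻¹' A ∩ Y ⁻¹' B) = ∫⁻ ω in X ⁻¹' A, κ (X ω) B ∂μ)
    {f : T × S → ℝ} (hf : Measurable f) {C : ℝ} (hC : ∀ z, |f z| ≤ C) {A : Set T}
    (hA : MeasurableSet A) :
    ∫ ω in X ⁻¹' A, f (X ω, Y ω) ∂μ = ∫ ω in X ⁻¹' A, ∫ y, f (X ω, y) ∂κ (X ω) ∂μ := by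
  have hfint : Integrable f ((μ.map X).compProd κ) :=
    .of_bound hf.aestronglyMeasurable C (.of_forall hC)
  calc ∫ ω in X ⁻¹' A, f (X ω, Y ω) ∂μ
      = ∫ z in A ×ˢ Set.univ, f z ∂(μ.map fun ω => (X ω, Y ω)) := by
        rw [setIntegral_map (hA.prod .univ) hf.aestronglyMeasurable (hX.prodMk hY).aemeasurable,
          Set.mk_preimage_prod, Set.preimage_univ, Set.inter_univ]
    _ = ∫ t in A, ∫ y, f (t, y) ∂κ t ∂(μ.map X) := by
        rw [map_prodMk_eq_compProd hX hY κ hrect,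
          Measure.setIntegral_compProd hA .univ hfint.integrableOn]
        simp only [Measure.restrict_univ]
    _ = ∫ ω in X ⁻¹' A, ∫ y, f (X ω, y) ∂κ (X ω) ∂μ :=
        setIntegral_map hA (hf.stronglyMeasurable.integral_kernel_prod_right').aestronglyMeasurable
          hX.aemeasurable

end Freezing

section CondExpKernel

variable {Ω S : Type*} {𝓖 mΩ : MeasurableSpace Ω} {mS : MeasurableSpace S} {μ : Measure Ω}
  [IsFiniteMeasure μ]

lemma measure_inter_eq_setLIntegral_of_condExp (hle : 𝓖 ≤ mΩ) {E : Set Ω} (hE : MeasurableSet E)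
    {q : Ω → ENNReal} (hq : Measurable[mΩ] q) (hq_le : ∀ ω, q ω ≤ 1)
    (hcond : μ[E.indicator (fun _ => (1 : ℝ)) | 𝓖] =ᵐ[μ] fun ω => (q ω).toReal) {A : Set Ω}
    (hA : MeasurableSet[𝓖] A) : μ (A ∩ E) = ∫⁻ ω in A, q ω ∂μ := by
  have hq_top : ∀ ω, q ω < ⊤ := fun ω => (hq_le ω).trans_lt ENNReal.one_lt_top
  have hreal : μ.real (A ∩ E) = ∫ ω in A, (q ω).toReal ∂μ :=
    calc μ.real (A ∩ E) = ∫ ω in A, E.indicator (fun _ => (1 : ℝ)) ω ∂μ := by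
          simp [setIntegral_indicator hE]
      _ = ∫ ω in A, (q ω).toReal ∂μ := by
          rw [← setIntegral_condExp hle ((integrable_const 1).indicator hE) hA]
          exact setIntegral_congr_ae (hle _ hA) (hcond.mono fun ω hω _ => hω)
  rw [integral_toReal hq.aemeasurable (.of_forall hq_top)] at hreal
  refine (ENNReal.toReal_eq_toReal_iff' (measure_ne_top _ _) (ne_of_lt ?_)).mp hreal
  calc ∫⁻ ω in A, q ω ∂μ ≤ ∫⁻ _ in A, 1 ∂μ := lintegral_mono hq_le
    _ < ⊤ := by simp

lemma condExp_eq_integral_kernel (hle : 𝓖 ≤ mΩ) {Y : Ω → S} (hY : Measurable Y)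
    (κ : Kernel[𝓖, mS] Ω S) (hκ : IsMarkovKernel κ)
    (hcond : ∀ B, MeasurableSet B →
      μ[(Y ⁻¹' B).indicator (fun _ => (1 : ℝ)) | 𝓖] =ᵐ[μ] fun ω => (κ ω).real B)
    {f : Ω → S → ℝ} (hf : Measurable[𝓖.prod mS] (Function.uncurry f)) {C : ℝ}
    (hC : ∀ ω y, |f ω y| ≤ C) :
    μ[fun ω => f ω (Y ω) | 𝓖] =ᵐ[μ] fun ω => ∫ y, f ω y ∂κ ω := by
  have hid : Measurable[mΩ, 𝓖] (id : Ω → Ω) := measurable_id'' hle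
  have hrect : ∀ A B, MeasurableSet[𝓖] A → MeasurableSet B →
      μ (A ∩ Y ⁻¹' B) = ∫⁻ ω in A, κ ω B ∂μ := fun A B hA hB =>
    measure_inter_eq_setLIntegral_of_condExp hle (hY hB)
      ((κ.measurable_coe hB).mono hle le_rfl) (fun ω => prob_le_one) (hcond B hB) hA
  have hfY : Measurable fun ω => f ω (Y ω) := hf.comp (hid.prodMk hY)
  have hint : StronglyMeasurable[𝓖] fun ω => ∫ y, f ω y ∂κ ω :=
    hf.stronglyMeasurable.integral_kernel_prod_right'
  have hint_le : ∀ ω, |∫ y, f ω y ∂κ ω| ≤ C := fun ω => by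
    simpa using norm_integral_le_of_norm_le_const (f := f ω) (μ := κ ω) (C := C) (.of_forall (hC ω))
  refine (ae_eq_condExp_of_forall_setIntegral_eq hle
    (.of_bound hfY.aestronglyMeasurable C (.of_forall fun ω => hC ω _)) (fun A _ _ => ?_)
    (fun A hA _ => ?_) hint.aestronglyMeasurable).symm
  · exact (Integrable.of_bound (hint.mono hle).aestronglyMeasurable C
      (.of_forall hint_le)).integrableOn
  · exact (@setIntegral_prodMk_eq_of_rect Ω S Ω mΩ mS 𝓖 μ _ id Y hid hY κ _ hrect _ hf C
      (fun z => hC z.1 z.2) A hA).symm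

end CondExpKernel

section History

variable {S A Ω : Type*} [MeasurableSpace S] [MeasurableSpace A] {d H : ℕ}
  {s : ℕ → ℕ → Ω → S} {a : ℕ → ℕ → Ω → A} {r : ℕ → ℕ → Ω → EuclideanSpace ℝ (Fin d)}

lemma measurable_history_state {k h i j : ℕ} (hij : (i < k ∧ j ≤ H) ∨ (i = k ∧ j ≤ h)) :
    Measurable[history H s a r k h] (s i j) :=
  (comap_measurable (s i j)).mono
    ((le_iSup₂_of_le i j (le_iSup (fun _ => _) hij)).trans (le_sup_left.trans le_sup_left)) le_rfl

lemma measurable_history_action {k h i j : ℕ} (hij : (i < k ∧ j < H) ∨ (i = k ∧ j ≤ h)) :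
    Measurable[history H s a r k h] (a i j) :=
  (comap_measurable (a i j)).mono
    ((le_iSup₂_of_le i j (le_iSup (fun _ => _) hij)).trans (le_sup_right.trans le_sup_left)) le_rfl

lemma measurable_history_return {k h i j : ℕ} (hij : (i < k ∧ j < H) ∨ (i = k ∧ j < h)) :
    Measurable[history H s a r k h] (r i j) :=
  (comap_measurable (r i j)).mono
    ((le_iSup₂_of_le i j (le_iSup (fun _ => _) hij)).trans le_sup_right) le_rfl

lemma measurable_history_pair (k h : ℕ) :
    Measurable[history H s a r k h] fun ω => (s k h ω, a k h ω) :=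
  (measurable_history_state (.inr ⟨rfl, le_rfl⟩)).prodMk
    (measurable_history_action (.inr ⟨rfl, le_rfl⟩))

lemma history_le {𝓖 : MeasurableSpace Ω} {k h : ℕ}
    (hs : ∀ i j, (i < k ∧ j ≤ H) ∨ (i = k ∧ j ≤ h) → Measurable[𝓖] (s i j))
    (ha : ∀ i j, (i < k ∧ j < H) ∨ (i = k ∧ j ≤ h) → Measurable[𝓖] (a i j))
    (hr : ∀ i j, (i < k ∧ j < H) ∨ (i = k ∧ j < h) → Measurable[𝓖] (r i j)) :
    history H s a r k h ≤ 𝓖 :=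
  sup_le (sup_le
      (iSup_le fun i => iSup_le fun j => iSup_le fun hij => (hs i j hij).comap_le)
      (iSup_le fun i => iSup_le fun j => iSup_le fun hij => (ha i j hij).comap_le))
    (iSup_le fun i => iSup_le fun j => iSup_le fun hij => (hr i j hij).comap_le)

lemma monotone_history {h : ℕ} (hh : h < H) : Monotone fun k => history H s a r k h :=
  monotone_nat_of_le_succ fun _ => history_le
    (fun _ _ hij => measurable_history_state (by omega))
    (fun _ _ hij => measurable_history_action (by omega))
    (fun _ _ hij => measurable_history_return (by omega))

/-- The return sample, set to zero on the null event that it leaves the unit ball: the concentration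
inequality asks for noise that is bounded everywhere. -/
def truncReturn (v : EuclideanSpace ℝ (Fin d)) : EuclideanSpace ℝ (Fin d) :=
  if ‖v‖ ≤ 1 then v else 0

lemma norm_truncReturn_le (v : EuclideanSpace ℝ (Fin d)) : ‖truncReturn v‖ ≤ 1 := by
  unfold truncReturn
  split_ifs with hv
  · exact hv
  · simp

lemma measurable_truncReturn : Measurable (truncReturn (d := d)) :=
  .ite (measurableSet_le measurable_norm measurable_const) measurable_id measurable_const

variable {mΩ : MeasurableSpace Ω} {M : VMDP S A d} {s₁ : S} {K : ℕ}
  {rule : (ℕ → ℕ → S) → (ℕ → ℕ → A) → ℕ → ℕ → S → A} {Pr : Measure Ω}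

lemma VMDP.measurable_integral_P (M : VMDP S A d) (h : ℕ) {𝓖 : MeasurableSpace Ω}
    {z : Ω → S × A} (hz : Measurable[𝓖] z) {f : Ω → S → ℝ}
    (hf : Measurable[𝓖.prod inferInstance] (Function.uncurry f)) :
    Measurable[𝓖] fun ω => ∫ y, f ω y ∂M.P h (z ω) := by
  have := M.markov h
  exact (hf.stronglyMeasurable.integral_kernel_prod_right' (κ := (M.P h).comap z hz)).measurable

lemma VMDP.abs_integral_P_le (M : VMDP S A d) (h : ℕ) (z : S × A) {f : S → ℝ} {C : ℝ}
    (hC : ∀ y, |f y| ≤ C) : |∫ y, f y ∂M.P h z| ≤ C := by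
  have := M.markov h
  simpa using norm_integral_le_of_norm_le_const (f := f) (μ := M.P h z) (C := C) (.of_forall hC)

namespace IsRun

/-- The filtration, indexed by the episodes, of the information available after the action of step
`h`. -/
def filtration (hrun : IsRun M s₁ H K rule Pr s a r) {h : ℕ} (hh : h < H) : Filtration ℕ mΩ where
  seq k := history H s a r k h
  mono' := monotone_history hh
  le' _ := history_le (fun i j _ => hrun.measurable_s i j) (fun i j _ => hrun.measurable_a i j)
    (fun i j _ => hrun.measurable_r i j)

variable [IsProbabilityMeasure Pr] (hrun : IsRun M s₁ H K rule Pr s a r) {h : ℕ} (hh : h < H)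
include hrun hh

lemma condExp_transition {k : ℕ} (hk : k < K) {f : Ω → S → ℝ}
    (hf : Measurable[(history H s a r k h).prod inferInstance] (Function.uncurry f))
    {C : ℝ} (hC : ∀ ω y, |f ω y| ≤ C) :
    Pr[fun ω => f ω (s k (h + 1) ω) | history H s a r k h]
      =ᵐ[Pr] fun ω => ∫ y, f ω y ∂M.P h (s k h ω, a k h ω) := by
  have := M.markov h
  exact condExp_eq_integral_kernel ((hrun.filtration hh).le k) (hrun.measurable_s k (h + 1))
    ((M.P h).comap _ (measurable_history_pair k h)) ⟨fun _ => this.isProbabilityMeasure _⟩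
    (hrun.transition k hk h hh) hf hC

lemma isNoise_transition {f : ℕ → Ω → S → ℝ}
    (hf : ∀ k, Measurable[(history H s a r k h).prod inferInstance] (Function.uncurry (f k)))
    {C : ℝ} (hC : ∀ k ω y, |f k ω y| ≤ C) :
    IsNoise Pr (hrun.filtration hh)
      (fun k ω (_ : Unit) =>
        f k ω (s k (h + 1) ω) - ∫ y, f k ω y ∂M.P h (s k h ω, a k h ω)) (2 * C) K := by
  have hmean : ∀ k, Measurable[history H s a r k h]
      fun ω => ∫ y, f k ω y ∂M.P h (s k h ω, a k h ω) := fun k =>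
    M.measurable_integral_P h (measurable_history_pair k h) (hf k)
  have hmean_le : ∀ k ω, |∫ y, f k ω y ∂M.P h (s k h ω, a k h ω)| ≤ C := fun k ω =>
    M.abs_integral_P_le h _ (hC k ω)
  have hsample : ∀ k, Measurable[history H s a r (k + 1) h]
      fun ω => f k ω (s k (h + 1) ω) := fun k =>
    (hf k).comp (Measurable.prodMk (measurable_id'' (monotone_history hh k.le_succ))
      (measurable_history_state (.inl ⟨k.lt_succ_self, hh⟩)))
  have hle : ∀ k, history H s a r k h ≤ mΩ := (hrun.filtration hh).le
  refine ⟨fun k _ => (hsample k).sub ((hmean k).mono (monotone_history hh k.le_succ) le_rfl),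
    fun k ω => ?_, fun k hk _ => ?_⟩
  · rw [Fintype.sum_unique]
    refine sq_le_sq' ?_ ?_ <;>
      linarith [abs_le.mp (hC k ω (s k (h + 1) ω)), abs_le.mp (hmean_le k ω)]
  · have hsample_int : Integrable (fun ω => f k ω (s k (h + 1) ω)) Pr :=
      .of_bound ((hsample k).mono (hle _) le_rfl).aestronglyMeasurable C
        (.of_forall fun ω => hC k ω _)
    have hmean_int : Integrable (fun ω => ∫ y, f k ω y ∂M.P h (s k h ω, a k h ω)) Pr :=
      .of_bound ((hmean k).mono (hle k) le_rfl).aestronglyMeasurable C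
        (.of_forall (hmean_le k))
    have hpred := condExp_of_stronglyMeasurable (hle k) (hmean k).stronglyMeasurable hmean_int
    filter_upwards [condExp_sub hsample_int hmean_int (history H s a r k h),
      hrun.condExp_transition hh hk (hf k) (hC k)] with ω hsub htrans
    exact hsub.trans (by rw [Pi.sub_apply, htrans, hpred, sub_self]; rfl)

lemma condExp_truncReturn {k : ℕ} (hk : k < K) (j : Fin d) :
    Pr[fun ω => truncReturn (r k h ω) j | history H s a r k h]
      =ᵐ[Pr] fun ω => M.r h (s k h ω, a k h ω) j := by
  have hint : Integrable (r k h) Pr :=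
    .of_bound (hrun.measurable_r k h).aestronglyMeasurable 1 (hrun.return_ball k hk h hh)
  have htrunc : (fun ω => truncReturn (r k h ω) j) =ᵐ[Pr] fun ω => r k h ω j := by
    filter_upwards [hrun.return_ball k hk h hh] with ω hω
    rw [truncReturn, if_pos hω]
  refine (condExp_congr_ae htrunc).trans (.trans
    ((EuclideanSpace.proj (𝕜 := ℝ) j).comp_condExp_comm hint).symm ?_)
  filter_upwards [hrun.return_mean k hk h hh] with ω hω
  simp [hω]

lemma isNoise_return :
    IsNoise Pr (hrun.filtration hh)
      (fun k ω (j : Fin d) => truncReturn (r k h ω) j - M.r h (s k h ω, a k h ω) j) 2 K := by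
  have hmean : ∀ k j, Measurable[history H s a r k h]
      fun ω => M.r h (s k h ω, a k h ω) j := fun k j =>
    (measurable_pi_apply j).comp ((WithLp.measurable_ofLp 2 _).comp
      ((M.measurable_r h).comp (measurable_history_pair k h)))
  have hsample : ∀ k j, Measurable[history H s a r (k + 1) h]
      fun ω => truncReturn (r k h ω) j := fun k j =>
    (measurable_pi_apply j).comp ((WithLp.measurable_ofLp 2 _).comp
      (measurable_truncReturn.comp (measurable_history_return (.inl ⟨k.lt_succ_self, hh⟩))))
  have hle : ∀ k, history H s a r k h ≤ mΩ := (hrun.filtration hh).le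
  refine ⟨fun k j => (hsample k j).sub ((hmean k j).mono (monotone_history hh k.le_succ) le_rfl),
    fun k ω => ?_, fun k hk j => ?_⟩
  · calc ∑ j, (truncReturn (r k h ω) j - M.r h (s k h ω, a k h ω) j) ^ 2
        = ‖truncReturn (r k h ω) - M.r h (s k h ω, a k h ω)‖ ^ 2 := by
          rw [EuclideanSpace.real_norm_sq_eq]
          rfl
      _ ≤ 2 ^ 2 := by
          refine pow_le_pow_left₀ (norm_nonneg _) ((norm_sub_le _ _).trans ?_) 2
          linarith [norm_truncReturn_le (r k h ω), M.norm_r_le h (s k h ω, a k h ω)]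
  · have hsample_int : Integrable (fun ω => truncReturn (r k h ω) j) Pr :=
      .of_bound ((hsample k j).mono (hle _) le_rfl).aestronglyMeasurable 1
        (.of_forall fun ω => (PiLp.norm_apply_le _ j).trans (norm_truncReturn_le _))
    have hmean_int : Integrable (fun ω => M.r h (s k h ω, a k h ω) j) Pr :=
      .of_bound ((hmean k j).mono (hle k) le_rfl).aestronglyMeasurable 1
        (.of_forall fun ω => (PiLp.norm_apply_le _ j).trans (M.norm_r_le _ _))
    have hpred := condExp_of_stronglyMeasurable (hle k) (hmean k j).stronglyMeasurable hmean_int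
    filter_upwards [condExp_sub hsample_int hmean_int (history H s a r k h),
      hrun.condExp_truncReturn hh hk j] with ω hsub htrunc
    exact hsub.trans (by rw [Pi.sub_apply, htrunc, hpred, sub_self]; rfl)

end IsRun

end History

section Values

variable {S A : Type*} [MeasurableSpace S] [MeasurableSpace A] {d : ℕ}

lemma measurable_finCons {T : Type*} [MeasurableSpace T] (n : ℕ) :
    Measurable fun q : T × (Fin n → T) => (Fin.cons q.1 q.2 : Fin (n + 1) → T) := by
  simpa [MeasurableEquiv.piFinSuccAbove, Fin.insertNthEquiv, Fin.insertNth_zero] using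
    (MeasurableEquiv.piFinSuccAbove (fun _ : Fin (n + 1) => T) 0).symm.measurable

instance VMDP.isMarkovKernel_traj (M : VMDP S A d) (π : Policy S A) (n h : ℕ) :
    IsMarkovKernel (M.traj π n h) := by
  induction n generalizing h with
  | zero => rw [VMDP.traj]; infer_instance
  | succ n ih =>
    have := M.markov h
    have := π.markov h
    have := ih (h + 1)
    rw [VMDP.traj]
    exact Kernel.IsMarkovKernel.map _ (measurable_finCons n)

variable (M : VMDP S A d) (π : Policy S A)

lemma VMDP.integral_traj_succ {n h : ℕ} (s : S) {F : (Fin (n + 1) → S × A) → ℝ}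
    (hF : Measurable F) {C : ℝ} (hC : ∀ τ, |F τ| ≤ C) :
    ∫ τ, F τ ∂M.traj π (n + 1) h s =
      ∫ a, ∫ y, ∫ τ, F (Fin.cons (s, a) τ) ∂M.traj π n (h + 1) y ∂M.P h (s, a) ∂π.act h s := by
  have := M.markov h
  have := π.markov h
  let G : (S × A) × (Fin n → S × A) → ℝ := fun q => F (Fin.cons q.1 q.2)
  have hG : Measurable G := hF.comp (measurable_finCons n)
  have hG_int : ∀ {ν : Measure ((S × A) × (Fin n → S × A))} [IsProbabilityMeasure ν],
      Integrable G ν := .of_bound hG.aestronglyMeasurable C (.of_forall fun q => hC _)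
  rw [VMDP.traj, Kernel.map_apply _ (measurable_finCons n),
    integral_map (measurable_finCons n).aemeasurable hF.aestronglyMeasurable]
  change ∫ q, G q ∂_ = _
  rw [Kernel.integral_comp hG_int, Kernel.prod_apply, Kernel.id_apply, Measure.dirac_prod,
    integral_map measurable_prodMk_left.aemeasurable
      hG.stronglyMeasurable.integral_kernel.aestronglyMeasurable]
  refine integral_congr_ae (.of_forall fun a => ?_)
  have hG_cons : Measurable fun τ => G ((s, a), τ) := hG.comp measurable_prodMk_left
  change ∫ q, G q ∂((Kernel.id ×ₖ (M.traj π n (h + 1) ∘ₖ M.P h)) (s, a)) = _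
  rw [Kernel.prod_apply, Kernel.id_apply, Measure.dirac_prod,
    integral_map measurable_prodMk_left.aemeasurable hG.aestronglyMeasurable,
    Kernel.integral_comp (.of_bound hG_cons.aestronglyMeasurable C (.of_forall fun τ => hC _))]

/-- The scalarized value, given the state at step `h`, of the `n` steps from `h` on. -/
def VMDP.valueN (θ : EuclideanSpace ℝ (Fin d)) (n h : ℕ) (s : S) : ℝ :=
  ∫ τ, ∑ i : Fin n, inner ℝ θ (M.r (h + i) (τ i)) ∂(M.traj π n h s)

variable {θ : EuclideanSpace ℝ (Fin d)}

lemma VMDP.abs_inner_r_le (hθ : ‖θ‖ ≤ 1) (h : ℕ) (z : S × A) : |inner ℝ θ (M.r h z)| ≤ 1 :=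
  (abs_real_inner_le_norm _ _).trans (mul_le_one₀ hθ (norm_nonneg _) (M.norm_r_le h z))

lemma VMDP.abs_sum_inner_r_le (hθ : ‖θ‖ ≤ 1) (n h : ℕ) (τ : Fin n → S × A) :
    |∑ i : Fin n, inner ℝ θ (M.r (h + i) (τ i))| ≤ n := by
  calc |∑ i : Fin n, inner ℝ θ (M.r (h + i) (τ i))|
      ≤ ∑ i : Fin n, |inner ℝ θ (M.r (h + i) (τ i))| := Finset.abs_sum_le_sum_abs _ _
    _ ≤ ∑ _i : Fin n, (1 : ℝ) := Finset.sum_le_sum fun i _ => M.abs_inner_r_le hθ _ _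
    _ = n := by simp

lemma VMDP.measurable_sum_inner_r (n h : ℕ) :
    Measurable fun τ : Fin n → S × A => ∑ i : Fin n, inner ℝ θ (M.r (h + i) (τ i)) :=
  Finset.measurable_sum _ fun i _ =>
    measurable_const.inner ((M.measurable_r _).comp (measurable_pi_apply i))

lemma VMDP.integrable_sum_inner_r (hθ : ‖θ‖ ≤ 1) (n h : ℕ) (s : S) :
    Integrable (fun τ : Fin n → S × A => ∑ i : Fin n, inner ℝ θ (M.r (h + i) (τ i)))
      (M.traj π n h s) :=
  .of_bound (M.measurable_sum_inner_r n h).aestronglyMeasurable n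
    (.of_forall fun τ => M.abs_sum_inner_r_le hθ n h τ)

lemma VMDP.abs_valueN_le (hθ : ‖θ‖ ≤ 1) (n h : ℕ) (s : S) : |M.valueN π θ n h s| ≤ n := by
  have hle := norm_integral_le_of_norm_le_const (μ := M.traj π n h s) (C := n)
    (f := fun τ => ∑ i : Fin n, inner ℝ θ (M.r (h + i) (τ i)))
    (.of_forall fun τ => M.abs_sum_inner_r_le hθ n h τ)
  rwa [probReal_univ, mul_one] at hle

lemma VMDP.measurable_valueN (n h : ℕ) : Measurable (M.valueN π θ n h) :=
  (M.measurable_sum_inner_r n h).stronglyMeasurable.integral_kernel.measurable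

lemma VMDP.integrable_valueN (hθ : ‖θ‖ ≤ 1) (n h : ℕ) (μ : Measure S) [IsFiniteMeasure μ] :
    Integrable (M.valueN π θ n h) μ :=
  .of_bound (M.measurable_valueN π n h).aestronglyMeasurable n
    (.of_forall fun s => M.abs_valueN_le π hθ n h s)

/-- The scalarized value of choosing the state-action pair `z` at step `h` and following `π` for `n`
more steps. -/
def VMDP.actionValue (θ : EuclideanSpace ℝ (Fin d)) (n h : ℕ) (z : S × A) : ℝ :=
  inner ℝ θ (M.r h z) + ∫ y, M.valueN π θ n (h + 1) y ∂M.P h z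

lemma VMDP.measurable_actionValue (n h : ℕ) : Measurable (M.actionValue π θ n h) :=
  (measurable_const.inner (M.measurable_r h)).add
    (M.measurable_valueN π n (h + 1)).stronglyMeasurable.integral_kernel.measurable

lemma VMDP.abs_actionValue_le (hθ : ‖θ‖ ≤ 1) (n h : ℕ) (z : S × A) :
    |M.actionValue π θ n h z| ≤ n + 1 :=
  (abs_add_le _ _).trans <| (add_le_add (M.abs_inner_r_le hθ h z)
    (M.abs_integral_P_le h z (M.abs_valueN_le π hθ n (h + 1)))).trans_eq (add_comm _ _)

theorem VMDP.valueN_succ (hθ : ‖θ‖ ≤ 1) (n h : ℕ) (s : S) :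
    M.valueN π θ (n + 1) h s = ∫ a, M.actionValue π θ n h (s, a) ∂π.act h s := by
  have := M.markov h
  have hcons : ∀ a (τ : Fin n → S × A),
      ∑ i : Fin (n + 1), inner ℝ θ (M.r (h + i) ((Fin.cons (s, a) τ : Fin (n + 1) → S × A) i))
        = inner ℝ θ (M.r h (s, a)) + ∑ i : Fin n, inner ℝ θ (M.r (h + 1 + i) (τ i)) := by
    intro a τ
    simp [Fin.sum_univ_succ, add_assoc, add_comm 1]
  have hfuture : ∀ a y, ∫ τ, (inner ℝ θ (M.r h (s, a))
      + ∑ i : Fin n, inner ℝ θ (M.r (h + 1 + i) (τ i))) ∂M.traj π n (h + 1) y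
        = inner ℝ θ (M.r h (s, a)) + M.valueN π θ n (h + 1) y := by
    intro a y
    rw [integral_add (integrable_const _) (M.integrable_sum_inner_r π hθ n (h + 1) y),
      integral_const, probReal_univ, one_smul]
    rfl
  rw [VMDP.valueN, M.integral_traj_succ π s (M.measurable_sum_inner_r (n + 1) h)
    (fun τ => M.abs_sum_inner_r_le hθ (n + 1) h τ)]
  simp only [hcons, hfuture]
  refine integral_congr_ae (.of_forall fun a => ?_)
  dsimp only
  rw [integral_add (integrable_const _) (M.integrable_valueN π hθ n (h + 1) _),
    integral_const, probReal_univ, one_smul, VMDP.actionValue]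

lemma VMDP.valueN_succ_le (hθ : ‖θ‖ ≤ 1) {n h : ℕ} {s : S} {C : ℝ}
    (hC : ∀ a, M.actionValue π θ n h (s, a) ≤ C) : M.valueN π θ (n + 1) h s ≤ C := by
  have := π.markov h
  have hint : Integrable (fun a => M.actionValue π θ n h (s, a)) (π.act h s) :=
    .of_bound ((M.measurable_actionValue π n h).comp measurable_prodMk_left).aestronglyMeasurable
      (n + 1) (.of_forall fun a => M.abs_actionValue_le π hθ n h (s, a))
  calc M.valueN π θ (n + 1) h s = ∫ a, M.actionValue π θ n h (s, a) ∂π.act h s :=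
        M.valueN_succ π hθ n h s
    _ ≤ ∫ _a, C ∂π.act h s := integral_mono hint (integrable_const C) hC
    _ = C := by simp

lemma VMDP.valueN_ofFun_succ (hθ : ‖θ‖ ≤ 1) {f : ℕ → S → A} (hf : ∀ h, Measurable (f h))
    (n h : ℕ) (s : S) : M.valueN (Policy.ofFun f hf) θ (n + 1) h s =
      M.actionValue (Policy.ofFun f hf) θ n h (s, f h s) := by
  rw [M.valueN_succ _ hθ, Policy.ofFun, Kernel.deterministic_apply]
  exact integral_dirac' _ _
    ((M.measurable_actionValue _ n h).comp measurable_prodMk_left).stronglyMeasurable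

end Values

section SignedMeasure

variable {S : Type*} [MeasurableSpace S] {V : S → ℝ} {C : ℝ}

lemma integrable_signedMeasure_of_abs_le (hV : Measurable V) (hC : ∀ s, |V s| ≤ C)
    (μ : SignedMeasure S) : VectorMeasure.Integrable μ V := by
  have : IsFiniteMeasure μ.variation := by
    rw [← SignedMeasure.totalVariation_eq_variation]
    infer_instance
  exact .of_bound hV.aestronglyMeasurable C (.of_forall hC)

lemma abs_integral_signedMeasure_le (hC : ∀ s, |V s| ≤ C) (μ : SignedMeasure S) :
    |∫ᵛ y, V y ∂<•μ| ≤ C * μ.totalVariation.real Set.univ := by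
  have hflip : ‖(ContinuousLinearMap.lsmul ℝ ℝ : ℝ →L[ℝ] ℝ →L[ℝ] ℝ).flip‖ ≤ 1 := by
    rw [ContinuousLinearMap.opNorm_flip]
    exact ContinuousLinearMap.opNorm_lsmul_le
  have hint : ∫ y, ‖V y‖ ∂μ.totalVariation ≤ C * μ.totalVariation.real Set.univ :=
    (le_abs_self _).trans (norm_integral_le_of_norm_le_const
      (.of_forall fun y => (norm_norm (V y)).trans_le (hC y)))
  have hnorm := VectorMeasure.norm_integral_le_integral_norm (μ := μ) (f := V)
    (B := (ContinuousLinearMap.lsmul ℝ ℝ : ℝ →L[ℝ] ℝ →L[ℝ] ℝ).flip)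
  rw [← SignedMeasure.totalVariation_eq_variation] at hnorm
  exact hnorm.trans
    ((mul_le_of_le_one_left (integral_nonneg fun y => norm_nonneg _) hflip).trans hint)

lemma integral_eq_sum_integral_signedMeasure {ι : Type*} [Fintype ι] (hV : Measurable V)
    (hC : ∀ s, |V s| ≤ C) {μ : ι → SignedMeasure S} {c : ι → ℝ} {P : Measure S}
    [IsFiniteMeasure P] (hP : ∀ B, MeasurableSet B → P.real B = ∑ i, μ i B * c i) :
    ∫ y, V y ∂P = ∑ i, (∫ᵛ y, V y ∂<•μ i) * c i := by
  have hP_eq : P.toSignedMeasure = ∑ i, c i • μ i := by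
    ext B hB
    rw [Measure.toSignedMeasure_apply_measurable hB, hP B hB]
    simp [mul_comm]
  rw [← VectorMeasure.integral_toSignedMeasure, hP_eq,
    VectorMeasure.integral_finsetSum_vectorMeasure fun i _ =>
      (integrable_signedMeasure_of_abs_le hV hC (μ i)).smul_vectorMeasure (c i)]
  simp only [VectorMeasure.integral_smul_vectorMeasure, smul_eq_mul, mul_comm]

end SignedMeasure

section Linear

variable {S A : Type*} [MeasurableSpace S] [MeasurableSpace A] {d m H : ℕ}
  {M : VMDP S A d} {φ : S × A → EuclideanSpace ℝ (Fin m)}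

lemma VMDP.IsLinear.exists_transition_weight (hM : M.IsLinear H φ) {h : ℕ} (hh : h < H)
    {V : S → ℝ} (hV : Measurable V) {C : ℝ} (hC0 : 0 ≤ C) (hC : ∀ s, |V s| ≤ C) :
    ∃ w : EuclideanSpace ℝ (Fin m), ‖w‖ ≤ C * √m ∧
      ∀ z, ∫ y, V y ∂M.P h z = inner ℝ w (φ z) := by
  obtain ⟨μ, hμ, hP⟩ := hM.transition h hh
  have := M.markov h
  refine ⟨WithLp.toLp 2 fun i => ∫ᵛ y, V y ∂<•μ i, ?_, fun z => ?_⟩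
  · refine le_trans ?_ (mul_le_mul_of_nonneg_left hμ hC0)
    rw [← Real.norm_of_nonneg hC0, ← norm_smul, EuclideanSpace.norm_eq, EuclideanSpace.norm_eq]
    refine Real.sqrt_le_sqrt (Finset.sum_le_sum fun i _ => pow_le_pow_left₀ (norm_nonneg _) ?_ 2)
    refine (abs_integral_signedMeasure_le hC (μ i)).trans (le_of_eq ?_)
    simp [abs_of_nonneg hC0, abs_of_nonneg measureReal_nonneg]
  · rw [integral_eq_sum_integral_signedMeasure hV hC (hP z),
      EuclideanSpace.inner_eq_star_dotProduct, star_trivial, dotProduct_comm]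
    rfl

lemma VMDP.IsLinear.exists_return_weight (hM : M.IsLinear H φ) {h : ℕ} (hh : h < H)
    {θ : EuclideanSpace ℝ (Fin d)} (hθ : ‖θ‖ ≤ 1) :
    ∃ w : EuclideanSpace ℝ (Fin m), ‖w‖ ≤ √m ∧ ∀ z, inner ℝ θ (M.r h z) = inner ℝ w (φ z) := by
  obtain ⟨W, hW, hr⟩ := hM.returns h hh
  set L := (Matrix.toEuclideanLin W).toContinuousLinearMap
  refine ⟨L.adjoint θ, ?_, fun z => ?_⟩
  · calc ‖L.adjoint θ‖ ≤ ‖L.adjoint‖ * ‖θ‖ := L.adjoint.le_opNorm θ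
      _ ≤ ‖L.adjoint‖ := mul_le_of_le_one_right (norm_nonneg _) hθ
      _ ≤ √m := by rwa [LinearIsometryEquiv.norm_map]
  · rw [ContinuousLinearMap.adjoint_inner_left, hr z]
    rfl

/-- The total mass of the transition probabilities pins down a one-dimensional feature. -/
lemma VMDP.IsLinear.r_eq_r_of_dim_one {φ : S × A → EuclideanSpace ℝ (Fin 1)}
    (hM : M.IsLinear H φ) {h : ℕ} (hh : h < H) (z z' : S × A) : M.r h z = M.r h z' := by
  obtain ⟨μ, -, hP⟩ := hM.transition h hh
  obtain ⟨W, -, hr⟩ := hM.returns h hh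
  have := M.markov h
  have hmass : ∀ z, 1 = μ 0 Set.univ * φ z 0 := fun z => by simpa using hP z Set.univ .univ
  have hmass_ne : μ 0 Set.univ ≠ 0 := fun h0 => by simpa [h0] using hmass z
  have hφ : φ z = φ z' := by
    ext i
    rw [Subsingleton.elim i 0]
    exact mul_left_cancel₀ hmass_ne ((hmass z).symm.trans (hmass z'))
  rw [hr z, hr z', hφ]

lemma VMDP.valueN_eq_of_r_eq (hr : ∀ h < H, ∀ z z', M.r h z = M.r h z')
    {θ : EuclideanSpace ℝ (Fin d)} (π π' : Policy S A) {n h : ℕ} (hn : h + n ≤ H) (s : S) :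
    M.valueN π θ n h s = M.valueN π' θ n h s := by
  obtain ⟨τ₀⟩ : Nonempty (Fin n → S × A) := nonempty_of_isProbabilityMeasure (M.traj π n h s)
  have hsum : ∀ τ : Fin n → S × A, ∑ i : Fin n, inner ℝ θ (M.r (h + i) (τ i))
      = ∑ i : Fin n, inner ℝ θ (M.r (h + i) (τ₀ i)) := fun τ =>
    Finset.sum_congr rfl fun i _ => by rw [hr (h + i) (by omega) (τ i) (τ₀ i)]
  simp [VMDP.valueN, hsum]

end Linear

section Net

/-- The net has one point for every occupied cell of a grid of mesh `ε`. -/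
lemma exists_grid_net {T I : Type*} [Nonempty T] (coord : T → I → ℝ) {L ε : ℝ} (hε : 0 < ε)
    (hL : ∀ p i, |coord p i| ≤ L) :
    ∃ rep : (I → Fin (⌊2 * L / ε⌋₊ + 1)) → T,
      ∀ p, ∃ c, ∀ i, |coord p i - coord (rep c) i| ≤ ε := by
  have hcell : ∀ p i, ⌊(coord p i + L) / ε⌋₊ < ⌊2 * L / ε⌋₊ + 1 := fun p i => by
    refine Nat.lt_succ_of_le (Nat.floor_mono ?_)
    gcongr
    linarith [(abs_le.mp (hL p i)).2]
  let cell : T → I → Fin (⌊2 * L / ε⌋₊ + 1) := fun p i => ⟨_, hcell p i⟩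
  have hnear : ∀ p q, cell p = cell q → ∀ i, |coord p i - coord q i| ≤ ε := fun p q hpq i => by
    have hnonneg : ∀ t, 0 ≤ (coord t i + L) / ε := fun t =>
      div_nonneg (by linarith [(abs_le.mp (hL t i)).1]) hε.le
    have hfloor : ⌊(coord p i + L) / ε⌋₊ = ⌊(coord q i + L) / ε⌋₊ :=
      congrArg Fin.val (congrFun hpq i)
    have hp := (Nat.floor_eq_iff (hnonneg p)).mp hfloor
    have hq := (Nat.floor_eq_iff (hnonneg q)).mp rfl
    have hdiff : |(coord p i + L) / ε - (coord q i + L) / ε| ≤ 1 :=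
      abs_le.mpr ⟨by linarith [hp.1, hq.2], by linarith [hp.2, hq.1]⟩
    rwa [← sub_div, abs_div, abs_of_pos hε, div_le_one hε, add_sub_add_right_eq_sub] at hdiff
  exact ⟨Function.invFun cell, fun p =>
    ⟨cell p, hnear p _ (Function.invFun_eq ⟨p, rfl⟩).symm⟩⟩

end Net

section Perturbation

lemma abs_sqrt_sub_sqrt_le (x y : ℝ) : |√x - √y| ≤ √|x - y| := by
  wlog h : y ≤ x generalizing x y
  · rw [abs_sub_comm, abs_sub_comm x y]
    exact this y x (le_of_not_ge h)
  rw [abs_of_nonneg (sub_nonneg.mpr (Real.sqrt_le_sqrt h)), abs_of_nonneg (sub_nonneg.mpr h),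
    sub_le_iff_le_add]
  rcases le_or_gt 0 y with hy | hy
  · rw [Real.sqrt_le_left (by positivity)]
    nlinarith [Real.sq_sqrt (sub_nonneg.mpr h), Real.sq_sqrt hy,
      mul_nonneg (Real.sqrt_nonneg (x - y)) (Real.sqrt_nonneg y)]
  · rw [Real.sqrt_eq_zero_of_nonpos hy.le, add_zero]
    exact Real.sqrt_le_sqrt (by linarith)

variable {m : ℕ} {ε : ℝ} {v : EuclideanSpace ℝ (Fin m)}

lemma abs_dotProduct_le_mul {w : Fin m → ℝ} (hw : ∀ i, |w i| ≤ ε) (hv : ‖v‖ ≤ 1) :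
    |w ⬝ᵥ v.ofLp| ≤ m * ε := by
  calc |w ⬝ᵥ v.ofLp| ≤ ∑ i, |w i * v i| := Finset.abs_sum_le_sum_abs _ _
    _ ≤ ∑ _i : Fin m, ε := by
        refine Finset.sum_le_sum fun i _ => ?_
        rw [abs_mul]
        exact (mul_le_of_le_one_right (abs_nonneg _) ((PiLp.norm_apply_le v i).trans hv)).trans
          (hw i)
    _ = m * ε := by simp

lemma abs_inner_sub_le {w w' : EuclideanSpace ℝ (Fin m)} (hw : ∀ i, |w i - w' i| ≤ ε)
    (hv : ‖v‖ ≤ 1) : |inner ℝ w v - inner ℝ w' v| ≤ m * ε := by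
  rw [← inner_sub_left, EuclideanSpace.inner_eq_star_dotProduct, star_trivial, dotProduct_comm]
  exact abs_dotProduct_le_mul hw hv

lemma abs_quad_sub_le {G G' : Matrix (Fin m) (Fin m) ℝ} (hG : ∀ i j, |G i j - G' i j| ≤ ε)
    (hv : ‖v‖ ≤ 1) : |quad G v.ofLp - quad G' v.ofLp| ≤ (m : ℝ) ^ 2 * ε := by
  rw [quad, quad, ← dotProduct_sub, ← sub_mulVec, dotProduct_comm, pow_two, mul_assoc]
  exact abs_dotProduct_le_mul (fun i => abs_dotProduct_le_mul (hG i) hv) hv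

variable {β : ℝ}

lemma bonus_eq (β : ℝ) (G : Fin m → Fin m → ℝ) (v : EuclideanSpace ℝ (Fin m)) :
    bonus β G v = β * matNorm (Matrix.of G) v.ofLp := rfl

lemma bonus_nonneg (hβ : 0 ≤ β) (G : Fin m → Fin m → ℝ) (v : EuclideanSpace ℝ (Fin m)) :
    0 ≤ bonus β G v := mul_nonneg hβ (matNorm_nonneg _ _)

lemma abs_bonus_sub_le (hβ : 0 ≤ β) {G G' : Fin m → Fin m → ℝ}
    (hG : ∀ i j, |G i j - G' i j| ≤ ε) (hv : ‖v‖ ≤ 1) :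
    |bonus β G v - bonus β G' v| ≤ β * (m * √ε) := by
  have hsqrt : √((m : ℝ) ^ 2 * ε) = m * √ε := by
    rw [Real.sqrt_mul (sq_nonneg _), Real.sqrt_sq (Nat.cast_nonneg m)]
  rw [bonus_eq, bonus_eq, ← mul_sub, abs_mul, abs_of_nonneg hβ, ← hsqrt]
  exact mul_le_mul_of_nonneg_left ((abs_sqrt_sub_sqrt_le _ _).trans
    (Real.sqrt_le_sqrt (abs_quad_sub_le hG hv))) hβ

lemma abs_truncBonus_div_sub_le {S A : Type*} (β : ℝ) (H : ℕ)
    (φ : S × A → EuclideanSpace ℝ (Fin m)) (p p' : Param m) (s : S) (a : A) :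
    |truncBonus β H φ p s a / H - truncBonus β H φ p' s a / H|
      ≤ |bonus β p.2 (φ (s, a)) - bonus β p'.2 (φ (s, a))| := by
  rw [← sub_div, abs_div, Nat.abs_cast]
  rcases H.eq_zero_or_pos with rfl | hH
  · simp
  · exact (div_le_self (abs_nonneg _) (by exact_mod_cast hH)).trans (abs_inf_sub_inf_le_abs _ _ _)

end Perturbation

section RegularQ

variable {S A : Type*} [MeasurableSpace S] [MeasurableSpace A] {m : ℕ}

/-- A parametrized family of action values `Q_p ≤ H` with the modulus of continuity, in the
parameter `p`, that is shared by the exploration and the planning phase. -/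
structure RegularQ (β : ℝ) (H : ℕ) (Q : Param m → S → A → ℝ) : Prop where
  le_horizon : ∀ p s a, Q p s a ≤ H
  abs_sub_le : ∀ (p p' : Param m) (ε : ℝ), (∀ i, |p.1 i - p'.1 i| ≤ ε) →
    (∀ i j, |p.2 i j - p'.2 i j| ≤ ε) → ∀ s a, |Q p s a - Q p' s a| ≤ m * ε + 2 * β * (m * √ε)
  measurable : Measurable fun q : Param m × S × A => Q q.1 q.2.1 q.2.2

variable {φ : S × A → EuclideanSpace ℝ (Fin m)} {β : ℝ} {H : ℕ}

lemma measurable_bonus (hφ : Measurable φ) (β : ℝ) :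
    Measurable fun q : Param m × S × A => bonus β q.1.2 (φ (q.2.1, q.2.2)) := by
  have : Measurable fun q : Param m × S × A => φ (q.2.1, q.2.2) := hφ.comp measurable_snd
  refine (Measurable.sqrt ?_).const_mul _
  simp only [dotProduct, mulVec, of_apply]
  fun_prop

lemma measurable_inner_feature (hφ : Measurable φ) :
    Measurable fun q : Param m × S × A => (inner ℝ q.1.1 (φ (q.2.1, q.2.2)) : ℝ) :=
  (measurable_fst.comp measurable_fst).inner (hφ.comp measurable_snd)

lemma regularQ_planQ (hβ : 0 ≤ β) (H : ℕ) (hφ : Measurable φ) (hφ1 : ∀ z, ‖φ z‖ ≤ 1) :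
    RegularQ β H (planQ β H φ) where
  le_horizon p s a := min_le_right _ _
  abs_sub_le p p' ε hw hG s a := by
    have hbonus := abs_bonus_sub_le hβ hG (hφ1 (s, a))
    calc |planQ β H φ p s a - planQ β H φ p' s a|
        ≤ |(inner ℝ p.1 (φ (s, a)) + bonus β p.2 (φ (s, a)))
            - (inner ℝ p'.1 (φ (s, a)) + bonus β p'.2 (φ (s, a)))| := abs_inf_sub_inf_le_abs _ _ _
      _ ≤ |inner ℝ p.1 (φ (s, a)) - inner ℝ p'.1 (φ (s, a))|
            + |bonus β p.2 (φ (s, a)) - bonus β p'.2 (φ (s, a))| := by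
          rw [add_sub_add_comm]
          exact abs_add_le _ _
      _ ≤ m * ε + 2 * β * (m * √ε) := by
          linarith [abs_inner_sub_le hw (hφ1 (s, a)), abs_nonneg (bonus β p.2 (φ (s, a))
            - bonus β p'.2 (φ (s, a)))]
  measurable := ((measurable_inner_feature hφ).add (measurable_bonus hφ β)).min measurable_const

lemma regularQ_exploreQ (hβ : 0 ≤ β) (H : ℕ) (hφ : Measurable φ) (hφ1 : ∀ z, ‖φ z‖ ≤ 1) :
    RegularQ β H (exploreQ β H φ) where
  le_horizon p s a := min_le_right _ _
  abs_sub_le p p' ε hw hG s a := by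
    have hbonus := abs_bonus_sub_le hβ hG (hφ1 (s, a))
    calc |exploreQ β H φ p s a - exploreQ β H φ p' s a|
        ≤ |(inner ℝ p.1 (φ (s, a)) + truncBonus β H φ p s a / H + bonus β p.2 (φ (s, a)))
            - (inner ℝ p'.1 (φ (s, a)) + truncBonus β H φ p' s a / H
              + bonus β p'.2 (φ (s, a)))| := abs_inf_sub_inf_le_abs _ _ _
      _ ≤ |inner ℝ p.1 (φ (s, a)) - inner ℝ p'.1 (φ (s, a))|
            + |truncBonus β H φ p s a / H - truncBonus β H φ p' s a / H|
            + |bonus β p.2 (φ (s, a)) - bonus β p'.2 (φ (s, a))| := by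
          rw [add_sub_add_comm, add_sub_add_comm]
          exact abs_add_three _ _ _
      _ ≤ m * ε + 2 * β * (m * √ε) := by
          linarith [abs_inner_sub_le hw (hφ1 (s, a)), abs_truncBonus_div_sub_le β H φ p p' s a]
  measurable := (((measurable_inner_feature hφ).add
    (((measurable_bonus hφ β).min measurable_const).div_const _)).add
      (measurable_bonus hφ β)).min measurable_const

variable {Q : Param m → S → A → ℝ}

/-- The value function `max_a Q_p(s, a)`, truncated below at `-H`. -/
def clipValue (H : ℕ) (G : Greedy Q) (p : Param m) (s : S) : ℝ :=
  max (Q p s (G.act p s)) (-H)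

lemma iSup_eq_greedy (hQ : RegularQ β H Q) (G : Greedy Q) {p : Param m}
    (hp : (Matrix.of p.2).PosDef) (s : S) : ⨆ b, Q p s b = Q p s (G.act p s) :=
  have : Nonempty A := ⟨G.act p s⟩
  le_antisymm (ciSup_le (G.isMax p hp s))
    (le_ciSup (f := fun b => Q p s b) ⟨H, Set.forall_mem_range.mpr (hQ.le_horizon p s)⟩ _)

lemma measurable_greedy_value (hQ : RegularQ β H Q) (G : Greedy Q) :
    Measurable fun q : Param m × S => Q q.1 q.2 (G.act q.1 q.2) :=
  hQ.measurable.comp (measurable_fst.prodMk (measurable_snd.prodMk G.measurable_act))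

lemma measurable_clipValue (hQ : RegularQ β H Q) (G : Greedy Q) :
    Measurable fun q : Param m × S => clipValue H G q.1 q.2 :=
  (measurable_greedy_value hQ G).max measurable_const

lemma abs_clipValue_le (hQ : RegularQ β H Q) (G : Greedy Q) (p : Param m) (s : S) :
    |clipValue H G p s| ≤ H :=
  abs_le.mpr ⟨le_max_right _ _, max_le (hQ.le_horizon _ _ _) (neg_le_self H.cast_nonneg)⟩

lemma abs_clipValue_sub_le (hQ : RegularQ β H Q) (G : Greedy Q) {p p' : Param m}
    (hp : (Matrix.of p.2).PosDef) (hp' : (Matrix.of p'.2).PosDef) {ε : ℝ}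
    (hw : ∀ i, |p.1 i - p'.1 i| ≤ ε) (hG : ∀ i j, |p.2 i j - p'.2 i j| ≤ ε) (s : S) :
    |clipValue H G p s - clipValue H G p' s| ≤ m * ε + 2 * β * (m * √ε) := by
  have hQ_sub := hQ.abs_sub_le p p' ε hw hG s
  refine (abs_sup_sub_sup_le_abs _ _ _).trans (abs_le.mpr ⟨?_, ?_⟩)
  · linarith [(abs_le.mp (hQ_sub (G.act p' s))).1, G.isMax p hp s (G.act p' s)]
  · linarith [(abs_le.mp (hQ_sub (G.act p s))).2, G.isMax p' hp' s (G.act p s)]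

end RegularQ

section LSVI

section Greedy

variable {S A : Type*} {m : ℕ}

lemma fit_posDef (φ : S × A → EuclideanSpace ℝ (Fin m)) (s : ℕ → ℕ → S) (a : ℕ → ℕ → A)
    (g : ℕ → ℕ → ℝ) (n h : ℕ) (V : S → ℝ) : (Matrix.of (fit φ s a g n h V).2).PosDef :=
  (gram_posDef _ n).inv

variable [MeasurableSpace S] [MeasurableSpace A] {β : ℝ} {H : ℕ}
  {φ : S × A → EuclideanSpace ℝ (Fin m)} {Q : Param m → S → A → ℝ} (hQ : RegularQ β H Q)
  (G : Greedy Q) (s : ℕ → ℕ → S) (a : ℕ → ℕ → A) (g : ℕ → ℕ → ℝ) (n : ℕ)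

include hQ G

lemma lsviValue_succ (j : ℕ) (x : S) :
    lsviValue Q H φ s a g n (j + 1) x =
      Q (fit φ s a g n (H - (j + 1)) (lsviValue Q H φ s a g n j)) x
        (G.act (fit φ s a g n (H - (j + 1)) (lsviValue Q H φ s a g n j)) x) :=
  iSup_eq_greedy hQ G (fit_posDef φ s a g n _ _) x

lemma lsviValue_eq {h : ℕ} (hh : h < H) (x : S) :
    lsviValue Q H φ s a g n (H - h) x =
      Q (lsviParam Q H φ s a g n h) x (G.act (lsviParam Q H φ s a g n h) x) := by
  have hstep : H - h = H - (h + 1) + 1 := by omega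
  have hback : H - (H - (h + 1) + 1) = h := by omega
  rw [hstep, lsviValue_succ hQ G, hback, lsviParam]

lemma le_lsviValue {h : ℕ} (hh : h < H) (x : S) (b : A) :
    Q (lsviParam Q H φ s a g n h) x b ≤ lsviValue Q H φ s a g n (H - h) x := by
  rw [lsviValue_eq hQ G s a g n hh]
  exact G.isMax _ (fit_posDef φ s a g n _ _) x b

end Greedy

variable {S A T : Type*} [MeasurableSpace S] [MeasurableSpace A] [MeasurableSpace T] {m : ℕ}
  {β : ℝ} {H : ℕ} {φ : S × A → EuclideanSpace ℝ (Fin m)} {Q : Param m → S → A → ℝ}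
  {s : ℕ → ℕ → T → S} {a : ℕ → ℕ → T → A} {g : ℕ → ℕ → T → ℝ} {n : ℕ}

lemma measurable_fit (hφ : Measurable φ) {h : ℕ} {V : T → S → ℝ}
    (hs : ∀ i < n, Measurable (s i h)) (ha : ∀ i < n, Measurable (a i h))
    (hV : ∀ i < n, Measurable fun t => V t (s i (h + 1) t))
    (hg : ∀ i < n, Measurable (g i h)) :
    Measurable fun t => fit φ (fun i j => s i j t) (fun i j => a i j t) (fun i j => g i j t) n h
      (V t) := by
  have hx : ∀ i < n, Measurable fun t => φ (s i h t, a i h t) := fun i hi =>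
    hφ.comp ((hs i hi).prodMk (ha i hi))
  have hG := measurable_gram_inv_apply (x := fun i t => φ (s i h t, a i h t)) hx
  refine Measurable.prodMk ?_
    (measurable_pi_lambda _ fun i => measurable_pi_lambda _ fun j => hG i j)
  refine (WithLp.measurable_toLp 2 _).comp (measurable_pi_lambda _ fun i => ?_)
  simp only [mulVec, dotProduct, Finset.sum_apply, Pi.smul_apply, smul_eq_mul]
  refine Finset.measurable_sum _ fun j _ => (hG i j).mul (Finset.measurable_sum _ fun k hk => ?_)
  have hk := Finset.mem_range.mp hk
  have := hx k hk
  exact ((hV k hk).add (hg k hk)).mul (by fun_prop)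

lemma measurable_lsviValue (hφ : Measurable φ) (hQ : RegularQ β H Q) (G : Greedy Q)
    (hs : ∀ i < n, ∀ h ≤ H, Measurable (s i h)) (ha : ∀ i < n, ∀ h < H, Measurable (a i h))
    (hg : ∀ i < n, ∀ h < H, Measurable (g i h)) (j : ℕ) (hj : j ≤ H) :
    Measurable fun q : T × S => lsviValue Q H φ (fun i j => s i j q.1) (fun i j => a i j q.1)
      (fun i j => g i j q.1) n j q.2 := by
  induction j with
  | zero => exact measurable_const
  | succ j ih =>
    simp only [lsviValue_succ hQ G]
    have hfit := measurable_fit (n := n) (h := H - (j + 1)) (V := fun t =>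
      lsviValue Q H φ (fun i j => s i j t) (fun i j => a i j t) (fun i j => g i j t) n j) hφ
      (fun i hi => hs i hi _ (by omega)) (fun i hi => ha i hi _ (by omega))
      (fun i hi => (ih (by omega)).comp (measurable_id.prodMk (hs i hi _ (by omega))))
      (fun i hi => hg i hi _ (by omega))
    exact (measurable_greedy_value hQ G).comp ((hfit.comp measurable_fst).prodMk measurable_snd)

end LSVI

section Radius

/-- The confidence radius of the self-normalized bounds, for noise of size `2H`, `K` rounds and
confidence `1 - δ`. -/
def radius (m H K : ℕ) (δ : ℝ) : ℝ :=
  √((2 * H : ℝ) ^ 2 * (m * Real.log (m + K)) + 4 * (2 * H : ℝ) ^ 2 * Real.log (1 / δ))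

lemma radius_nonneg (m H K : ℕ) (δ : ℝ) : 0 ≤ radius m H K δ := Real.sqrt_nonneg _

lemma le_sq_radius {m m' H K n : ℕ} (hm' : 1 ≤ m') (hm : m' ≤ m) (hn : n ≤ K) (δ : ℝ) :
    (2 * H : ℝ) ^ 2 * (m' * Real.log (m' + n)) + 4 * (2 * H : ℝ) ^ 2 * Real.log (1 / δ)
      ≤ radius m H K δ ^ 2 := by
  have hcast : (1 : ℝ) ≤ m' ∧ (m' : ℝ) ≤ m ∧ (n : ℝ) ≤ K :=
    ⟨by exact_mod_cast hm', by exact_mod_cast hm, by exact_mod_cast hn⟩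
  have hlog : 0 ≤ Real.log ((m' : ℝ) + n) := Real.log_nonneg (by linarith [n.cast_nonneg (α := ℝ)])
  rw [radius, Real.sq_sqrt']
  refine le_trans ?_ (le_max_left _ _)
  gcongr

variable {Ω ι : Type*} {mΩ : MeasurableSpace Ω} {Pr : Measure Ω} {ℱ : Filtration ℕ mΩ}
  {η : ℕ → Ω → ι → ℝ} [Fintype ι]

lemma IsNoise.mono_bound {B B' : ℝ} {K : ℕ} (hη : IsNoise Pr ℱ η B K) (hB : 0 ≤ B)
    (hBB' : B ≤ B') : IsNoise Pr ℱ η B' K where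
  measurable := hη.measurable
  sum_sq_le n ω := (hη.sum_sq_le n ω).trans (pow_le_pow_left₀ hB hBB' 2)
  condExp_eq_zero := hη.condExp_eq_zero

lemma IsNoise.measure_sq_radius_lt_selfNorm_le [IsProbabilityMeasure Pr] {m m' H K n : ℕ}
    {x : ℕ → Ω → EuclideanSpace ℝ (Fin m')} {δ : ℝ} (hη : IsNoise Pr ℱ η (2 * H) K)
    (hxm : ∀ n, Measurable[ℱ n] (x n)) (hx : ∀ n ω, ‖x n ω‖ ≤ 1) (hH : 0 < H) (hm' : 1 ≤ m')
    (hm : m' ≤ m) (hδ : 0 < δ) (hn : n ≤ K) :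
    Pr {ω | radius m H K δ ^ 2 < selfNorm (x · ω) (η · ω) n} ≤ ENNReal.ofReal δ :=
  (measure_mono fun _ => (le_sq_radius hm' hm hn δ).trans_lt).trans
    (hη.measure_lt_selfNorm_le hxm hx (by positivity) hδ hn)

end Radius

section TransitionNoise

variable {S A : Type*} [MeasurableSpace S] [MeasurableSpace A] {d m : ℕ}

/-- The regression parameters with a positive definite matrix and all entries bounded by `L`,
among them all those that the algorithm can produce. -/
def paramClass (m : ℕ) (L : ℝ) : Set (Param m) :=
  {p | (Matrix.of p.2).PosDef ∧ (∀ i, |p.1 i| ≤ L) ∧ ∀ i j, |p.2 i j| ≤ L}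

/-- The number of cells of size `ε` in a grid for `paramClass m L`. -/
def netSize (m : ℕ) (L ε : ℝ) : ℕ := (⌊2 * L / ε⌋₊ + 1) ^ (m + m * m)

lemma exists_paramNet {L ε : ℝ} (hL : 1 ≤ L) (hε : 0 < ε) :
    ∃ rep : (Fin m ⊕ Fin m × Fin m → Fin (⌊2 * L / ε⌋₊ + 1)) → paramClass m L,
      ∀ p ∈ paramClass m L, ∃ c, (∀ i, |p.1 i - (rep c).1.1 i| ≤ ε) ∧
        ∀ i j, |p.2 i j - (rep c).1.2 i j| ≤ ε := by
  have hone : ∀ i j, |(1 : Matrix (Fin m) (Fin m) ℝ) i j| ≤ L := fun i j => by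
    rw [Matrix.one_apply]
    split_ifs <;> simp <;> linarith
  have : Nonempty (paramClass m L) :=
    ⟨⟨(0, (1 : Matrix (Fin m) (Fin m) ℝ)), .one, fun _ => by simp; linarith, hone⟩⟩
  obtain ⟨rep, hrep⟩ := exists_grid_net
    (fun (p : paramClass m L) => Sum.elim (p.1.1 ·) fun ij : Fin m × Fin m => p.1.2 ij.1 ij.2) hε
    fun p => Sum.rec p.2.2.1 fun ij => p.2.2.2 ij.1 ij.2
  refine ⟨rep, fun p hp => ?_⟩
  obtain ⟨c, hc⟩ := hrep ⟨p, hp⟩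
  exact ⟨c, fun i => hc (.inl i), fun i j => hc (.inr (i, j))⟩

/-- The Gram matrix of step `h` after `n` episodes. -/
abbrev dataGram (φ : S × A → EuclideanSpace ℝ (Fin m)) (s : ℕ → ℕ → S) (a : ℕ → ℕ → A)
    (h n : ℕ) : Matrix (Fin m) (Fin m) ℝ := gram (fun i => φ (s i h, a i h)) n

/-- The transition noise `∑_{i < n} (V(s^i_{h+1}) - P_h V(s^i_h, a^i_h)) φ^i_h`. -/
def transNoise (M : VMDP S A d) (φ : S × A → EuclideanSpace ℝ (Fin m)) (s : ℕ → ℕ → S)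
    (a : ℕ → ℕ → A) (h n : ℕ) (V : S → ℝ) : Fin m → ℝ :=
  ∑ i ∈ Finset.range n, (V (s i (h + 1)) - ∫ y, V y ∂M.P h (s i h, a i h))
    • (φ (s i h, a i h)).ofLp

/-- The self-normalized size of the transition noise. -/
def transDev (M : VMDP S A d) (φ : S × A → EuclideanSpace ℝ (Fin m)) (s : ℕ → ℕ → S)
    (a : ℕ → ℕ → A) (h n : ℕ) (V : S → ℝ) : ℝ :=
  matNorm (dataGram φ s a h n)⁻¹ (transNoise M φ s a h n V)

lemma sq_transDev (M : VMDP S A d) (φ : S × A → EuclideanSpace ℝ (Fin m)) (s : ℕ → ℕ → S)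
    (a : ℕ → ℕ → A) (h n : ℕ) (V : S → ℝ) :
    transDev M φ s a h n V ^ 2 = selfNorm (fun i => φ (s i h, a i h))
      (fun i (_ : Unit) => V (s i (h + 1)) - ∫ y, V y ∂M.P h (s i h, a i h)) n := by
  rw [transDev, matNorm_sq (gram_inv_posSemidef _ _), selfNorm, Fintype.sum_unique]
  rfl

lemma transDev_le_transDev_add (M : VMDP S A d) {φ : S × A → EuclideanSpace ℝ (Fin m)}
    (hφ : ∀ z, ‖φ z‖ ≤ 1) (s : ℕ → ℕ → S) (a : ℕ → ℕ → A) (h n : ℕ) {V V' : S → ℝ}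
    (hV : Measurable V) (hV' : Measurable V') {C : ℝ} (hC : ∀ y, |V y| ≤ C)
    (hC' : ∀ y, |V' y| ≤ C) {e : ℝ} (he : ∀ y, |V y - V' y| ≤ e) :
    transDev M φ s a h n V ≤ transDev M φ s a h n V' + n * (2 * e) := by
  have := M.markov h
  have hG := gram_inv_posSemidef (fun i => φ (s i h, a i h)) n
  set t : ℕ → ℝ := fun i =>
    (V (s i (h + 1)) - V' (s i (h + 1))) - ∫ y, (V y - V' y) ∂M.P h (s i h, a i h) with ht_def
  have ht : ∀ i, |t i| ≤ 2 * e := fun i => by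
    have hmean := M.abs_integral_P_le h (s i h, a i h) he
    linarith [abs_sub (V (s i (h + 1)) - V' (s i (h + 1)))
      (∫ y, (V y - V' y) ∂M.P h (s i h, a i h)), he (s i (h + 1))]
  have hsplit : transNoise M φ s a h n V = transNoise M φ s a h n V'
      + ∑ i ∈ Finset.range n, t i • (φ (s i h, a i h)).ofLp := by
    simp only [transNoise, ← Finset.sum_add_distrib, ← add_smul]
    refine Finset.sum_congr rfl fun i _ => ?_
    simp only [ht_def]
    rw [integral_sub (.of_bound hV.aestronglyMeasurable C (.of_forall hC))
      (.of_bound hV'.aestronglyMeasurable C (.of_forall hC'))]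
    congr 1
    ring
  rw [transDev, transDev, hsplit]
  refine (matNorm_add_le hG _ _).trans (add_le_add le_rfl ?_)
  calc matNorm (dataGram φ s a h n)⁻¹ (∑ i ∈ Finset.range n, t i • (φ (s i h, a i h)).ofLp)
      ≤ ∑ i ∈ Finset.range n, matNorm (dataGram φ s a h n)⁻¹ (t i • (φ (s i h, a i h)).ofLp) :=
        matNorm_sum_le hG _ _
    _ ≤ ∑ _i ∈ Finset.range n, 2 * e := Finset.sum_le_sum fun i _ => by
        rw [matNorm_smul]
        exact (mul_le_of_le_one_right (abs_nonneg _)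
          ((matNorm_gram_inv_le _ n _).trans (hφ _))).trans (ht i)
    _ = n * (2 * e) := by simp

end TransitionNoise

section Events

lemma selfNorm_single_one (η : ℕ → ℝ) (n : ℕ) :
    selfNorm (fun _ => EuclideanSpace.single (0 : Fin 1) (1 : ℝ)) (fun i (_ : Unit) => η i) n
      = (∑ i ∈ Finset.range n, η i) ^ 2 / (n + 1) := by
  have hinv : (gram (fun _ => EuclideanSpace.single (0 : Fin 1) (1 : ℝ)) n)⁻¹
      = ((n : ℝ) + 1)⁻¹ • (1 : Matrix (Fin 1) (Fin 1) ℝ) := by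
    refine Matrix.inv_eq_right_inv ?_
    ext i j
    fin_cases i; fin_cases j
    simp [gram, Matrix.mul_apply, Matrix.vecMulVec_apply, Matrix.natCast_apply,
      mul_inv_cancel₀ (n.cast_add_one_ne_zero (R := ℝ))]
  simp only [selfNorm, Fintype.sum_unique, quad, hinv, noiseSum, Matrix.smul_mulVec,
    Matrix.one_mulVec, dotProduct]
  simp
  ring

variable {S A Ω : Type*} [MeasurableSpace S] [MeasurableSpace A] {mΩ : MeasurableSpace Ω}
  {d m H K : ℕ} {M : VMDP S A d} {s₁ : S} {rule : (ℕ → ℕ → S) → (ℕ → ℕ → A) → ℕ → ℕ → S → A}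
  {Pr : Measure Ω} {s : ℕ → ℕ → Ω → S} {a : ℕ → ℕ → Ω → A}
  {r : ℕ → ℕ → Ω → EuclideanSpace ℝ (Fin d)} {φ : S × A → EuclideanSpace ℝ (Fin m)} {β δ : ℝ}
  {Q : Param m → S → A → ℝ}

lemma measurable_history_feature (hφ : Measurable φ) (h k : ℕ) :
    Measurable[history H s a r k h] fun ω => φ (s k h ω, a k h ω) :=
  hφ.comp (measurable_history_pair k h)

lemma lsviValue_le_horizon (hQ : RegularQ β H Q) (G : Greedy Q) (s : ℕ → ℕ → S)
    (a : ℕ → ℕ → A) (g : ℕ → ℕ → ℝ) (n h : ℕ) (x : S) :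
    lsviValue Q H φ s a g n (H - h) x ≤ H := by
  rcases Nat.lt_or_ge h H with hh | hh
  · rw [lsviValue_eq hQ G _ _ _ _ hh]
    exact hQ.le_horizon _ _ _
  · rw [Nat.sub_eq_zero_of_le hh]
    exact H.cast_nonneg

/-- The value function of step `h` from the first `n` reward-free episodes, truncated below at
`-H`. The truncation never acts on good data, but makes the function bounded for all data. -/
def clipLsvi (Q : Param m → S → A → ℝ) (H : ℕ) (φ : S × A → EuclideanSpace ℝ (Fin m))
    (s : ℕ → ℕ → S) (a : ℕ → ℕ → A) (n h : ℕ) (x : S) : ℝ :=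
  max (lsviValue Q H φ s a (fun _ _ => 0) n (H - h) x) (-H)

lemma abs_clipLsvi_le (hQ : RegularQ β H Q) (G : Greedy Q) (s : ℕ → ℕ → S) (a : ℕ → ℕ → A)
    (n h : ℕ) (x : S) : |clipLsvi Q H φ s a n h x| ≤ H :=
  abs_le.mpr ⟨le_max_right _ _,
    max_le (lsviValue_le_horizon hQ G s a _ n h x) (neg_le_self H.cast_nonneg)⟩

lemma measurable_history_clipLsvi (hφ : Measurable φ) (hQ : RegularQ β H Q) (G : Greedy Q)
    (k h h' : ℕ) :
    Measurable[(history H s a r k h).prod inferInstance]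
      (Function.uncurry fun ω => clipLsvi Q H φ (s · · ω) (a · · ω) k h') :=
  (@measurable_lsviValue S A Ω _ _ (history H s a r k h) m β H φ Q s a (fun _ _ _ => 0) k hφ hQ G
    (fun _ hi _ hj => measurable_history_state (.inl ⟨hi, hj⟩))
    (fun _ hi _ hj => measurable_history_action (.inl ⟨hi, hj⟩))
    (fun _ _ _ _ => @measurable_const _ _ _ (history H s a r k h) _) _ (H.sub_le h')).max
      (@measurable_const _ _ _ ((history H s a r k h).prod inferInstance) _)

namespace IsRun

variable [IsProbabilityMeasure Pr] (hrun : IsRun M s₁ H K rule Pr s a r) (hM : M.IsLinear H φ)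
  (hm : 1 ≤ m) {h : ℕ} (hh : h < H) (hδ : 0 < δ)
include hrun hM hm hh hδ

lemma measure_radius_lt_transDev_le {V : S → ℝ} (hV : Measurable V) (hVb : ∀ y, |V y| ≤ H) {n : ℕ}
    (hn : n ≤ K) :
    Pr {ω | radius m H K δ < transDev M φ (s · · ω) (a · · ω) h n V} ≤ ENNReal.ofReal δ := by
  have hnoise := hrun.isNoise_transition hh (f := fun _ _ => V)
    (fun k => hV.comp (@measurable_snd Ω S (history H s a r k h) _)) (fun _ _ => hVb)
  have htail := hnoise.measure_sq_radius_lt_selfNorm_le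
    (measurable_history_feature hM.measurable_feature h) (fun _ _ => hM.norm_feature_le _)
    (Nat.zero_lt_of_lt hh) hm le_rfl hδ hn
  exact (measure_mono fun ω hω => (pow_lt_pow_left₀ hω (radius_nonneg ..) two_ne_zero).trans_eq
    (sq_transDev M φ (s · · ω) (a · · ω) h n V)).trans htail

lemma measure_exists_radius_lt_transDev_le (hQ : RegularQ β H Q) (G : Greedy Q) {L ε : ℝ}
    (hL : 1 ≤ L) (hε : 0 < ε) (hεK : K * (m * ε + 2 * β * (m * √ε)) ≤ 1) :
    Pr {ω | ∃ n ≤ K, ∃ p ∈ paramClass m L,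
        radius m H K δ + 2 < transDev M φ (s · · ω) (a · · ω) h n (clipValue H G p)}
      ≤ ((K + 1) * netSize m L ε : ℕ) * ENNReal.ofReal δ := by
  obtain ⟨rep, hrep⟩ := exists_paramNet (m := m) hL hε
  have hclip : ∀ p, Measurable (clipValue H G p) := fun p =>
    (measurable_clipValue hQ G).comp measurable_prodMk_left
  calc _ ≤ Pr (⋃ (n : Fin (K + 1)) (c), {ω | radius m H K δ <
          transDev M φ (s · · ω) (a · · ω) h n (clipValue H G (rep c))}) := by
        refine measure_mono fun ω ⟨n, hn, p, hp, hlt⟩ => ?_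
        obtain ⟨c, hw, hG⟩ := hrep p hp
        refine Set.mem_iUnion₂.mpr ⟨⟨n, Nat.lt_succ_of_le hn⟩, c, ?_⟩
        have hclose := abs_clipValue_sub_le hQ G hp.1 (rep c).2.1 hw hG
        have hdev := transDev_le_transDev_add M hM.norm_feature_le (s · · ω) (a · · ω) h n
          (hclip p) (hclip (rep c)) (abs_clipValue_le hQ G p) (abs_clipValue_le hQ G _) hclose
        have herr : n * (m * ε + 2 * β * (m * √ε)) ≤ 1 :=
          (mul_le_mul_of_nonneg_right (by exact_mod_cast hn)
            ((abs_nonneg _).trans (hclose s₁))).trans hεK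
        rw [Set.mem_ofPred_eq]
        linarith
    _ ≤ ∑ _n : Fin (K + 1), ∑ _c : Fin m ⊕ Fin m × Fin m → Fin (⌊2 * L / ε⌋₊ + 1),
          ENNReal.ofReal δ :=
        (measure_iUnion_fintype_le _ _).trans <| Finset.sum_le_sum fun n _ =>
          (measure_iUnion_fintype_le _ _).trans <| Finset.sum_le_sum fun c _ =>
            hrun.measure_radius_lt_transDev_le hM hm hh hδ (hclip _) (abs_clipValue_le hQ G _)
              (Nat.lt_succ_iff.mp n.2)
    _ = ((K + 1) * netSize m L ε : ℕ) * ENNReal.ofReal δ := by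
        simp only [Finset.sum_const, Finset.card_univ, nsmul_eq_mul, Fintype.card_fin,
          Fintype.card_fun, Fintype.card_sum, Fintype.card_prod, netSize, Nat.cast_mul, mul_assoc]

lemma measure_sq_radius_lt_returnNoise_le :
    Pr {ω | radius m H K δ ^ 2 < selfNorm (fun i => φ (s i h ω, a i h ω))
        (fun i j => truncReturn (r i h ω) j - M.r h (s i h ω, a i h ω) j) K}
      ≤ ENNReal.ofReal δ := by
  have hH : (1 : ℝ) ≤ H := by exact_mod_cast Nat.one_le_of_lt hh
  exact ((hrun.isNoise_return hh).mono_bound zero_le_two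
    (by linarith : (2 : ℝ) ≤ 2 * H)).measure_sq_radius_lt_selfNorm_le
    (measurable_history_feature hM.measurable_feature h) (fun _ _ => hM.norm_feature_le _)
    (Nat.zero_lt_of_lt hh) hm le_rfl hδ le_rfl

lemma measure_radius_mul_lt_sum_clipLsvi_le (hQ : RegularQ β H Q) (G : Greedy Q) :
    Pr {ω | radius m H K δ * √(K + 1) < |∑ k ∈ Finset.range K,
        (clipLsvi Q H φ (s · · ω) (a · · ω) k (h + 1) (s k (h + 1) ω)
          - ∫ y, clipLsvi Q H φ (s · · ω) (a · · ω) k (h + 1) y ∂M.P h (s k h ω, a k h ω))|}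
      ≤ ENNReal.ofReal δ := by
  have hnoise := hrun.isNoise_transition hh
    (fun k => measurable_history_clipLsvi hM.measurable_feature hQ G k h (h + 1))
    (fun k ω => abs_clipLsvi_le hQ G (s · · ω) (a · · ω) k (h + 1))
  -- A scalar martingale is the self-normalized sum with the constant regressor `1`.
  refine (measure_mono fun ω hω => ?_).trans (hnoise.measure_sq_radius_lt_selfNorm_le (m := m)
    (x := fun _ _ => EuclideanSpace.single (0 : Fin 1) (1 : ℝ)) (fun _ => measurable_const)
    (fun _ _ => by simp) (Nat.zero_lt_of_lt hh) le_rfl hm hδ le_rfl)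
  rw [Set.mem_ofPred_eq] at hω
  rw [Set.mem_ofPred_eq, selfNorm_single_one, lt_div_iff₀ (by positivity), ← sq_abs (Finset.sum ..),
    ← Real.sq_sqrt (K.cast_add_one_pos (α := ℝ)).le, ← mul_pow]
  exact pow_lt_pow_left₀ hω (mul_nonneg (radius_nonneg ..) (Real.sqrt_nonneg _)) two_ne_zero

end IsRun

end Events

section GoodData

variable {S A : Type*} [MeasurableSpace S] [MeasurableSpace A] {d m : ℕ}

/-- The concentration bounds at step `h`, with radius `ρ`, that suffice for the guarantee. -/
structure GoodStep (M : VMDP S A d) (H K : ℕ) (φ : S × A → EuclideanSpace ℝ (Fin m)) (β : ℝ)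
    (Ge : Greedy (exploreQ β H φ)) (Gp : Greedy (planQ β H φ)) (ρ L : ℝ) (s : ℕ → ℕ → S)
    (a : ℕ → ℕ → A) (r : ℕ → ℕ → EuclideanSpace ℝ (Fin d)) (h : ℕ) : Prop where
  explore : ∀ n ≤ K, ∀ p ∈ paramClass m L, transDev M φ s a h n (clipValue H Ge p) ≤ ρ + 2
  plan : ∀ n ≤ K, ∀ p ∈ paramClass m L, transDev M φ s a h n (clipValue H Gp p) ≤ ρ + 2
  returns : selfNorm (fun i => φ (s i h, a i h))
    (fun i j => truncReturn (r i h) j - M.r h (s i h, a i h) j) K ≤ ρ ^ 2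
  martingale : |∑ k ∈ Finset.range K,
      (clipLsvi (exploreQ β H φ) H φ s a k (h + 1) (s k (h + 1))
        - ∫ y, clipLsvi (exploreQ β H φ) H φ s a k (h + 1) y ∂M.P h (s k h, a k h))|
    ≤ ρ * √(K + 1)

/-- The properties of the recorded data that hold with high probability and suffice for the
guarantee: the almost sure properties of a run, and the concentration bounds at every step. -/
structure GoodData (M : VMDP S A d) (s₁ : S) (H K : ℕ) (φ : S × A → EuclideanSpace ℝ (Fin m))
    (β : ℝ) (Ge : Greedy (exploreQ β H φ)) (Gp : Greedy (planQ β H φ)) (ρ L : ℝ)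
    (s : ℕ → ℕ → S) (a : ℕ → ℕ → A) (r : ℕ → ℕ → EuclideanSpace ℝ (Fin d)) : Prop where
  start : ∀ k < K, s k 0 = s₁
  action : ∀ k < K, ∀ h < H, a k h = exploreAct β H φ Ge s a k h (s k h)
  ball : ∀ k < K, ∀ h < H, ‖r k h‖ ≤ 1
  step : ∀ h < H, GoodStep M H K φ β Ge Gp ρ L s a r h

namespace IsRun

variable {Ω : Type*} {mΩ : MeasurableSpace Ω} {H K : ℕ} {M : VMDP S A d} {s₁ : S}
  {Pr : Measure Ω} {s : ℕ → ℕ → Ω → S} {a : ℕ → ℕ → Ω → A}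
  {r : ℕ → ℕ → Ω → EuclideanSpace ℝ (Fin d)} {φ : S × A → EuclideanSpace ℝ (Fin m)} {β δ : ℝ}
  {Ge : Greedy (exploreQ β H φ)} [IsProbabilityMeasure Pr]
  (hrun : IsRun M s₁ H K (exploreAct β H φ Ge) Pr s a r) (hM : M.IsLinear H φ) (hm : 1 ≤ m)
  (hβ : 0 ≤ β) {L ε : ℝ} (hL : 1 ≤ L) (hε : 0 < ε) (hεK : K * (m * ε + 2 * β * (m * √ε)) ≤ 1)
  (hδ : 0 < δ) (Gp : Greedy (planQ β H φ))
include hrun hM hm hβ hL hε hεK hδ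

lemma measure_not_goodStep_le {h : ℕ} (hh : h < H) :
    Pr {ω | ¬ GoodStep M H K φ β Ge Gp (radius m H K δ) L (s · · ω) (a · · ω) (r · · ω) h}
      ≤ (4 * ((K + 1) * netSize m L ε) : ℕ) * ENNReal.ofReal δ := by
  have hQe := regularQ_exploreQ hβ H hM.measurable_feature hM.norm_feature_le
  have hQp := regularQ_planQ hβ H hM.measurable_feature hM.norm_feature_le
  have hnet : 1 ≤ (K + 1) * netSize m L ε := Nat.mul_pos K.succ_pos (Nat.pow_pos (Nat.succ_pos _))
  have hone : ENNReal.ofReal δ ≤ ((K + 1) * netSize m L ε : ℕ) * ENNReal.ofReal δ :=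
    le_mul_of_one_le_left' (by exact_mod_cast hnet)
  refine (measure_mono (t := _ ∪ _ ∪ (_ ∪ _)) fun ω hω => ?_).trans <|
    (measure_union_le _ _).trans <| (add_le_add (measure_union_le _ _)
      (measure_union_le _ _)).trans <| (add_le_add
        (add_le_add (hrun.measure_exists_radius_lt_transDev_le hM hm hh hδ hQe Ge hL hε hεK)
          (hrun.measure_exists_radius_lt_transDev_le hM hm hh hδ hQp Gp hL hε hεK))
        (add_le_add ((hrun.measure_sq_radius_lt_returnNoise_le hM hm hh hδ).trans hone)
          ((hrun.measure_radius_mul_lt_sum_clipLsvi_le hM hm hh hδ hQe Ge).trans hone))).trans_eq ?_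
  · contrapose! hω
    simp only [Set.mem_union, Set.mem_ofPred_eq, not_or, not_exists, not_and, not_lt] at hω
    obtain ⟨⟨hexplore, hplan⟩, hreturns, hmartingale⟩ := hω
    exact not_not.mpr ⟨hexplore, hplan, hreturns, hmartingale⟩
  · push_cast
    ring

theorem measure_not_goodData_le :
    Pr {ω | ¬ GoodData M s₁ H K φ β Ge Gp (radius m H K δ) L (s · · ω) (a · · ω) (r · · ω)}
      ≤ (4 * H * (K + 1) * netSize m L ε : ℕ) * ENNReal.ofReal δ := by
  have hsure : ∀ᵐ ω ∂Pr, (∀ k < K, s k 0 ω = s₁) ∧ (∀ k < K, ∀ h < H, a k h ω =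
      exploreAct β H φ Ge (s · · ω) (a · · ω) k h (s k h ω)) ∧
      ∀ k < K, ∀ h < H, ‖r k h ω‖ ≤ 1 := by
    simp only [Filter.eventually_and, ae_all_iff]
    exact ⟨hrun.start, hrun.action, hrun.return_ball⟩
  calc Pr {ω | ¬ GoodData M s₁ H K φ β Ge Gp (radius m H K δ) L (s · · ω) (a · · ω) (r · · ω)}
      ≤ Pr (⋃ h ∈ Finset.range H, {ω | ¬ GoodStep M H K φ β Ge Gp (radius m H K δ) L
          (s · · ω) (a · · ω) (r · · ω) h}) := measure_mono_ae <| by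
        filter_upwards [hsure] with ω ⟨hstart, haction, hball⟩ hω
        by_contra hstep
        exact hω ⟨hstart, haction, hball, fun h hh => not_not.mp fun hbad =>
          hstep (Set.mem_biUnion (Finset.mem_coe.mpr (Finset.mem_range.mpr hh)) hbad)⟩
    _ ≤ ∑ _h ∈ Finset.range H, (4 * ((K + 1) * netSize m L ε) : ℕ) * ENNReal.ofReal δ :=
        (measure_biUnion_finset_le _ _).trans <| Finset.sum_le_sum fun h hh =>
          hrun.measure_not_goodStep_le hM hm hβ hL hε hεK hδ Gp (Finset.mem_range.mp hh)
    _ = (4 * H * (K + 1) * netSize m L ε : ℕ) * ENNReal.ofReal δ := by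
        rw [Finset.sum_const, Finset.card_range, nsmul_eq_mul]
        push_cast
        ring

end IsRun

end GoodData

section Prediction

variable {S A : Type*} {m H K n h : ℕ} {φ : S × A → EuclideanSpace ℝ (Fin m)} {s : ℕ → ℕ → S}
  {a : ℕ → ℕ → A} {g : ℕ → ℕ → ℝ} {L : ℝ}

lemma fit_mem_paramClass (hφ : ∀ z, ‖φ z‖ ≤ 1) (hL : 1 ≤ L) (hLK : (H + 1) * K ≤ L) (hn : n ≤ K)
    {V : S → ℝ} (hVb : ∀ y, |V y| ≤ H) (hg : ∀ i < n, |g i h| ≤ 1) :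
    fit φ s a g n h V ∈ paramClass m L := by
  refine ⟨fit_posDef φ s a g n h V, fun i => ?_, fun i j =>
    (abs_gram_inv_apply_le _ n i j).trans hL⟩
  have htarget : ∀ i < n, |V (s i (h + 1)) + g i h| ≤ H + 1 := fun i hi =>
    (abs_add_le _ _).trans (add_le_add (hVb _) (hg i hi))
  calc |(fit φ s a g n h V).1 i| ≤ n * (H + 1) := abs_ridge_apply_le (fun i => hφ _) htarget i
    _ ≤ (H + 1) * K := by rw [mul_comm]; gcongr
    _ ≤ L := hLK

variable [MeasurableSpace S] [MeasurableSpace A] {d : ℕ} {M : VMDP S A d} {ρ β : ℝ}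

/-- The regression target of step `h` is the sum of `V` at the next state and of a noisy observation
of the linear function `⟨w, φ⟩`. -/
lemma abs_inner_fit_sub_le (hM : M.IsLinear H φ) (hh : h < H) {V : S → ℝ} (hV : Measurable V)
    (hVb : ∀ y, |V y| ≤ H) {w : EuclideanSpace ℝ (Fin m)} {ρ' C : ℝ}
    (hρ : transDev M φ s a h n V ≤ ρ)
    (hρ' : matNorm (dataGram φ s a h n)⁻¹ (∑ i ∈ Finset.range n,
      (g i h - inner ℝ w (φ (s i h, a i h))) • (φ (s i h, a i h)).ofLp) ≤ ρ')
    (hw : ‖w‖ ≤ C) (z : S × A) :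
    |inner ℝ (fit φ s a g n h V).1 (φ z) - (inner ℝ w (φ z) + ∫ y, V y ∂M.P h z)| ≤
      matNorm (dataGram φ s a h n)⁻¹ (φ z).ofLp * (ρ + ρ' + (H * √m + C)) := by
  obtain ⟨v, hv, hPv⟩ := hM.exists_transition_weight hh hV (Nat.cast_nonneg H) hVb
  have hnoise : ∑ i ∈ Finset.range n, (V (s i (h + 1)) + g i h
      - inner ℝ (w + v) (φ (s i h, a i h))) • (φ (s i h, a i h)).ofLp
      = transNoise M φ s a h n V + ∑ i ∈ Finset.range n,
        (g i h - inner ℝ w (φ (s i h, a i h))) • (φ (s i h, a i h)).ofLp := by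
    simp only [transNoise, ← Finset.sum_add_distrib, ← add_smul]
    refine Finset.sum_congr rfl fun i _ => ?_
    rw [hPv, inner_add_left]
    congr 1
    ring
  rw [hPv z, ← inner_add_left]
  refine (abs_inner_ridge_sub_le _ _ n (w + v) (φ z)).trans
    (mul_le_mul_of_nonneg_left (add_le_add ?_ ?_) (matNorm_nonneg _ _))
  · rw [hnoise]
    exact (matNorm_add_le (gram_inv_posSemidef _ n) _ _).trans (add_le_add hρ hρ')
  · exact (norm_add_le _ _).trans (by linarith)

variable {Q : Param m → S → A → ℝ}

lemma lsviValue_eq_clipValue (hQ : RegularQ β H Q) (G : Greedy Q) (hh : h < H)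
    (hlow : ∀ x, -(H : ℝ) ≤ lsviValue Q H φ s a g n (H - h) x) :
    lsviValue Q H φ s a g n (H - h) = clipValue H G (lsviParam Q H φ s a g n h) := by
  funext x
  rw [clipValue, ← lsviValue_eq hQ G s a g n hh, max_eq_left (hlow x)]

lemma measurable_lsviValue_state (hφ : Measurable φ) (hQ : RegularQ β H Q) (G : Greedy Q) (h : ℕ) :
    Measurable (lsviValue Q H φ s a g n (H - h)) :=
  (measurable_lsviValue (T := Unit) (s := fun i j _ => s i j) (a := fun i j _ => a i j)
    (g := fun i j _ => g i j) hφ hQ G (fun _ _ _ _ => measurable_const)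
    (fun _ _ _ _ => measurable_const) (fun _ _ _ _ => measurable_const) _ (H.sub_le h)).comp
    (measurable_prodMk_left (x := ()))

/-- Value functions that are bounded below are clipped value functions of `paramClass`, and so
inherit the deviation bound of the class. -/
lemma transDev_lsviValue_le (hQ : RegularQ β H Q) (G : Greedy Q) (hφ : ∀ z, ‖φ z‖ ≤ 1)
    (hL : 1 ≤ L) (hLK : (H + 1) * K ≤ L) (hρ : 0 ≤ ρ)
    (hdev : ∀ p ∈ paramClass m L, transDev M φ s a h n (clipValue H G p) ≤ ρ) (hn : n ≤ K)
    (hg : ∀ i < n, ∀ h < H, |g i h| ≤ 1)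
    (hlow : ∀ h', h < h' → ∀ x, -(H : ℝ) ≤ lsviValue Q H φ s a g n (H - h') x) :
    transDev M φ s a h n (lsviValue Q H φ s a g n (H - (h + 1))) ≤ ρ := by
  rcases Nat.lt_or_ge (h + 1) H with hlt | hge
  · rw [lsviValue_eq_clipValue hQ G hlt (hlow _ h.lt_succ_self)]
    refine hdev _ (fit_mem_paramClass hφ hL hLK hn (fun y => abs_le.mpr
      ⟨hlow (h + 1 + 1) (by omega) y, lsviValue_le_horizon hQ G s a g n _ y⟩)
      fun i hi => hg i hi _ hlt)
  · rw [Nat.sub_eq_zero_of_le hge]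
    simpa [transDev, transNoise, lsviValue] using hρ

end Prediction

section Analysis

variable {S A : Type*} {d m H K : ℕ}

/-- The value function of step `h` in episode `k` of the exploration phase. -/
abbrev exploreValue (β : ℝ) (H : ℕ) (φ : S × A → EuclideanSpace ℝ (Fin m)) (s : ℕ → ℕ → S)
    (a : ℕ → ℕ → A) (k h : ℕ) : S → ℝ :=
  lsviValue (exploreQ β H φ) H φ s a (fun _ _ => 0) k (H - h)

/-- The value function of step `h` in the planning phase. -/
abbrev planValue (β : ℝ) (H : ℕ) (φ : S × A → EuclideanSpace ℝ (Fin m)) (K : ℕ)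
    (s : ℕ → ℕ → S) (a : ℕ → ℕ → A) (r : ℕ → ℕ → EuclideanSpace ℝ (Fin d))
    (θ : EuclideanSpace ℝ (Fin d)) (h : ℕ) : S → ℝ :=
  lsviValue (planQ β H φ) H φ s a (fun i j => inner ℝ θ (r i j)) K (H - h)

/-- The bonus of step `h` after `n` episodes. -/
abbrev dataBonus (β : ℝ) (φ : S × A → EuclideanSpace ℝ (Fin m)) (s : ℕ → ℕ → S)
    (a : ℕ → ℕ → A) (h n : ℕ) (z : S × A) : ℝ :=
  β * matNorm (dataGram φ s a h n)⁻¹ (φ z).ofLp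

/-- Compatibility of the parameters of the analysis: the bound `L` holds for all regression
parameters of the algorithm, and the bonus coefficient `β` exceeds twice the regression error for
the confidence radius `ρ`. -/
structure Tuned (m H K : ℕ) (β ρ L : ℝ) : Prop where
  one_le_horizon : 1 ≤ H
  radius_nonneg : 0 ≤ ρ
  one_le_bound : 1 ≤ L
  bound : (H + 1) * K ≤ L
  bonus : 2 * ρ + 4 + 2 * (H * √m) ≤ β

lemma Tuned.bonus_nonneg {β ρ L : ℝ} (hT : Tuned m H K β ρ L) : 0 ≤ β := by
  have : 0 ≤ (H : ℝ) * √m := by positivity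
  linarith [hT.radius_nonneg, hT.bonus]

variable {φ : S × A → EuclideanSpace ℝ (Fin m)} {β : ℝ} {s : ℕ → ℕ → S} {a : ℕ → ℕ → A}

lemma dataBonus_nonneg (hβ : 0 ≤ β) (h n : ℕ) (z : S × A) : 0 ≤ dataBonus β φ s a h n z :=
  mul_nonneg hβ (matNorm_nonneg _ _)

lemma antitone_dataBonus (hβ : 0 ≤ β) (h : ℕ) (z : S × A) :
    Antitone fun n => dataBonus β φ s a h n z :=
  (antitone_matNorm_gram_inv _ _).const_mul hβ

lemma sum_dataBonus_le (hφ : ∀ z, ‖φ z‖ ≤ 1) (hβ : 0 ≤ β) (h : ℕ) :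
    ∑ k ∈ Finset.range K, dataBonus β φ s a h k (s k h, a k h)
      ≤ β * √(K * (2 * (m * Real.log (m + K)))) := by
  have hsum := Real.sum_sqrt_mul_sqrt_le (Finset.range K) (f := fun _ => (1 : ℝ))
    (g := lever fun k => φ (s k h, a k h)) (fun _ => zero_le_one) (lever_nonneg _)
  simp only [Real.sqrt_one, one_mul, Finset.sum_const, Finset.card_range, nsmul_eq_mul,
    mul_one] at hsum
  rw [← Finset.mul_sum, Real.sqrt_mul K.cast_nonneg]
  exact mul_le_mul_of_nonneg_left (hsum.trans (mul_le_mul_of_nonneg_left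
    (Real.sqrt_le_sqrt (sum_lever_le (fun k => hφ (s k h, a k h)) K)) (Real.sqrt_nonneg _))) hβ

variable [MeasurableSpace S] [MeasurableSpace A]

lemma integrable_lsviValue {Q : Param m → S → A → ℝ} {g : ℕ → ℕ → ℝ} {n h : ℕ}
    (hφ : Measurable φ) (hQ : RegularQ β H Q) (G : Greedy Q)
    (hlow : ∀ x, -(H : ℝ) ≤ lsviValue Q H φ s a g n (H - h) x) (μ : Measure S)
    [IsFiniteMeasure μ] : Integrable (lsviValue Q H φ s a g n (H - h)) μ :=
  .of_bound (measurable_lsviValue_state hφ hQ G h).aestronglyMeasurable H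
    (.of_forall fun x => abs_le.mpr ⟨hlow x, lsviValue_le_horizon hQ G s a g n h x⟩)

variable {M : VMDP S A d} {s₁ : S} {ρ L : ℝ} {Ge : Greedy (exploreQ β H φ)}
  {Gp : Greedy (planQ β H φ)} {r : ℕ → ℕ → EuclideanSpace ℝ (Fin d)}
  (hT : Tuned m H K β ρ L) (hM : M.IsLinear H φ) (hg : GoodData M s₁ H K φ β Ge Gp ρ L s a r)

include hT hM hg

section Exploration

variable {k h : ℕ}

lemma abs_inner_exploreParam_sub_le (hk : k ≤ K) (hh : h < H)
    (hnext : ∀ h', h < h' → ∀ y, 0 ≤ exploreValue β H φ s a k h' y) (z : S × A) :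
    |inner ℝ (lsviParam (exploreQ β H φ) H φ s a (fun _ _ => 0) k h).1 (φ z)
      - ∫ y, exploreValue β H φ s a k (h + 1) y ∂M.P h z| ≤ dataBonus β φ s a h k z / 2 := by
  have hQ := regularQ_exploreQ hT.bonus_nonneg H hM.measurable_feature hM.norm_feature_le
  have hlow : ∀ h', h < h' → ∀ y, -(H : ℝ) ≤ exploreValue β H φ s a k h' y := fun h' hh' y =>
    (neg_nonpos.mpr H.cast_nonneg).trans (hnext h' hh' y)
  have hdev := transDev_lsviValue_le (g := fun _ _ => 0) hQ Ge hM.norm_feature_le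
    hT.one_le_bound hT.bound (by linarith [hT.radius_nonneg]) (hg.step h hh |>.explore k hk) hk
    (by simp) hlow
  have hfit := abs_inner_fit_sub_le (g := fun _ _ => 0) (w := 0) (ρ' := 0) (C := 0) hM hh
    (measurable_lsviValue_state hM.measurable_feature hQ Ge (h + 1))
    (fun y => abs_le.mpr ⟨hlow _ h.lt_succ_self y, lsviValue_le_horizon hQ Ge s a _ k _ y⟩)
    hdev (by simp) (by simp) z
  rw [inner_zero_left, zero_add] at hfit
  calc _ ≤ matNorm (dataGram φ s a h k)⁻¹ (φ z).ofLp * (ρ + 2 + 0 + (H * √m + 0)) := hfit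
    _ ≤ matNorm (dataGram φ s a h k)⁻¹ (φ z).ofLp * (β / 2) :=
        mul_le_mul_of_nonneg_left (by linarith [hT.bonus]) (matNorm_nonneg _ _)
    _ = dataBonus β φ s a h k z / 2 := by rw [dataBonus]; ring

/-- Half of the optimism bonus survives the estimation error. -/
lemma min_le_exploreValue_of_nonneg (hk : k ≤ K) (hh : h < H)
    (hnext : ∀ h', h < h' → ∀ y, 0 ≤ exploreValue β H φ s a k h' y) (x : S) (b : A) :
    min (∫ y, exploreValue β H φ s a k (h + 1) y ∂M.P h (x, b)
      + dataBonus β φ s a h k (x, b) / 2) H ≤ exploreValue β H φ s a k h x := by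
  have hQ := regularQ_exploreQ hT.bonus_nonneg H hM.measurable_feature hM.norm_feature_le
  refine le_trans (min_le_min ?_ le_rfl) (le_lsviValue hQ Ge s a (fun _ _ => 0) k hh x b)
  have herror := (abs_le.mp (abs_inner_exploreParam_sub_le hT hM hg hk hh hnext (x, b))).1
  have hreward : 0 ≤ truncBonus β H φ
      (lsviParam (exploreQ β H φ) H φ s a (fun _ _ => 0) k h) x b / H :=
    div_nonneg (le_min (bonus_nonneg hT.bonus_nonneg _ _) H.cast_nonneg) H.cast_nonneg
  have hbonus : bonus β (lsviParam (exploreQ β H φ) H φ s a (fun _ _ => 0) k h).2 (φ (x, b))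
    = dataBonus β φ s a h k (x, b) := rfl
  linarith

lemma exploreValue_nonneg (hk : k ≤ K) (h : ℕ) (x : S) : 0 ≤ exploreValue β H φ s a k h x := by
  induction hj : H - h using Nat.strong_induction_on generalizing h x with
  | _ j ih =>
    subst hj
    rcases Nat.lt_or_ge h H with hh | hh
    · have hnext : ∀ h', h < h' → ∀ y, 0 ≤ exploreValue β H φ s a k h' y := fun h' hlt y =>
        ih (H - h') (by omega) h' y rfl
      have b := Ge.act 0 x
      exact (le_min (add_nonneg (integral_nonneg (hnext _ h.lt_succ_self))
        (div_nonneg (dataBonus_nonneg hT.bonus_nonneg _ _ _) zero_le_two)) H.cast_nonneg).trans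
        (min_le_exploreValue_of_nonneg hT hM hg hk hh hnext x b)
    · simp [exploreValue, Nat.sub_eq_zero_of_le hh, lsviValue]

lemma min_le_exploreValue (hk : k ≤ K) (hh : h < H) (x : S) (b : A) :
    min (∫ y, exploreValue β H φ s a k (h + 1) y ∂M.P h (x, b)
      + dataBonus β φ s a h k (x, b) / 2) H ≤ exploreValue β H φ s a k h x :=
  min_le_exploreValue_of_nonneg hT hM hg hk hh
    (fun h' _ => exploreValue_nonneg hT hM hg hk h') x b

lemma exploreValue_le (hk : k < K) (hh : h < H) :
    exploreValue β H φ s a k h (s k h) ≤ 3 * dataBonus β φ s a h k (s k h, a k h)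
      + ∫ y, exploreValue β H φ s a k (h + 1) y ∂M.P h (s k h, a k h) := by
  have hQ := regularQ_exploreQ hT.bonus_nonneg H hM.measurable_feature hM.norm_feature_le
  have hH : (1 : ℝ) ≤ H := by exact_mod_cast hT.one_le_horizon
  set p := lsviParam (exploreQ β H φ) H φ s a (fun _ _ => 0) k h
  have hgreedy : exploreValue β H φ s a k h (s k h) = exploreQ β H φ p (s k h) (a k h) := by
    rw [exploreValue, lsviValue_eq hQ Ge _ _ _ _ hh, hg.action k hk h hh]
    rfl
  have herror : inner ℝ p.1 (φ (s k h, a k h))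
      - ∫ y, exploreValue β H φ s a k (h + 1) y ∂M.P h (s k h, a k h)
      ≤ dataBonus β φ s a h k (s k h, a k h) / 2 :=
    (abs_le.mp (abs_inner_exploreParam_sub_le hT hM hg hk.le hh
      (fun h' _ => exploreValue_nonneg hT hM hg hk.le h') (s k h, a k h))).2
  have hbonus : bonus β p.2 (φ (s k h, a k h)) = dataBonus β φ s a h k (s k h, a k h) := rfl
  have hreward : truncBonus β H φ p (s k h) (a k h) / H
      ≤ dataBonus β φ s a h k (s k h, a k h) :=
    (div_le_iff₀ (by linarith)).mpr <| (min_le_left _ _).trans <| hbonus.trans_le <|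
      le_mul_of_one_le_right (dataBonus_nonneg hT.bonus_nonneg _ _ _) hH
  rw [hgreedy]
  refine (min_le_left _ _).trans ?_
  linarith [dataBonus_nonneg (φ := φ) (s := s) (a := a) hT.bonus_nonneg h k (s k h, a k h)]

lemma exploreValue_le_sum (hk : k < K) :
    exploreValue β H φ s a k 0 s₁ ≤ ∑ h ∈ Finset.range H,
      (3 * dataBonus β φ s a h k (s k h, a k h) - (exploreValue β H φ s a k (h + 1) (s k (h + 1))
        - ∫ y, exploreValue β H φ s a k (h + 1) y ∂M.P h (s k h, a k h))) := by
  have hlast : exploreValue β H φ s a k H (s k H) = 0 := by rw [exploreValue, Nat.sub_self]; rfl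
  calc exploreValue β H φ s a k 0 s₁
      = exploreValue β H φ s a k 0 (s k 0) - exploreValue β H φ s a k H (s k H) := by
        rw [hg.start k hk, hlast, sub_zero]
    _ = ∑ h ∈ Finset.range H, (exploreValue β H φ s a k h (s k h)
          - exploreValue β H φ s a k (h + 1) (s k (h + 1))) :=
        (Finset.sum_range_sub' (fun h => exploreValue β H φ s a k h (s k h)) H).symm
    _ ≤ _ := Finset.sum_le_sum fun h hh => by
        linarith [exploreValue_le hT hM hg hk (Finset.mem_range.mp hh)]

lemma neg_le_sum_exploreValue_sub_integral (hh : h < H) :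
    -(ρ * √(K + 1)) ≤ ∑ k ∈ Finset.range K, (exploreValue β H φ s a k (h + 1) (s k (h + 1))
      - ∫ y, exploreValue β H φ s a k (h + 1) y ∂M.P h (s k h, a k h)) := by
  have hclip : ∀ k < K, clipLsvi (exploreQ β H φ) H φ s a k (h + 1)
      = exploreValue β H φ s a k (h + 1) := fun k hk => funext fun y =>
    max_eq_left ((neg_nonpos.mpr H.cast_nonneg).trans (exploreValue_nonneg hT hM hg hk.le _ y))
  refine (abs_le.mp (hg.step h hh).martingale).1.trans_eq (Finset.sum_congr rfl fun k hk => ?_)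
  rw [hclip k (Finset.mem_range.mp hk)]

theorem sum_exploreValue_le :
    ∑ k ∈ Finset.range K, exploreValue β H φ s a k 0 s₁ ≤
      H * (3 * (β * √(K * (2 * (m * Real.log (m + K))))) + ρ * √(K + 1)) :=
  calc ∑ k ∈ Finset.range K, exploreValue β H φ s a k 0 s₁
      ≤ ∑ k ∈ Finset.range K, ∑ h ∈ Finset.range H, (3 * dataBonus β φ s a h k (s k h, a k h)
          - (exploreValue β H φ s a k (h + 1) (s k (h + 1))
            - ∫ y, exploreValue β H φ s a k (h + 1) y ∂M.P h (s k h, a k h))) :=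
        Finset.sum_le_sum fun _ hk => exploreValue_le_sum hT hM hg (Finset.mem_range.mp hk)
    _ = ∑ h ∈ Finset.range H, (3 * ∑ k ∈ Finset.range K, dataBonus β φ s a h k (s k h, a k h)
          - ∑ k ∈ Finset.range K, (exploreValue β H φ s a k (h + 1) (s k (h + 1))
            - ∫ y, exploreValue β H φ s a k (h + 1) y ∂M.P h (s k h, a k h))) := by
        rw [Finset.sum_comm]
        simp only [Finset.sum_sub_distrib, Finset.mul_sum]
    _ ≤ ∑ _h ∈ Finset.range H, (3 * (β * √(K * (2 * (m * Real.log (m + K)))))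
          + ρ * √(K + 1)) := Finset.sum_le_sum fun h hh => by
        linarith [sum_dataBonus_le (K := K) (s := s) (a := a) hM.norm_feature_le hT.bonus_nonneg h,
          neg_le_sum_exploreValue_sub_integral hT hM hg (Finset.mem_range.mp hh)]
    _ = _ := by rw [Finset.sum_const, Finset.card_range, nsmul_eq_mul]

end Exploration

section Planning

variable {θ : EuclideanSpace ℝ (Fin d)} (hθ : ‖θ‖ ≤ 1) {h : ℕ}

include hθ

omit hM in
lemma matNorm_returnNoise_le (hh : h < H) :
    matNorm (dataGram φ s a h K)⁻¹ (∑ i ∈ Finset.range K,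
      (inner ℝ θ (r i h) - inner ℝ θ (M.r h (s i h, a i h))) • (φ (s i h, a i h)).ofLp) ≤ ρ := by
  have hcoord : ∑ i ∈ Finset.range K, ((inner ℝ θ (r i h) : ℝ)
      - inner ℝ θ (M.r h (s i h, a i h))) • (φ (s i h, a i h)).ofLp
      = ∑ j, θ j • noiseSum (fun i => φ (s i h, a i h))
        (fun i j => truncReturn (r i h) j - M.r h (s i h, a i h) j) K j := by
    simp only [noiseSum, Finset.smul_sum]
    rw [Finset.sum_comm]
    refine Finset.sum_congr rfl fun i hi => ?_
    rw [truncReturn, if_pos (hg.ball i (Finset.mem_range.mp hi) h hh), ← inner_sub_right,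
      PiLp.inner_apply, Finset.sum_smul]
    exact Finset.sum_congr rfl fun j _ => by rw [smul_smul, mul_comm]; rfl
  have hθ_coord : √(∑ j, θ j ^ 2) ≤ 1 := by
    rwa [← EuclideanSpace.real_norm_sq_eq, Real.sqrt_sq (norm_nonneg _)]
  rw [hcoord]
  exact (matNorm_sum_smul_le (gram_inv_posSemidef _ K) _ _ _).trans <|
    (mul_le_of_le_one_left (Real.sqrt_nonneg _) hθ_coord).trans <|
      (Real.sqrt_le_left hT.radius_nonneg).mpr (hg.step h hh).returns

lemma abs_inner_planParam_sub_le (hh : h < H)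
    (hlow : ∀ h', h < h' → ∀ y, -(H : ℝ) ≤ planValue β H φ K s a r θ h' y) (z : S × A) :
    |inner ℝ (lsviParam (planQ β H φ) H φ s a (fun i j => inner ℝ θ (r i j)) K h).1 (φ z)
      - (inner ℝ θ (M.r h z) + ∫ y, planValue β H φ K s a r θ (h + 1) y ∂M.P h z)|
      ≤ dataBonus β φ s a h K z := by
  have hQ := regularQ_planQ hT.bonus_nonneg H hM.measurable_feature hM.norm_feature_le
  have hreturn : ∀ i < K, ∀ j < H, |inner ℝ θ (r i j)| ≤ 1 := fun i hi j hj =>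
    (abs_real_inner_le_norm _ _).trans (mul_le_one₀ hθ (norm_nonneg _) (hg.ball i hi j hj))
  have hdev := transDev_lsviValue_le hQ Gp hM.norm_feature_le hT.one_le_bound hT.bound
    (by linarith [hT.radius_nonneg]) (hg.step h hh |>.plan K le_rfl) le_rfl hreturn hlow
  obtain ⟨w, hw, hwr⟩ := hM.exists_return_weight hh hθ
  have hnoise := matNorm_returnNoise_le hT hg hθ hh
  simp only [hwr] at hnoise ⊢
  have hfit := abs_inner_fit_sub_le (g := fun i j => inner ℝ θ (r i j)) hM hh
    (measurable_lsviValue_state hM.measurable_feature hQ Gp (h + 1))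
    (fun y => abs_le.mpr ⟨hlow _ h.lt_succ_self y, lsviValue_le_horizon hQ Gp s a _ K _ y⟩)
    hdev hnoise hw z
  have hH : √m ≤ H * √m :=
    le_mul_of_one_le_left (Real.sqrt_nonneg _) (by exact_mod_cast hT.one_le_horizon)
  calc _ ≤ matNorm (dataGram φ s a h K)⁻¹ (φ z).ofLp * (ρ + 2 + ρ + (H * √m + √m)) := hfit
    _ ≤ matNorm (dataGram φ s a h K)⁻¹ (φ z).ofLp * β :=
        mul_le_mul_of_nonneg_left (by linarith [hT.bonus]) (matNorm_nonneg _ _)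
    _ = dataBonus β φ s a h K z := mul_comm _ _

lemma actionValue_le_planValue (hh : h < H) (π : Policy S A)
    (hnext : ∀ h', h < h' → ∀ y, M.valueN π θ (H - h') h' y ≤ planValue β H φ K s a r θ h' y)
    (x : S) (b : A) :
    M.actionValue π θ (H - (h + 1)) h (x, b) ≤ planValue β H φ K s a r θ h x := by
  have hQ := regularQ_planQ hT.bonus_nonneg H hM.measurable_feature hM.norm_feature_le
  have := M.markov h
  have hlow : ∀ h', h < h' → ∀ y, -(H : ℝ) ≤ planValue β H φ K s a r θ h' y := fun h' hh' y =>
    (neg_le_neg (Nat.cast_le.mpr (Nat.sub_le H h'))).trans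
      ((abs_le.mp (M.abs_valueN_le π hθ (H - h') h' y)).1.trans (hnext h' hh' y))
  refine le_trans (le_min ?_ ?_)
    (le_lsviValue hQ Gp s a (fun i j => inner ℝ θ (r i j)) K hh x b)
  · have herror := (abs_le.mp (abs_inner_planParam_sub_le hT hM hg hθ hh hlow (x, b))).1
    have hnext_integral : ∫ y, M.valueN π θ (H - (h + 1)) (h + 1) y ∂M.P h (x, b)
        ≤ ∫ y, planValue β H φ K s a r θ (h + 1) y ∂M.P h (x, b) :=
      integral_mono (M.integrable_valueN π hθ _ _ _)
        (integrable_lsviValue hM.measurable_feature hQ Gp (hlow _ h.lt_succ_self) _)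
        (hnext _ h.lt_succ_self)
    have hbonus : bonus β (lsviParam (planQ β H φ) H φ s a (fun i j => inner ℝ θ (r i j)) K h).2
      (φ (x, b)) = dataBonus β φ s a h K (x, b) := rfl
    rw [VMDP.actionValue]
    linarith
  · refine (abs_le.mp (M.abs_actionValue_le π hθ _ h (x, b))).2.trans ?_
    exact_mod_cast (by omega : H - (h + 1) + 1 ≤ H)

theorem valueN_le_planValue (π : Policy S A) (h : ℕ) (x : S) :
    M.valueN π θ (H - h) h x ≤ planValue β H φ K s a r θ h x := by
  induction hj : H - h using Nat.strong_induction_on generalizing h x with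
  | _ j ih =>
    subst hj
    rcases Nat.lt_or_ge h H with hh | hh
    · rw [show H - h = H - (h + 1) + 1 by omega]
      exact M.valueN_succ_le π hθ fun b => actionValue_le_planValue hT hM hg hθ hh π
        (fun h' hlt y => ih (H - h') (by omega) h' y rfl) x b
    · rw [planValue, Nat.sub_eq_zero_of_le hh]
      simp [VMDP.valueN, lsviValue]

lemma neg_horizon_le_planValue (h : ℕ) (x : S) : -(H : ℝ) ≤ planValue β H φ K s a r θ h x :=
  let π := planPolicy β H φ Gp K s a r θ
  (neg_le_neg (Nat.cast_le.mpr (Nat.sub_le H h))).trans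
    ((abs_le.mp (M.abs_valueN_le π hθ (H - h) h x)).1.trans
      (valueN_le_planValue hT hM hg hθ π h x))

lemma planValue_sub_valueN_le_add (hh : h < H) (x : S) :
    ∃ b, planValue β H φ K s a r θ h x
        - M.valueN (planPolicy β H φ Gp K s a r θ) θ (H - h) h x
      ≤ 2 * dataBonus β φ s a h K (x, b)
        + (∫ y, planValue β H φ K s a r θ (h + 1) y ∂M.P h (x, b)
          - ∫ y, M.valueN (planPolicy β H φ Gp K s a r θ) θ (H - (h + 1)) (h + 1) y
              ∂M.P h (x, b)) := by
  have hQ := regularQ_planQ hT.bonus_nonneg H hM.measurable_feature hM.norm_feature_le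
  set p := lsviParam (planQ β H φ) H φ s a (fun i j => inner ℝ θ (r i j)) K h
  refine ⟨Gp.act p x, ?_⟩
  have hplan : planValue β H φ K s a r θ h x
      ≤ inner ℝ p.1 (φ (x, Gp.act p x)) + dataBonus β φ s a h K (x, Gp.act p x) := by
    rw [planValue, lsviValue_eq hQ Gp s a _ K hh]
    exact min_le_left _ _
  have hvalue : M.valueN (planPolicy β H φ Gp K s a r θ) θ (H - h) h x
      = M.actionValue (planPolicy β H φ Gp K s a r θ) θ (H - (h + 1)) h (x, Gp.act p x) := by
    rw [show H - h = H - (h + 1) + 1 by omega]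
    exact M.valueN_ofFun_succ hθ _ _ h x
  have herror : inner ℝ p.1 (φ (x, Gp.act p x)) - (inner ℝ θ (M.r h (x, Gp.act p x))
      + ∫ y, planValue β H φ K s a r θ (h + 1) y ∂M.P h (x, Gp.act p x))
      ≤ dataBonus β φ s a h K (x, Gp.act p x) :=
    (abs_le.mp (abs_inner_planParam_sub_le hT hM hg hθ hh
      (fun h' _ => neg_horizon_le_planValue hT hM hg hθ h') (x, Gp.act p x))).2
  rw [hvalue, VMDP.actionValue]
  linarith

omit hg in
lemma planValue_sub_valueN_le_two_mul (h : ℕ) (x : S) :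
    planValue β H φ K s a r θ h x - M.valueN (planPolicy β H φ Gp K s a r θ) θ (H - h) h x
      ≤ 2 * H := by
  have hQ := regularQ_planQ hT.bonus_nonneg H hM.measurable_feature hM.norm_feature_le
  have hplan := lsviValue_le_horizon (φ := φ) hQ Gp s a (fun i j => inner ℝ θ (r i j)) K h x
  have hvalue := (abs_le.mp (M.abs_valueN_le (planPolicy β H φ Gp K s a r θ) hθ (H - h) h x)).1
  have hsub : ((H - h : ℕ) : ℝ) ≤ H := Nat.cast_le.mpr (Nat.sub_le H h)
  linarith

/-- Both values obey the same Bellman recursion, and by monotonicity of the Gram matrices the bonus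
driving the left-hand side is dominated by that of every earlier episode. -/
theorem planValue_sub_valueN_le {k : ℕ} (hk : k ≤ K) (h : ℕ) (x : S) :
    planValue β H φ K s a r θ h x - M.valueN (planPolicy β H φ Gp K s a r θ) θ (H - h) h x
      ≤ 4 * exploreValue β H φ s a k h x := by
  have hQ := regularQ_planQ hT.bonus_nonneg H hM.measurable_feature hM.norm_feature_le
  have hQe := regularQ_exploreQ hT.bonus_nonneg H hM.measurable_feature hM.norm_feature_le
  induction hj : H - h using Nat.strong_induction_on generalizing h x with
  | _ j ih =>
    subst hj
    rcases Nat.lt_or_ge h H with hh | hh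
    · have := M.markov h
      obtain ⟨b, hb⟩ := planValue_sub_valueN_le_add hT hM hg hθ hh x
      have hnext : ∫ y, planValue β H φ K s a r θ (h + 1) y ∂M.P h (x, b)
          - ∫ y, M.valueN (planPolicy β H φ Gp K s a r θ) θ (H - (h + 1)) (h + 1) y
              ∂M.P h (x, b)
          ≤ 4 * ∫ y, exploreValue β H φ s a k (h + 1) y ∂M.P h (x, b) := by
        have hplan := integrable_lsviValue hM.measurable_feature hQ Gp
          (neg_horizon_le_planValue hT hM hg hθ (h + 1)) (M.P h (x, b))
        have hvalue := M.integrable_valueN (planPolicy β H φ Gp K s a r θ) hθ (H - (h + 1))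
          (h + 1) (M.P h (x, b))
        have hexplore := integrable_lsviValue hM.measurable_feature hQe Ge (fun y =>
          (neg_nonpos.mpr H.cast_nonneg).trans (exploreValue_nonneg hT hM hg hk (h + 1) y))
          (M.P h (x, b))
        rw [← integral_sub hplan hvalue, ← integral_const_mul]
        exact integral_mono (hplan.sub hvalue) (hexplore.const_mul 4)
          fun y => ih (H - (h + 1)) (by omega) (h + 1) y rfl
      have hbonus := antitone_dataBonus (φ := φ) (s := s) (a := a) hT.bonus_nonneg h (x, b) hk
      rw [← div_le_iff₀' four_pos]
      refine (le_min ?_ ?_).trans (min_le_exploreValue hT hM hg hk hh x b)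
      · simp only at hbonus
        linarith
      · linarith [(H.cast_nonneg : (0 : ℝ) ≤ H),
          planValue_sub_valueN_le_two_mul (s := s) (a := a) (r := r) (Gp := Gp) hT hM hθ h x]
    · rw [planValue, exploreValue, Nat.sub_eq_zero_of_le hh]
      simp [VMDP.valueN, lsviValue]

theorem mul_optValue_sub_value_le :
    K * (M.optValue H θ 0 s₁ - M.value H θ (planPolicy β H φ Gp K s a r θ) 0 s₁) ≤
      4 * (H * (3 * (β * √(K * (2 * (m * Real.log (m + K))))) + ρ * √(K + 1))) := by
  set π := planPolicy β H φ Gp K s a r θ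
  have : Nonempty (Policy S A) := ⟨π⟩
  have hoptimism : M.optValue H θ 0 s₁ ≤ planValue β H φ K s a r θ 0 s₁ :=
    ciSup_le fun π' => valueN_le_planValue hT hM hg hθ π' 0 s₁
  calc K * (M.optValue H θ 0 s₁ - M.value H θ π 0 s₁)
      = ∑ _k ∈ Finset.range K, (M.optValue H θ 0 s₁ - M.value H θ π 0 s₁) := by
        rw [Finset.sum_const, Finset.card_range, nsmul_eq_mul]
    _ ≤ ∑ k ∈ Finset.range K, 4 * exploreValue β H φ s a k 0 s₁ :=
        Finset.sum_le_sum fun k hk => (sub_le_sub_right hoptimism _).trans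
          (planValue_sub_valueN_le hT hM hg hθ (Finset.mem_range.mp hk).le 0 s₁)
    _ = 4 * ∑ k ∈ Finset.range K, exploreValue β H φ s a k 0 s₁ := (Finset.mul_sum _ _ _).symm
    _ ≤ _ := mul_le_mul_of_nonneg_left (sum_exploreValue_le hT hM hg) four_pos.le

end Planning

end Analysis

section Tuning

/-- The resolution of the grid of regression parameters: replacing a parameter by a neighbouring
grid point changes the sum of `K` values by at most `1`. -/
def gridStep (m K : ℕ) (β : ℝ) : ℝ := (1 / (K * m * (1 + 2 * β))) ^ 2

/-- The failure probability of each of the events in the union bound. -/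
def eventProb (m H K : ℕ) (β δ : ℝ) : ℝ :=
  δ / (4 * H * (K + 1) * netSize m (2 * H * K) (gridStep m K β) : ℕ)

/-- The argument `d_lin d K H / δ` of the logarithm in the bonus coefficient. -/
def logArg (m d H K : ℕ) (δ : ℝ) : ℝ := m * d * K * H / δ

variable {m d H K : ℕ} {β δ : ℝ}

lemma gridStep_pos (hm : 1 ≤ m) (hK : 1 ≤ K) (hβ : 0 ≤ β) : 0 < gridStep m K β := by
  rw [gridStep]
  positivity

lemma mul_gridStep_le_one (hm : 1 ≤ m) (hK : 1 ≤ K) (hβ : 0 ≤ β) :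
    K * (m * gridStep m K β + 2 * β * (m * √(gridStep m K β))) ≤ 1 := by
  have hKm : (1 : ℝ) ≤ K * m := by exact_mod_cast Nat.mul_pos hK hm
  set t := 1 / ((K : ℝ) * m * (1 + 2 * β))
  have ht : 0 ≤ t := by positivity
  have ht_one : t ≤ 1 :=
    div_le_one_of_le₀ (one_le_mul_of_one_le_of_one_le hKm (by linarith)) (by positivity)
  rw [gridStep, Real.sqrt_sq ht]
  calc (K : ℝ) * (m * t ^ 2 + 2 * β * (m * t)) = K * m * (t * t + 2 * β * t) := by ring
    _ ≤ K * m * (1 * t + 2 * β * t) := by gcongr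
    _ = K * m * (1 + 2 * β) * t := by ring
    _ = 1 := mul_one_div_cancel (by positivity)

lemma mul_mul_le_logArg (hd : 1 ≤ d) (hδ : 0 < δ) (hδ1 : δ ≤ 1) :
    (m : ℝ) * K * H ≤ logArg m d H K δ := by
  have hd' : (1 : ℝ) ≤ d := by exact_mod_cast hd
  calc (m : ℝ) * K * H ≤ m * K * H * (d / δ) :=
        le_mul_of_one_le_right (by positivity) ((one_le_div hδ).mpr (hδ1.trans hd'))
    _ = logArg m d H K δ := by rw [logArg]; ring

lemma mul_episodes_le_logArg (hd : 1 ≤ d) (hH : 1 ≤ H) (hδ : 0 < δ) (hδ1 : δ ≤ 1) :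
    (m : ℝ) * K ≤ logArg m d H K δ :=
  (le_mul_of_one_le_right (by positivity) (by exact_mod_cast hH)).trans
    (mul_mul_le_logArg hd hδ hδ1)

lemma mul_horizon_le_logArg (hd : 1 ≤ d) (hK : 1 ≤ K) (hδ : 0 < δ) (hδ1 : δ ≤ 1) :
    (m : ℝ) * H ≤ logArg m d H K δ :=
  calc (m : ℝ) * H ≤ m * H * K := le_mul_of_one_le_right (by positivity) (by exact_mod_cast hK)
    _ = m * K * H := mul_right_comm _ _ _
    _ ≤ logArg m d H K δ := mul_mul_le_logArg hd hδ hδ1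

lemma four_le_logArg (hm : 2 ≤ m) (hd : 1 ≤ d) (hH : 1 ≤ H) (hK : 2 ≤ K) (hδ : 0 < δ)
    (hδ1 : δ ≤ 1) : 4 ≤ logArg m d H K δ :=
  le_trans (by exact_mod_cast Nat.mul_le_mul hm hK) (mul_episodes_le_logArg hd hH hδ hδ1)

lemma one_le_log_logArg (hm : 2 ≤ m) (hd : 1 ≤ d) (hH : 1 ≤ H) (hK : 2 ≤ K) (hδ : 0 < δ)
    (hδ1 : δ ≤ 1) : 1 ≤ Real.log (logArg m d H K δ) := by
  have hfour := four_le_logArg hm hd hH hK hδ hδ1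
  rw [Real.le_log_iff_exp_le (by linarith)]
  linarith [Real.exp_one_lt_three]

lemma log_add_le_log_logArg (hm : 2 ≤ m) (hd : 1 ≤ d) (hH : 1 ≤ H) (hK : 2 ≤ K) (hδ : 0 < δ)
    (hδ1 : δ ≤ 1) : Real.log (m + K) ≤ Real.log (logArg m d H K δ) := by
  have hadd : (m : ℝ) + K ≤ m * K := by exact_mod_cast Nat.add_le_mul hm hK
  exact Real.log_le_log (by positivity) (hadd.trans (mul_episodes_le_logArg hd hH hδ hδ1))

lemma bonusCoeff_eq (cβ : ℝ) :
    bonusCoeff cβ m d H K δ = cβ * (m * H * √(Real.log (logArg m d H K δ))) := by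
  rw [bonusCoeff, logArg]
  ring

lemma bonusCoeff_nonneg {cβ : ℝ} (hc : 0 ≤ cβ) : 0 ≤ bonusCoeff cβ m d H K δ := by
  rw [bonusCoeff]
  positivity

lemma one_add_two_mul_bonusCoeff_le (hm : 2 ≤ m) (hd : 1 ≤ d) (hH : 1 ≤ H) (hK : 2 ≤ K)
    (hδ : 0 < δ) (hδ1 : δ ≤ 1) :
    1 + 2 * bonusCoeff 100 m d H K δ ≤ 201 * logArg m d H K δ ^ 2 := by
  have hfour := four_le_logArg hm hd hH hK hδ hδ1
  have hmH := mul_horizon_le_logArg (m := m) (H := H) hd (by omega : 1 ≤ K) hδ hδ1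
  rw [bonusCoeff_eq]
  generalize logArg m d H K δ = X at *
  have hsqrt : √(Real.log X) ≤ X := by
    rw [Real.sqrt_le_left (by linarith)]
    nlinarith [Real.log_le_sub_one_of_pos (by linarith : 0 < X)]
  have hmul : m * H * √(Real.log X) ≤ X * X :=
    mul_le_mul hmH hsqrt (Real.sqrt_nonneg _) (by linarith)
  nlinarith

lemma floor_gridStep_le {X : ℝ} (hX : 4 ≤ X) (hKX : (K : ℝ) ≤ X) (hmK : (m : ℝ) * K ≤ X)
    (hmKH : (m : ℝ) * K * H ≤ X) (hβ : 0 ≤ β) (hβX : 1 + 2 * β ≤ 201 * X ^ 2) :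
    ((⌊2 * (2 * H * K : ℝ) / gridStep m K β⌋₊ + 1 : ℕ) : ℝ) ≤ X ^ 16 := by
  have hnonneg : 0 ≤ 2 * (2 * H * K : ℝ) / gridStep m K β :=
    div_nonneg (by positivity) (sq_nonneg _)
  have hconst : (201 ^ 2 * 4 + 1 : ℝ) ≤ X ^ 9 :=
    le_trans (by norm_num) (pow_le_pow_left₀ (by norm_num) hX 9)
  push_cast
  calc (⌊2 * (2 * H * K : ℝ) / gridStep m K β⌋₊ : ℝ) + 1
      ≤ 2 * (2 * H * K : ℝ) / gridStep m K β + 1 := add_le_add_left (Nat.floor_le hnonneg) 1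
    _ = 4 * ((m * K * H) * (m * K) * K) * (1 + 2 * β) ^ 2 + 1 := by
        rw [gridStep, one_div, inv_pow, div_inv_eq_mul]
        ring
    _ ≤ 4 * (X * X * X) * (201 * X ^ 2) ^ 2 + 1 := by gcongr
    _ ≤ (201 ^ 2 * 4) * X ^ 7 + X ^ 7 := by
        nlinarith [one_le_pow₀ (by linarith : 1 ≤ X) (n := 7)]
    _ = (201 ^ 2 * 4 + 1) * X ^ 7 := by ring
    _ ≤ X ^ 9 * X ^ 7 := by gcongr
    _ = X ^ 16 := by ring

lemma log_netSize_le (hm : 1 ≤ m) {B t C : ℝ}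
    (hC : Real.log ((⌊2 * B / t⌋₊ + 1 : ℕ) : ℝ) ≤ C) :
    Real.log (netSize m B t) ≤ 2 * m ^ 2 * C := by
  have hexponent : ((m + m * m : ℕ) : ℝ) ≤ 2 * m ^ 2 := by exact_mod_cast (by nlinarith)
  rw [netSize, Nat.cast_pow, Real.log_pow]
  exact mul_le_mul hexponent hC (Real.log_natCast_nonneg _) (by positivity)

lemma netSize_pos (m : ℕ) (L t : ℝ) : 0 < netSize m L t := Nat.pow_pos (Nat.succ_pos _)

lemma log_netSize_gridStep_le (hm : 2 ≤ m) (hd : 1 ≤ d) (hH : 1 ≤ H) (hK : 2 ≤ K) (hδ : 0 < δ)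
    (hδ1 : δ ≤ 1) :
    Real.log (netSize m (2 * H * K) (gridStep m K (bonusCoeff 100 m d H K δ)))
      ≤ 32 * m ^ 2 * Real.log (logArg m d H K δ) := by
  have hmK := mul_episodes_le_logArg (m := m) (K := K) hd hH hδ hδ1
  have hKX : (K : ℝ) ≤ logArg m d H K δ :=
    (le_mul_of_one_le_left K.cast_nonneg (by exact_mod_cast (by omega : 1 ≤ m))).trans hmK
  have hfloor := floor_gridStep_le (four_le_logArg hm hd hH hK hδ hδ1) hKX hmK
    (mul_mul_le_logArg hd hδ hδ1) (bonusCoeff_nonneg (by norm_num))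
    (one_add_two_mul_bonusCoeff_le hm hd hH hK hδ hδ1)
  have hlog := Real.log_le_log (by positivity) hfloor
  rw [Real.log_pow] at hlog
  refine (log_netSize_le (by omega) hlog).trans_eq ?_
  push_cast
  ring

lemma log_four_mul_le (hm : 2 ≤ m) (hd : 1 ≤ d) (hH : 1 ≤ H) (hK : 2 ≤ K) (hδ : 0 < δ)
    (hδ1 : δ ≤ 1) :
    Real.log (4 * H * (K + 1) / δ) ≤ 2 * Real.log (logArg m d H K δ) := by
  have hfour := four_le_logArg hm hd hH hK hδ hδ1
  have hmd : (2 : ℝ) ≤ m * d := by exact_mod_cast Nat.mul_le_mul hm hd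
  have hK' : (2 : ℝ) ≤ K := by exact_mod_cast hK
  calc Real.log (4 * H * (K + 1) / δ) ≤ Real.log (4 * (m * d * K * H / δ)) := by
        refine Real.log_le_log (by positivity) ?_
        rw [← mul_div_assoc]
        gcongr ?_ / δ
        calc (4 : ℝ) * H * (K + 1) ≤ 4 * H * (2 * K) := by gcongr; linarith
          _ ≤ 4 * H * (m * d * K) := by gcongr
          _ = 4 * (m * d * K * H) := by ring
    _ ≤ Real.log (logArg m d H K δ ^ 2) := by
        rw [← logArg, sq]
        refine Real.log_le_log (by positivity) ?_
        gcongr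
    _ = 2 * Real.log (logArg m d H K δ) := by rw [Real.log_pow]; norm_num

lemma log_inv_eventProb_le (hm : 2 ≤ m) (hd : 1 ≤ d) (hH : 1 ≤ H) (hK : 2 ≤ K) (hδ : 0 < δ)
    (hδ1 : δ ≤ 1) :
    Real.log (1 / eventProb m H K (bonusCoeff 100 m d H K δ) δ)
      ≤ 34 * m ^ 2 * Real.log (logArg m d H K δ) := by
  have hlogNet := log_netSize_gridStep_le hm hd hH hK hδ hδ1
  have hlogProb := log_four_mul_le hm hd hH hK hδ hδ1
  have hnet : (0 : ℝ) < netSize m (2 * H * K) (gridStep m K (bonusCoeff 100 m d H K δ)) :=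
    Nat.cast_pos.mpr (netSize_pos _ _ _)
  have hfactor : 1 / eventProb m H K (bonusCoeff 100 m d H K δ) δ = (4 * H * (K + 1) / δ)
      * netSize m (2 * H * K) (gridStep m K (bonusCoeff 100 m d H K δ)) := by
    rw [eventProb, one_div_div]
    push_cast
    ring
  have hm_sq : Real.log (logArg m d H K δ) ≤ m ^ 2 * Real.log (logArg m d H K δ) :=
    le_mul_of_one_le_left (zero_le_one.trans (one_le_log_logArg hm hd hH hK hδ hδ1))
      (by exact_mod_cast Nat.one_le_pow _ _ (by omega))
  rw [hfactor, Real.log_mul (by positivity) hnet.ne']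
  linarith

lemma radius_le {p ι : ℝ} (hm : 1 ≤ m) (hι : 0 ≤ ι) (hmK : Real.log (m + K) ≤ ι)
    (hp : Real.log (1 / p) ≤ 34 * m ^ 2 * ι) : radius m H K p ≤ 24 * (m * H * √ι) := by
  have hm' : (1 : ℝ) ≤ m := by exact_mod_cast hm
  rw [radius, Real.sqrt_le_left (by positivity)]
  calc (2 * H : ℝ) ^ 2 * (m * Real.log (m + K)) + 4 * (2 * H : ℝ) ^ 2 * Real.log (1 / p)
      ≤ (2 * H : ℝ) ^ 2 * (m * (m * ι)) + 4 * (2 * H : ℝ) ^ 2 * (34 * m ^ 2 * ι) := by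
        gcongr
        exact hmK.trans (le_mul_of_one_le_left hι hm')
    _ = 548 * (m ^ 2 * H ^ 2 * ι) := by ring
    _ ≤ 576 * (m ^ 2 * H ^ 2 * ι) := by gcongr; norm_num
    _ = (24 * (m * H)) ^ 2 * √ι ^ 2 := by rw [Real.sq_sqrt hι]; ring
    _ = (24 * (m * H * √ι)) ^ 2 := by ring

lemma radius_eventProb_le (hm : 2 ≤ m) (hd : 1 ≤ d) (hH : 1 ≤ H) (hK : 2 ≤ K) (hδ : 0 < δ)
    (hδ1 : δ ≤ 1) :
    radius m H K (eventProb m H K (bonusCoeff 100 m d H K δ) δ)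
      ≤ 24 * (m * H * √(Real.log (logArg m d H K δ))) :=
  radius_le (by omega) (zero_le_one.trans (one_le_log_logArg hm hd hH hK hδ hδ1))
    (log_add_le_log_logArg hm hd hH hK hδ hδ1) (log_inv_eventProb_le hm hd hH hK hδ hδ1)

lemma tuned_bonusCoeff (hm : 2 ≤ m) (hd : 1 ≤ d) (hH : 1 ≤ H) (hK : 2 ≤ K) (hδ : 0 < δ)
    (hδ1 : δ ≤ 1) :
    Tuned m H K (bonusCoeff 100 m d H K δ)
      (radius m H K (eventProb m H K (bonusCoeff 100 m d H K δ) δ)) (2 * H * K) := by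
  have hradius := radius_eventProb_le hm hd hH hK hδ hδ1
  have hm' : (1 : ℝ) ≤ m := by exact_mod_cast (by omega : 1 ≤ m)
  have hH' : (1 : ℝ) ≤ H := by exact_mod_cast hH
  have hsqrt_log : 1 ≤ √(Real.log (logArg m d H K δ)) :=
    Real.one_le_sqrt.mpr (one_le_log_logArg hm hd hH hK hδ hδ1)
  have hHm : (H : ℝ) * √m ≤ m * H * √(Real.log (logArg m d H K δ)) :=
    calc (H : ℝ) * √m ≤ H * m := by
          gcongr
          exact Real.sqrt_le_iff.mpr ⟨by positivity, le_self_pow₀ hm' two_ne_zero⟩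
      _ = m * H := mul_comm _ _
      _ ≤ m * H * √(Real.log (logArg m d H K δ)) :=
        le_mul_of_one_le_right (by positivity) hsqrt_log
  have hone : 1 ≤ m * H * √(Real.log (logArg m d H K δ)) :=
    one_le_mul_of_one_le_of_one_le (one_le_mul_of_one_le_of_one_le hm' hH') hsqrt_log
  refine ⟨hH, radius_nonneg _ _ _ _, ?_, ?_, ?_⟩
  · exact_mod_cast Nat.mul_pos (Nat.mul_pos two_pos hH) (by omega)
  · gcongr
    linarith
  · rw [bonusCoeff_eq] at hradius ⊢
    linarith

end Tuning

section Rate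

/-- The argument `d_lin d H / (ε δ)` of the logarithm in the rate. -/
def rateArg (m d H : ℕ) (ε δ : ℝ) : ℝ := m * d * H / (ε * δ)

/-- The constant `c_K`: the factor `2400` comes from the total error and the factor `100` from the
conversion of the logarithm of `logArg` into that of `rateArg`. -/
def episodeConst : ℝ := (2400 * 100) ^ 2

variable {m d H K : ℕ} {ε δ : ℝ}

lemma dim_le_rateArg (hd : 1 ≤ d) (hε : 0 < ε) (hεH : ε ≤ H) (hδ : 0 < δ) (hδ1 : δ ≤ 1) :
    (m : ℝ) ≤ rateArg m d H ε δ := by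
  have hd' : (1 : ℝ) ≤ d := by exact_mod_cast hd
  rw [rateArg, le_div_iff₀ (by positivity), mul_assoc]
  refine mul_le_mul_of_nonneg_left ?_ m.cast_nonneg
  calc ε * δ ≤ H * 1 := by gcongr
    _ ≤ d * H := by rw [mul_one]; exact le_mul_of_one_le_left H.cast_nonneg hd'

lemma one_div_le_rateArg (hm : 1 ≤ m) (hd : 1 ≤ d) (hH : 1 ≤ H) (hε : 0 < ε) (hδ : 0 < δ)
    (hδ1 : δ ≤ 1) : 1 / ε ≤ rateArg m d H ε δ := by
  have hmdH : (1 : ℝ) ≤ m * d * H := by exact_mod_cast Nat.mul_pos (Nat.mul_pos hm hd) hH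
  rw [rateArg]
  gcongr
  exact mul_le_of_le_one_right hε.le hδ1

lemma half_le_log_rateArg (hm : 2 ≤ m) (hd : 1 ≤ d) (hε : 0 < ε) (hεH : ε ≤ H) (hδ : 0 < δ)
    (hδ1 : δ ≤ 1) : 1 / 2 ≤ Real.log (rateArg m d H ε δ) := by
  have htwo : (2 : ℝ) ≤ rateArg m d H ε δ :=
    le_trans (by exact_mod_cast hm) (dim_le_rateArg hd hε hεH hδ hδ1)
  linarith [Real.log_two_gt_d9, Real.log_le_log two_pos htwo]

lemma one_le_rate (hm : 2 ≤ m) (hd : 1 ≤ d) (hH : 1 ≤ H) (hε : 0 < ε) (hεH : ε ≤ H)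
    (hδ : 0 < δ) (hδ1 : δ ≤ 1) : 1 ≤ rate m d H ε δ := by
  have hlog := half_le_log_rateArg hm hd hε hεH hδ hδ1
  have hm' : (2 : ℝ) ≤ m := by exact_mod_cast hm
  have hH' : (1 : ℝ) ≤ H := by exact_mod_cast hH
  rw [rate, ← rateArg, le_div_iff₀ (by positivity), one_mul]
  calc ε ^ 2 ≤ (H : ℝ) ^ 2 := by gcongr
    _ ≤ (H : ℝ) ^ 6 := pow_le_pow_right₀ hH' (by norm_num)
    _ ≤ 2 ^ 3 * (H : ℝ) ^ 6 * (1 / 2) ^ 2 := by linarith [pow_nonneg (zero_le_one.trans hH') 6]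
    _ ≤ (m : ℝ) ^ 3 * H ^ 6 * Real.log (rateArg m d H ε δ) ^ 2 := by gcongr

lemma two_le_of_rate_le (hm : 2 ≤ m) (hd : 1 ≤ d) (hH : 1 ≤ H) (hε : 0 < ε) (hεH : ε ≤ H)
    (hδ : 0 < δ) (hδ1 : δ ≤ 1) (hK : episodeConst * rate m d H ε δ ≤ K) : 2 ≤ K := by
  have hrate := one_le_rate hm hd hH hε hεH hδ hδ1
  rw [episodeConst] at hK
  exact_mod_cast (by linarith : (2 : ℝ) ≤ K)

lemma mul_log_rateArg_le (hε : 0 < ε) (hK : episodeConst * rate m d H ε δ ≤ K) :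
    2400 * (m * √m * H ^ 2) * (100 * (H * Real.log (rateArg m d H ε δ))) ≤ √K * ε := by
  rw [rate, ← rateArg, episodeConst, mul_div_assoc', div_le_iff₀ (by positivity)] at hK
  refine abs_le_of_sq_le_sq' ?_ (by positivity) |>.2
  calc (2400 * (m * √m * H ^ 2) * (100 * (H * Real.log (rateArg m d H ε δ)))) ^ 2
      = (2400 * 100) ^ 2 * (m ^ 2 * √m ^ 2 * H ^ 6 * Real.log (rateArg m d H ε δ) ^ 2) := by ring
    _ = (2400 * 100) ^ 2 * (m ^ 3 * H ^ 6 * Real.log (rateArg m d H ε δ) ^ 2) := by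
        rw [Real.sq_sqrt m.cast_nonneg]
        ring
    _ ≤ K * ε ^ 2 := hK
    _ = (√K * ε) ^ 2 := by rw [mul_pow, Real.sq_sqrt K.cast_nonneg]

lemma logArg_le (hm : 1 ≤ m) (hd : 1 ≤ d) (hH : 1 ≤ H) (hε : 0 < ε) (hεH : ε ≤ H) (hδ : 0 < δ)
    (hδ1 : δ ≤ 1) {t : ℝ} (ht : 2400 * (m * √m * H ^ 2) * t = √K * ε) :
    logArg m d H K δ ≤ 2400 ^ 2 * (rateArg m d H ε δ ^ 5 * H ^ 4 * t ^ 2) := by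
  have hdim := dim_le_rateArg (m := m) hd hε hεH hδ hδ1
  have hinv := one_div_le_rateArg hm hd hH hε hδ hδ1
  have hR : 0 < rateArg m d H ε δ := (one_div_pos.mpr hε).trans_le hinv
  have hKε : K * ε ^ 2 = 2400 ^ 2 * (m ^ 3 * H ^ 4 * t ^ 2) :=
    calc K * ε ^ 2 = (2400 * (m * √m * H ^ 2) * t) ^ 2 := by
          rw [ht, mul_pow, Real.sq_sqrt K.cast_nonneg]
      _ = 2400 ^ 2 * (m ^ 2 * √m ^ 2 * H ^ 4 * t ^ 2) := by ring
      _ = 2400 ^ 2 * (m ^ 3 * H ^ 4 * t ^ 2) := by rw [Real.sq_sqrt m.cast_nonneg]; ring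
  calc logArg m d H K δ = rateArg m d H ε δ * (K * ε ^ 2) * (1 / ε) := by
        rw [logArg, rateArg]
        field_simp
    _ = rateArg m d H ε δ * (2400 ^ 2 * (m ^ 3 * H ^ 4 * t ^ 2)) * (1 / ε) := by rw [hKε]
    _ ≤ rateArg m d H ε δ * (2400 ^ 2 * (rateArg m d H ε δ ^ 3 * H ^ 4 * t ^ 2))
          * rateArg m d H ε δ := by gcongr
    _ = 2400 ^ 2 * (rateArg m d H ε δ ^ 5 * H ^ 4 * t ^ 2) := by ring

lemma log_2400_le : Real.log 2400 ≤ 8 := by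
  rw [Real.log_le_iff_le_exp (by norm_num)]
  calc (2400 : ℝ) ≤ 2.7 ^ 8 := by norm_num
    _ ≤ Real.exp 1 ^ 8 := by gcongr; linarith [Real.exp_one_gt_d9]
    _ = Real.exp 8 := Real.exp_one_pow 8

lemma log_le_div_four_add_one {t : ℝ} (ht : 0 < t) : Real.log t ≤ t / 4 + 1 := by
  have hdiv := Real.log_le_sub_one_of_pos (div_pos ht four_pos)
  have hfour : Real.log 4 = 2 * Real.log 2 := by
    rw [show (4 : ℝ) = 2 ^ 2 by norm_num, Real.log_pow, Nat.cast_two]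
  rw [Real.log_div ht.ne' four_ne_zero, hfour] at hdiv
  linarith [Real.log_two_lt_d9]

lemma log_le_of_le_pow {X R B t : ℝ} (hX : 0 < X) (hR : 0 < R) (hB : 1 ≤ B)
    (hlogR : 1 / 2 ≤ Real.log R) (ht : 100 * (B * Real.log R) ≤ t)
    (hle : X ≤ 2400 ^ 2 * (R ^ 5 * B ^ 4 * t ^ 2)) : Real.log X ≤ t := by
  have hBlog : B ≤ 2 * (B * Real.log R) := by nlinarith
  have hlog_le : Real.log R ≤ B * Real.log R := le_mul_of_one_le_left (by linarith) hB
  have ht0 : 0 < t := by linarith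
  have hlogX : Real.log X
      ≤ 2 * Real.log 2400 + (5 * Real.log R + 4 * Real.log B + 2 * Real.log t) := by
    refine (Real.log_le_log hX hle).trans_eq ?_
    rw [Real.log_mul (by positivity) (by positivity), Real.log_mul (by positivity) (by positivity),
      Real.log_mul (by positivity) (by positivity)]
    simp only [Real.log_pow, Nat.cast_ofNat]
  linarith [log_2400_le, log_le_div_four_add_one ht0,
    Real.log_le_sub_one_of_pos (by linarith : 0 < B)]

lemma mul_log_logArg_le (hm : 2 ≤ m) (hd : 1 ≤ d) (hH : 1 ≤ H) (hε : 0 < ε) (hεH : ε ≤ H)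
    (hδ : 0 < δ) (hδ1 : δ ≤ 1) (hK : episodeConst * rate m d H ε δ ≤ K) :
    2400 * (m * √m * H ^ 2) * Real.log (logArg m d H K δ) ≤ √K * ε := by
  have hK2 := two_le_of_rate_le hm hd hH hε hεH hδ hδ1 hK
  have hX := four_le_logArg hm hd hH hK2 hδ hδ1
  have hR : 0 < rateArg m d H ε δ := by rw [rateArg]; positivity
  have hD : 0 < 2400 * (m * √m * H ^ 2 : ℝ) := by positivity
  rw [← le_div_iff₀' hD]
  exact log_le_of_le_pow (by linarith) hR (by exact_mod_cast hH)
    (half_le_log_rateArg hm hd hε hεH hδ hδ1) ((le_div_iff₀' hD).mpr (mul_log_rateArg_le hε hK))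
    (logArg_le (by omega) hd hH hε hεH hδ hδ1 (mul_div_cancel₀ _ hD.ne'))

lemma sqrt_potential_le {ι : ℝ} (hι : 0 ≤ ι) (hmK : Real.log (m + K) ≤ ι) :
    √(K * (2 * (m * Real.log (m + K)))) ≤ √K * (3 / 2 * (√m * √ι)) := by
  rw [Real.sqrt_le_left (by positivity)]
  calc K * (2 * (m * Real.log (m + K))) ≤ K * (2 * (m * ι)) := by gcongr
    _ ≤ K * (9 / 4 * (m * ι)) := by gcongr; norm_num
    _ = √K ^ 2 * (9 / 4 * (√m ^ 2 * √ι ^ 2)) := by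
        rw [Real.sq_sqrt K.cast_nonneg, Real.sq_sqrt m.cast_nonneg, Real.sq_sqrt hι]
    _ = (√K * (3 / 2 * (√m * √ι))) ^ 2 := by ring

lemma sqrt_succ_le {ι : ℝ} (hm : 2 ≤ m) (hK : 1 ≤ K) (hι : 1 ≤ ι) :
    √(K + 1 : ℝ) ≤ √K * (3 / 2 * (√m * √ι)) := by
  have hmι : (2 : ℝ) ≤ m * ι :=
    (Nat.cast_le.mpr hm).trans (le_mul_of_one_le_right m.cast_nonneg hι)
  have hK' : (1 : ℝ) ≤ K := by exact_mod_cast hK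
  rw [Real.sqrt_le_left (by positivity)]
  calc (K : ℝ) + 1 ≤ K * (9 / 4 * (m * ι)) := by nlinarith
    _ = √K ^ 2 * (9 / 4 * (√m ^ 2 * √ι ^ 2)) := by
        rw [Real.sq_sqrt K.cast_nonneg, Real.sq_sqrt m.cast_nonneg,
          Real.sq_sqrt (zero_le_one.trans hι)]
    _ = (√K * (3 / 2 * (√m * √ι))) ^ 2 := by ring

lemma total_error_le (hm : 2 ≤ m) (hd : 1 ≤ d) (hH : 1 ≤ H) (hε : 0 < ε) (hεH : ε ≤ H)
    (hδ : 0 < δ) (hδ1 : δ ≤ 1) (hK : episodeConst * rate m d H ε δ ≤ K) :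
    4 * (H * (3 * (bonusCoeff 100 m d H K δ * √(K * (2 * (m * Real.log (m + K)))))
      + radius m H K (eventProb m H K (bonusCoeff 100 m d H K δ) δ) * √(K + 1))) ≤ K * ε := by
  have hK2 := two_le_of_rate_le hm hd hH hε hεH hδ hδ1 hK
  have hι := one_le_log_logArg hm hd hH hK2 hδ hδ1
  have hlog := mul_log_logArg_le hm hd hH hε hεH hδ hδ1 hK
  have hpotential := sqrt_potential_le (zero_le_one.trans hι)
    (log_add_le_log_logArg hm hd hH hK2 hδ hδ1)
  have hsucc := sqrt_succ_le hm (by omega : 1 ≤ K) hι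
  have hradius := radius_eventProb_le hm hd hH hK2 hδ hδ1
  rw [bonusCoeff_eq] at hradius ⊢
  generalize Real.log (logArg m d H K δ) = ι at *
  calc _ ≤ 4 * (H * (3 * (100 * (m * H * √ι) * (√K * (3 / 2 * (√m * √ι))))
          + 24 * (m * H * √ι) * (√K * (3 / 2 * (√m * √ι))))) := by gcongr
    _ = 1944 * (m * √m * H ^ 2) * √ι ^ 2 * √K := by ring
    _ ≤ 2400 * (m * √m * H ^ 2) * √ι ^ 2 * √K := by gcongr; norm_num
    _ = 2400 * (m * √m * H ^ 2) * ι * √K := by rw [Real.sq_sqrt (zero_le_one.trans hι)]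
    _ ≤ √K * ε * √K := by gcongr
    _ = K * ε := by rw [mul_right_comm, Real.mul_self_sqrt K.cast_nonneg]

end Rate

section Main

variable {m d H K : ℕ} {ε δ : ℝ}

/-- For one-dimensional features the rewards of each step are constant, so all policies have the
same value. -/
lemma guarantee_of_dim_one (cβ : ℝ) (d H K : ℕ) (hε : 0 < ε) (hδ : 0 < δ) :
    Guarantee.{u, v, w} cβ 1 d H K ε δ := by
  intro S A Ω _ _ _ φ M s₁ Ge Gp Pr _ s a r hM _
  refine ⟨Set.univ, MeasurableSet.univ, by rw [probReal_univ]; linarith, fun ω _ θ _ => ?_⟩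
  set π := planPolicy (bonusCoeff cβ 1 d H K δ) H φ Gp K (s · · ω) (a · · ω) (r · · ω) θ
  have : Nonempty (Policy S A) := ⟨π⟩
  have hopt : M.optValue H θ 0 s₁ ≤ M.value H θ π 0 s₁ := ciSup_le fun π' =>
    (M.valueN_eq_of_r_eq (H := H) (fun h hh z z' => hM.r_eq_r_of_dim_one hh z z')
      π' π (n := H - 0) (h := 0) (by omega) s₁).le
  linarith

lemma one_le_mul_netSize (hH : 1 ≤ H) (K m : ℕ) (L t : ℝ) :
    1 ≤ 4 * H * (K + 1) * netSize m L t :=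
  Nat.mul_pos (Nat.mul_pos (Nat.mul_pos four_pos hH) K.succ_pos) (netSize_pos m L t)

lemma eventProb_pos (hH : 1 ≤ H) (hδ : 0 < δ) (β : ℝ) : 0 < eventProb m H K β δ :=
  div_pos hδ (Nat.cast_pos.mpr (one_le_mul_netSize hH K m _ _))

lemma mul_ofReal_eventProb (hH : 1 ≤ H) (β δ : ℝ) :
    (4 * H * (K + 1) * netSize m (2 * H * K) (gridStep m K β) : ℕ)
      * ENNReal.ofReal (eventProb m H K β δ) = ENNReal.ofReal δ := by
  rw [← ENNReal.ofReal_natCast, ← ENNReal.ofReal_mul (Nat.cast_nonneg _), eventProb,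
    mul_div_cancel₀]
  exact Nat.cast_ne_zero.mpr (Nat.one_le_iff_ne_zero.mp (one_le_mul_netSize hH K m _ _))

lemma exists_measurableSet_one_sub_le {Ω : Type*} [MeasurableSpace Ω] {Pr : Measure Ω}
    [IsProbabilityMeasure Pr] {p : Ω → Prop} (hδ : 0 ≤ δ)
    (hp : Pr {ω | ¬ p ω} ≤ ENNReal.ofReal δ) :
    ∃ E, MeasurableSet E ∧ 1 - δ ≤ Pr.real E ∧ ∀ ω ∈ E, p ω := by
  have hmeas := measurableSet_toMeasurable Pr {ω | ¬ p ω}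
  refine ⟨(toMeasurable Pr {ω | ¬ p ω})ᶜ, hmeas.compl, ?_, fun ω hω =>
    not_not.mp fun hpω => hω (subset_toMeasurable _ _ hpω)⟩
  rw [probReal_compl_eq_one_sub hmeas, measureReal_def, measure_toMeasurable]
  exact sub_le_sub_left (ENNReal.toReal_le_of_le_ofReal hδ hp) 1

lemma guarantee_of_two_le_dim (hm : 2 ≤ m) (hd : 1 ≤ d) (hH : 1 ≤ H) (hε : 0 < ε) (hεH : ε ≤ H)
    (hδ : 0 < δ) (hδ1 : δ ≤ 1) (hK : episodeConst * rate m d H ε δ ≤ K) :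
    Guarantee.{u, v, w} 100 m d H K ε δ := by
  intro S A Ω _ _ _ φ M s₁ Ge Gp Pr _ s a r hM hrun
  have hK2 := two_le_of_rate_le hm hd hH hε hεH hδ hδ1 hK
  have hT := tuned_bonusCoeff hm hd hH hK2 hδ hδ1
  have hm1 : 1 ≤ m := by omega
  have hK1 : 1 ≤ K := by omega
  have hbad := (hrun.measure_not_goodData_le hM hm1 hT.bonus_nonneg hT.one_le_bound
    (gridStep_pos hm1 hK1 hT.bonus_nonneg) (mul_gridStep_le_one hm1 hK1 hT.bonus_nonneg)
    (eventProb_pos hH hδ _) Gp).trans_eq (mul_ofReal_eventProb hH _ δ)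
  obtain ⟨E, hE, hprob, hgood⟩ := exists_measurableSet_one_sub_le hδ.le hbad
  refine ⟨E, hE, hprob, fun ω hω θ hθ => ?_⟩
  exact le_of_mul_le_mul_left
    ((mul_optValue_sub_value_le hT hM (hgood ω hω) hθ).trans
      (total_error_le hm hd hH hε hεH hδ hδ1 hK)) (Nat.cast_pos.mpr hK1)

lemma guarantee_of_rate_le (hm : 1 ≤ m) (hd : 1 ≤ d) (hH : 1 ≤ H) (hε : 0 < ε) (hεH : ε ≤ H)
    (hδ : 0 < δ) (hδ1 : δ ≤ 1) (hK : episodeConst * rate m d H ε δ ≤ K) :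
    Guarantee.{u, v, w} 100 m d H K ε δ := by
  rcases hm.eq_or_lt with rfl | hm
  · exact guarantee_of_dim_one 100 d H K hε hδ
  · exact guarantee_of_two_le_dim hm hd hH hε hεH hδ hδ1 hK

lemma episodeConst_pos : 0 < episodeConst := by norm_num [episodeConst]

lemma rate_nonneg (m d H : ℕ) (ε δ : ℝ) : 0 ≤ rate m d H ε δ := by
  rw [rate]
  positivity

/-- The rate may vanish for one-dimensional features, where no episode is needed. -/
lemma exists_le_rate_guarantee (hm : 1 ≤ m) (hd : 1 ≤ d) (hH : 1 ≤ H) (hε : 0 < ε)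
    (hεH : ε ≤ H) (hδ : 0 < δ) (hδ1 : δ ≤ 1) :
    ∃ K : ℕ, K ≤ (episodeConst + 1) * rate m d H ε δ ∧ Guarantee.{u, v, w} 100 m d H K ε δ := by
  rcases hm.eq_or_lt with rfl | hm
  · refine ⟨0, ?_, guarantee_of_dim_one 100 d H 0 hε hδ⟩
    exact Nat.cast_zero.trans_le
      (mul_nonneg (add_pos episodeConst_pos one_pos).le (rate_nonneg 1 d H ε δ))
  · refine ⟨⌈episodeConst * rate m d H ε δ⌉₊, ?_,
      guarantee_of_two_le_dim hm hd hH hε hεH hδ hδ1 (Nat.le_ceil _)⟩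
    linarith [one_le_rate hm hd hH hε hεH hδ hδ1,
      Nat.ceil_lt_add_one (mul_nonneg episodeConst_pos.le (rate_nonneg m d H ε δ))]

end Main

end RewardFree

end

theorem mainTheorem4 :
    ∃ cβ : ℝ, 0 < cβ ∧
      (∃ cK : ℝ, 0 < cK ∧ ∀ (m d H : ℕ), 1 ≤ m → 1 ≤ d → 1 ≤ H →
        ∀ ε δ : ℝ, 0 < ε → ε ≤ H → 0 < δ → δ ≤ 1 →
          ∀ K : ℕ, cK * RewardFree.rate m d H ε δ ≤ K →
            RewardFree.Guarantee.{u, v, w} cβ m d H K ε δ) ∧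
      (∃ C : ℝ, 0 < C ∧ ∀ (m d H : ℕ), 1 ≤ m → 1 ≤ d → 1 ≤ H →
        ∀ ε δ : ℝ, 0 < ε → ε ≤ H → 0 < δ → δ ≤ 1 →
          ∃ K : ℕ, (K : ℝ) ≤ C * RewardFree.rate m d H ε δ ∧
            RewardFree.Guarantee.{u, v, w} cβ m d H K ε δ) := by
  refine ⟨100, by norm_num, ⟨RewardFree.episodeConst, RewardFree.episodeConst_pos, ?_⟩,
    ⟨RewardFree.episodeConst + 1, add_pos RewardFree.episodeConst_pos one_pos, ?_⟩⟩
  · intro m d H hm hd hH ε δ hε hεH hδ hδ1 K hK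
    exact RewardFree.guarantee_of_rate_le hm hd hH hε hεH hδ hδ1 hK
  · intro m d H hm hd hH ε δ hε hεH hδ hδ1
    exact RewardFree.exists_le_rate_guarantee hm hd hH hε hεH hδ hδ1
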